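/- Let $\mathbb S=\mathbb R/2\pi\mathbb Z$ with the arc-length distance $d_{\mathbb S}$ and arc-length measure, $I=[0,1]$, and $G=\mathbb S\times\mathbb R\times I$ with the distance $d_G(P,P')=\sqrt{d_{\mathbb S}(\theta,\theta')^2+(\omega-\omega')^2+(x-x')^2}$ for $P=(\theta,\omega,x)$, $P'=(\theta',\omega',x')$. For Borel probability measures $\mu,\nu$ on $G$ let $d(\mu,\nu)=\sup_f\left|\int_G f\,d\mu-\int_G f\,d\nu\right|$, the supremum being over all $f:G\to[0,1]$ with $|f(P)-f(Q)|\le d_G(P,Q)$ for all $P,Q\in G$. Let $K\in\mathbb R$, let $W:I^2\to\mathbb R$ be symmetric and Lipschitz continuous, and let $\xi_{ni}\in I$ ($n\ge1$, $1\le i\le n$) be points with $\lim_{n\to\infty}n^{-1}\sum_{i=1}^n f(\xi_{ni})=\int_I f(x)\,dx$ for all $f\in C(I)$. Let $g$ be a continuous probability density on $\mathbb R$, and let $\hat\rho^0_{\theta|\omega}(\theta,\omega,\xi)\ge 0$ be a continuous function on $G$ which is uniformly continuous in $\xi$, uniformly with respect to $(\theta,\omega)\in\mathbb S\times\mathbb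 R$, with $\int_{\mathbb S}\hat\rho^0_{\theta|\omega}(\phi,\omega,\xi)\,d\phi=1$ for all $(\omega,\xi)\in\mathbb R\times I$. Let $\omega_1,\omega_2,\dots$ be IID random variables with density $g$. For every $n$ let $\theta^0_{n1},\dots,\theta^0_{nn}$ be $\mathbb S$-valued random variables on the same probability space which, conditionally on $\omega_1,\dots,\omega_n$, are independent with densities $\hat\rho^0_{\theta|\omega}(\cdot,\omega_i,\xi_{ni})$, $1\le i\le n$ (no assumption is made on the joint law for different $n$). Let $T>0$ and let $\theta_{ni}(t)\in\mathbb S$, $t\in[0,T]$, solve $$\dot\theta_{ni}=\omega_i+\frac Kn\sum_{j=1}^n W(\xi_{ni},\xi_{nj})\sin(\theta_{nj}-\theta_{ni}),\qquad \theta_{ni}(0)=\theta^0_{ni},\qquad 1\le i\le n,$$ and put $\mu^n_t=n^{-1}\sum_{i=1}^n\delta_{(\theta_{ni}(t),\,\omega_i,\,\xi_{ni})}$. A weak solution on $[0,T]$ of the initial value problem $$\partial_t\hat\rho+\partial_\theta(\hat\rho\,V)=0,\qquad V(t,\theta,\omega,x)=\omega+K\int_I\int_{\mathbb R}\int_{\mathbb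 S}W(x,y)\sin(\phi-\theta)\,\hat\rho(t,\phi,\lambda,y)\,d\phi\,d\lambda\,dy,$$ $$\hat\rho(0,\theta,\omega,x)=\hat\rho^0_{\theta|\omega}(\theta,\omega,x)\,g(\omega)=:\hat\rho^0(\theta,\omega,x)$$ is a family $\hat\rho(t,\cdot)$, $t\in[0,T]$, of probability densities on $G$ such that $t\mapsto\int_G f\,\hat\rho(t,P)\,dP$ is continuous on $[0,T]$ for every bounded continuous $f$ on $G$ and $$\int_G\psi(\tau,P)\hat\rho(\tau,P)\,dP=\int_G\psi(0,P)\hat\rho^0(P)\,dP+\int_0^\tau\!\int_G\left(\partial_t\psi+V\,\partial_\theta\psi\right)\hat\rho\,dP\,dt$$ for all $\tau\in[0,T]$ and all $C^1$ functions $\psi(t,\theta,\omega,x)$ that vanish for large $|\omega|$. Then such a weak solution exists, and for every weak solution $\hat\rho$, with $\mu_t(A)=\int_A\hat\rho(t,P)\,dP$, $$\lim_{n\to\infty}\ \sup_{t\in[0,T]}d(\mu^n_t,\mu_t)=0\quad\text{almost surely}.$$ -/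

import Mathlib

open MeasureTheory ProbabilityTheory Filter Topology
open scoped Real

namespace KuramotoMF

noncomputable section

/-- The unit interval `I = [0,1]`. -/
abbrev I : Type := unitInterval

/-- The circle `ℝ / 2πℤ`. Its Mathlib distance is the arc-length distance
`min (|θ - θ'|, 2π - |θ - θ'|)` (for representatives in `[0, 2π)`), and its `volume` is the
arc-length measure, of total mass `2π`. -/
abbrev Phase : Type := AddCircle (2 * π)

instance factTwoPiPos : Fact ((0 : ℝ) < 2 * π) := ⟨Real.two_pi_pos⟩

/-- The sine function on the circle. -/
def sinPhase : Phase → ℝ := Real.sin_periodic.lift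

/-- The state space `G = 𝕊 × ℝ × I` of triples (phase, intrinsic frequency, position). -/
abbrev G : Type := Phase × ℝ × I

/-- The Euclidean product distance on `G`. -/
def distG (P Q : G) : ℝ :=
  √(dist P.1 Q.1 ^ 2 + (P.2.1 - Q.2.1) ^ 2 + ((P.2.2 : ℝ) - (Q.2.2 : ℝ)) ^ 2)

/-- The class of functions `f : G → [0,1]` with `|f P - f Q| ≤ d_G (P, Q)`. -/
def lipClass : Set (G → ℝ) :=
  {f | (∀ P, f P ∈ Set.Icc (0 : ℝ) 1) ∧ ∀ P Q, |f P - f Q| ≤ distG P Q}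

/-- The bounded Lipschitz distance between (probability) measures on `G`. -/
def blDist (μ ν : Measure G) : ℝ :=
  ⨆ f : lipClass, |∫ P, f.1 P ∂μ - ∫ P, f.1 P ∂ν|

/-- The empirical measure `n⁻¹ ∑ᵢ δ_{Pᵢ}` of `n` points of `G`. -/
def empiricalMeasure {n : ℕ} (p : Fin n → G) : Measure G :=
  (n : ENNReal)⁻¹ • ∑ i, Measure.dirac (p i)

/-- The triangular array `ξ` of points of `I` is asymptotically uniformly distributed:
`n⁻¹ ∑ᵢ f (ξ n i) → ∫_I f` for every continuous `f`. -/
def Equidistributed (ξ : (n : ℕ) → Fin n → I) : Prop :=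
  ∀ f : C(I, ℝ), Tendsto (fun n : ℕ => (n : ℝ)⁻¹ * ∑ i, f (ξ n i)) atTop (𝓝 (∫ x, f x))

/-- `θ` solves on `[0,T]` the Kuramoto system
`θᵢ' = wᵢ + (K / n) ∑ⱼ W (ξᵢ, ξⱼ) sin (θⱼ - θᵢ)`, `θᵢ(0) = θ⁰ᵢ`.
The derivative of a circle-valued curve is that of a real-valued lift. -/
def IsKuramotoSolution (K : ℝ) (W : I → I → ℝ) (T : ℝ) {n : ℕ} (ξ : Fin n → I)
    (w : Fin n → ℝ) (θ₀ : Fin n → Phase) (θ : Fin n → ℝ → Phase) : Prop :=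
  (∀ i, θ i 0 = θ₀ i) ∧
  ∃ ϑ : Fin n → ℝ → ℝ,
    (∀ i, ∀ t ∈ Set.Icc 0 T, (ϑ i t : Phase) = θ i t) ∧
    ∀ i, ∀ t ∈ Set.Icc 0 T,
      HasDerivWithinAt (ϑ i)
        (w i + K * (n : ℝ)⁻¹ * ∑ j, W (ξ i) (ξ j) * Real.sin (ϑ j t - ϑ i t))
        (Set.Icc 0 T) t

/-- The mean-field velocity at the point `P = (θ, ω, x)` generated by the density `r` on `G`:
`V = ω + K ∫ W (x, y) sin (φ - θ) r (φ, λ, y) dφ dλ dy`. -/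
def velocity (K : ℝ) (W : I → I → ℝ) (r : G → ℝ) (P : G) : ℝ :=
  P.2.1 + K * ∫ Q : G, W P.2.2 Q.2.2 * sinPhase (Q.1 - P.1) * r Q

/-- The derivative of a real function on the circle. -/
def derivPhase (f : Phase → ℝ) (θ : Phase) : ℝ :=
  deriv (fun s : ℝ => f (θ + (s : Phase))) 0

/-- Test functions `ψ (t, θ, ω, x)`: of class `C¹` in all variables and vanishing for large `|ω|`.
Only their values for `t ∈ [0,T]` and `x ∈ I` matter, so that no condition on the support in the
other variables is needed; the composition with `ℝ → ℝ / 2πℤ` expresses regularity in `θ`. -/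
structure IsTestFunction (ψ : ℝ → Phase → ℝ → ℝ → ℝ) : Prop where
  contDiff : ContDiff ℝ 1
    (fun p : ℝ × ℝ × ℝ × ℝ => ψ p.1 (p.2.1 : Phase) p.2.2.1 p.2.2.2)
  support : ∃ R : ℝ, ∀ t θ ω x, R < |ω| → ψ t θ ω x = 0

/-- `ρ` is a weak solution on `[0,T]`, in the class of weakly continuous curves of probability
densities on `G`, of `∂ₜ ρ + ∂_θ (ρ V) = 0`, where `V = V[ρ]` is the mean-field velocity, with
initial density `ρ₀`. -/
structure IsWeakSolution (K : ℝ) (W : I → I → ℝ) (T : ℝ) (ρ₀ : G → ℝ) (ρ : ℝ → G → ℝ) :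
    Prop where
  measurable : ∀ t ∈ Set.Icc 0 T, Measurable (ρ t)
  nonneg : ∀ t ∈ Set.Icc 0 T, ∀ P, 0 ≤ ρ t P
  integrable : ∀ t ∈ Set.Icc 0 T, Integrable (ρ t)
  integral_eq_one : ∀ t ∈ Set.Icc 0 T, ∫ P, ρ t P = 1
  weaklyContinuous : ∀ f : BoundedContinuousFunction G ℝ,
    ContinuousOn (fun t => ∫ P, f P * ρ t P) (Set.Icc 0 T)
  weak : ∀ ψ, IsTestFunction ψ → ∀ τ ∈ Set.Icc 0 T,
    ∫ P : G, ψ τ P.1 P.2.1 P.2.2 * ρ τ P =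
      (∫ P : G, ψ 0 P.1 P.2.1 P.2.2 * ρ₀ P) +
      ∫ t in (0 : ℝ)..τ, ∫ P : G,
        (deriv (fun s => ψ s P.1 P.2.1 P.2.2) t +
          velocity K W (ρ t) P * derivPhase (fun θ => ψ t θ P.2.1 P.2.2) P.1) * ρ t P

/-- The measure `μ (A) = ∫_A r dP` on `G` with density `r`. -/
def densityMeasure (r : G → ℝ) : Measure G :=
  volume.withDensity (fun P => ENNReal.ofReal (r P))

/-- The sampling of the random data. The frequencies `ω 0, ω 1, …` are IID with density `g`, and
for every `n`, conditionally on the frequencies, the `n` initial phases are independent, the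
`i`-th one having the density `q (·, ωᵢ, ξ n i)`. -/
structure IsSampled {Ω : Type*} [MeasurableSpace Ω] (Pr : Measure Ω) [IsFiniteMeasure Pr]
    (g : ℝ → ℝ) (q : Phase → ℝ → I → ℝ) (ξ : (n : ℕ) → Fin n → I)
    (ω : ℕ → Ω → ℝ) (θ₀ : (n : ℕ) → Fin n → Ω → Phase) : Prop where
  measurable_freq : ∀ i, Measurable (ω i)
  indep_freq : iIndepFun ω Pr
  law_freq : ∀ i, Pr.map (ω i) = volume.withDensity (fun s => ENNReal.ofReal (g s))
  measurable_phase : ∀ n i, Measurable (θ₀ n i)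
  condLaw_phase : ∀ n : ℕ,
    ∀ᵐ w ∂(Pr.map (fun z (i : Fin n) => ω i z)),
      condDistrib (fun z (i : Fin n) => θ₀ n i z) (fun z (i : Fin n) => ω i z) Pr w =
        Measure.pi (fun i : Fin n =>
          volume.withDensity (fun φ : Phase => ENNReal.ofReal (q φ (w i) (ξ n i))))

end

end KuramotoMF

/-!
A weak solution and the empirical measure of the particle system are both moved, up to `o(h)`, by
the Euler steps of length `h` of the same mean-field velocity field. One such step from two measures
increases their bounded Lipschitz distance by a factor `1 + C h` at most, since the velocity is
Lipschitz continuous both in the point and in the measure, so a discrete Gronwall argument bounds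
the distance at time `t` by `exp (C t)` times the initial one. As the velocity grows linearly in the
frequency, this is carried out for the distance weighted by a cutoff of the frequency; the error is
controlled by the frequency tails, which are conserved in time.

At time `0` the empirical measures converge almost surely: the triangular array has independent
rows, so Hoeffding's inequality and the Borel–Cantelli lemma give a strong law for each observable,
and finitely many observables determine the bounded Lipschitz distance up to a small error.

For existence, the interaction only rotates the phases, so the characteristic flow is a fixed point
for the phase displacement, found by contraction in an exponentially weighted norm. Its time-`t` map
is bi-Lipschitz in the phase, hence preserves absolute continuity, and the density of the image of
the initial law is a weak solution.
-/

namespace KuramotoMF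

noncomputable section

lemma continuous_sinPhase : Continuous sinPhase :=
  continuous_quot_lift _ Real.continuous_sin

lemma abs_sinPhase_le_one (a : Phase) : |sinPhase a| ≤ 1 :=
  QuotientAddGroup.induction_on a Real.abs_sin_le_one

lemma exists_coe_eq_abs_eq_norm (a : Phase) : ∃ u : ℝ, (u : Phase) = a ∧ |u| = ‖a‖ := by
  obtain ⟨x, rfl⟩ := QuotientAddGroup.mk_surjective a
  refine ⟨x - round ((2 * π)⁻¹ * x) * (2 * π), ?_, (AddCircle.norm_eq (2 * π)).symm⟩
  rw [AddCircle.coe_sub, ← zsmul_eq_mul, AddCircle.coe_zsmul, AddCircle.coe_period, smul_zero,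
    sub_zero]

lemma exists_eq_add_coe_abs_eq_dist (a b : Phase) :
    ∃ u : ℝ, a = b + (u : Phase) ∧ |u| = dist a b := by
  obtain ⟨u, hu, hu'⟩ := exists_coe_eq_abs_eq_norm (a - b)
  exact ⟨u, by rw [hu, add_sub_cancel], by rw [hu', dist_eq_norm]⟩

lemma abs_sinPhase_sub_le (a b : Phase) : |sinPhase a - sinPhase b| ≤ dist a b := by
  obtain ⟨u, rfl, hu⟩ := exists_eq_add_coe_abs_eq_dist a b
  rw [← hu]
  induction b using QuotientAddGroup.induction_on with
  | H y =>
    have h := Real.abs_sin_sub_sin_le (y + u) y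
    rwa [add_sub_cancel_left] at h

lemma norm_coe_phase_le (u : ℝ) : ‖(u : Phase)‖ ≤ |u| :=
  QuotientAddGroup.norm_mk_le_norm (S := AddSubgroup.zmultiples (2 * π)) (m := u)

lemma dist_add_coe_le (a b : Phase) (u v : ℝ) :
    dist (a + (u : Phase)) (b + (v : Phase)) ≤ dist a b + |u - v| :=
  calc dist (a + (u : Phase)) (b + (v : Phase))
      ≤ dist a b + dist (u : Phase) v := dist_add_add_le _ _ _ _
    _ ≤ dist a b + |u - v| := by
      gcongr
      rw [dist_eq_norm, ← AddCircle.coe_sub]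
      exact norm_coe_phase_le _

lemma dist_add_coe_self_le (a : Phase) (u v : ℝ) :
    dist (a + (u : Phase)) (a + (v : Phase)) ≤ |u - v| := by
  simpa only [dist_self, zero_add] using dist_add_coe_le a a u v

lemma distG_nonneg (P Q : G) : 0 ≤ distG P Q := Real.sqrt_nonneg _

lemma sq_distG (P Q : G) :
    distG P Q ^ 2 = dist P.1 Q.1 ^ 2 + (P.2.1 - Q.2.1) ^ 2 + ((P.2.2 : ℝ) - Q.2.2) ^ 2 :=
  Real.sq_sqrt (by positivity)

lemma dist_phase_le_distG (P Q : G) : dist P.1 Q.1 ≤ distG P Q :=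
  Real.le_sqrt_of_sq_le <| by
    rw [add_assoc]
    exact le_add_of_nonneg_right (by positivity)

lemma abs_freq_sub_le_distG (P Q : G) : |P.2.1 - Q.2.1| ≤ distG P Q :=
  Real.abs_le_sqrt <| by
    rw [add_right_comm]
    exact le_add_of_nonneg_left (by positivity)

lemma abs_pos_sub_le_distG (P Q : G) : |(P.2.2 : ℝ) - Q.2.2| ≤ distG P Q :=
  Real.abs_le_sqrt (le_add_of_nonneg_left (by positivity))

lemma distG_le_add_of_phase {P Q P' Q' : G} {c : ℝ} (hc : 0 ≤ c)
    (h : dist P'.1 Q'.1 ≤ dist P.1 Q.1 + c) (hP : P'.2 = P.2) (hQ : Q'.2 = Q.2) :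
    distG P' Q' ≤ distG P Q + c := by
  refine Real.sqrt_le_iff.mpr ⟨add_nonneg (distG_nonneg P Q) hc, ?_⟩
  rw [hP, hQ]
  nlinarith [sq_distG P Q, dist_phase_le_distG P Q, dist_nonneg (x := P'.1) (y := Q'.1)]

lemma distG_mk_mk (a b : Phase) (p : ℝ × I) : distG (a, p) (b, p) = dist a b := by
  simp [distG, Real.sqrt_sq dist_nonneg]

lemma distG_le_add (P Q : G) :
    distG P Q ≤ dist P.1 Q.1 + |P.2.1 - Q.2.1| + |(P.2.2 : ℝ) - Q.2.2| := by
  refine Real.sqrt_le_iff.mpr ⟨by positivity, ?_⟩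
  rw [← sq_abs (P.2.1 - Q.2.1), ← sq_abs ((P.2.2 : ℝ) - Q.2.2)]
  have ha : 0 ≤ dist P.1 Q.1 := dist_nonneg
  have hb := abs_nonneg (P.2.1 - Q.2.1)
  have hc := abs_nonneg ((P.2.2 : ℝ) - Q.2.2)
  nlinarith [mul_nonneg ha hb, mul_nonneg ha hc, mul_nonneg hb hc]

lemma distG_le_three_mul_dist (P Q : G) : distG P Q ≤ 3 * dist P Q := by
  have hθ : dist P.1 Q.1 ≤ dist P Q := le_max_left _ _
  have h2 : dist P.2 Q.2 ≤ dist P Q := le_max_right _ _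
  have hω : |P.2.1 - Q.2.1| ≤ dist P.2 Q.2 := le_max_left _ _
  have hx : |(P.2.2 : ℝ) - Q.2.2| ≤ dist P.2 Q.2 := le_max_right _ _
  linarith [distG_le_add P Q]

lemma continuous_of_abs_sub_le_distG {F : G → ℝ} {c : ℝ}
    (h : ∀ P Q, |F P - F Q| ≤ c * distG P Q) : Continuous F := by
  refine (LipschitzWith.of_dist_le' (K := |c| * 3) fun P Q => ?_).continuous
  calc |F P - F Q| ≤ c * distG P Q := h P Q
    _ ≤ |c| * (3 * dist P Q) :=
      mul_le_mul (le_abs_self c) (distG_le_three_mul_dist P Q) (distG_nonneg P Q) (abs_nonneg c)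
    _ = |c| * 3 * dist P Q := by ring

lemma continuous_of_mem_lipClass {f : G → ℝ} (hf : f ∈ lipClass) : Continuous f :=
  continuous_of_abs_sub_le_distG (c := 1) (by simpa using hf.2)

lemma abs_le_one_of_mem_lipClass {f : G → ℝ} (hf : f ∈ lipClass) (P : G) : |f P| ≤ 1 :=
  abs_le.mpr ⟨by linarith [(hf.1 P).1], (hf.1 P).2⟩

lemma zero_mem_lipClass : (fun _ => 0 : G → ℝ) ∈ lipClass :=
  ⟨fun _ => by simp, fun P Q => by simpa using distG_nonneg P Q⟩

instance : Nonempty lipClass := ⟨⟨_, zero_mem_lipClass⟩⟩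

lemma div_mem_lipClass {F : G → ℝ} {c : ℝ} (hc : 0 < c) (hF : ∀ P, F P ∈ Set.Icc 0 c)
    (h : ∀ P Q, |F P - F Q| ≤ c * distG P Q) : (fun P => F P / c) ∈ lipClass := by
  refine ⟨fun P => ⟨div_nonneg (hF P).1 hc.le, (div_le_one hc).mpr (hF P).2⟩, fun P Q => ?_⟩
  rw [← sub_div, abs_div, abs_of_pos hc, div_le_iff₀' hc]
  exact h P Q

lemma abs_integral_le_of_abs_le {α : Type*} [MeasurableSpace α] {μ : Measure α}
    [IsProbabilityMeasure μ] {F : α → ℝ} {c : ℝ} (h : ∀ P, |F P| ≤ c) : |∫ P, F P ∂μ| ≤ c := by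
  simpa using norm_integral_le_of_norm_le_const (μ := μ) (f := F) (Eventually.of_forall h)

/-- The bounded Lipschitz distance weighted by a function `χ` of the frequency, which will be a
cutoff: the velocity field grows linearly in the frequency. -/
def cutDist (χ : ℝ → ℝ) (μ ν : Measure G) : ℝ :=
  ⨆ f : lipClass, |∫ P, χ P.2.1 * f.1 P ∂μ - ∫ P, χ P.2.1 * f.1 P ∂ν|

lemma blDist_eq_cutDist_one (μ ν : Measure G) : blDist μ ν = cutDist (fun _ => 1) μ ν := by
  simp only [blDist, cutDist, one_mul]

lemma cutDist_nonneg (χ : ℝ → ℝ) (μ ν : Measure G) : 0 ≤ cutDist χ μ ν :=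
  Real.iSup_nonneg fun _ => abs_nonneg _

lemma blDist_nonneg (μ ν : Measure G) : 0 ≤ blDist μ ν :=
  Real.iSup_nonneg fun _ => abs_nonneg _

lemma blDist_comm (μ ν : Measure G) : blDist μ ν = blDist ν μ := by
  simp_rw [blDist, abs_sub_comm]

lemma cutDist_le {χ : ℝ → ℝ} {μ ν : Measure G} {c : ℝ}
    (h : ∀ f ∈ lipClass, |∫ P, χ P.2.1 * f P ∂μ - ∫ P, χ P.2.1 * f P ∂ν| ≤ c) :
    cutDist χ μ ν ≤ c :=
  ciSup_le fun f => h f.1 f.2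

lemma blDist_le {μ ν : Measure G} {c : ℝ}
    (h : ∀ f ∈ lipClass, |∫ P, f P ∂μ - ∫ P, f P ∂ν| ≤ c) : blDist μ ν ≤ c :=
  ciSup_le fun f => h f.1 f.2

lemma abs_weight_mul_le {χ : ℝ → ℝ} (hχ : ∀ s, |χ s| ≤ 1) {f : G → ℝ} {c : ℝ}
    (h : ∀ P, |f P| ≤ c) (P : G) : |χ P.2.1 * f P| ≤ c :=
  calc |χ P.2.1 * f P| = |χ P.2.1| * |f P| := abs_mul _ _
    _ ≤ 1 * c := mul_le_mul (hχ _) (h P) (abs_nonneg _) zero_le_one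
    _ = c := one_mul c

section ProbabilityMeasures

variable {χ : ℝ → ℝ} (μ ν : Measure G) [IsProbabilityMeasure μ] [IsProbabilityMeasure ν]

lemma bddAbove_range_cutDist (hχ : ∀ s, |χ s| ≤ 1) : BddAbove (Set.range fun f : lipClass =>
    |∫ P, χ P.2.1 * f.1 P ∂μ - ∫ P, χ P.2.1 * f.1 P ∂ν|) := by
  refine ⟨1 + 1, Set.forall_mem_range.mpr fun f => (abs_sub _ _).trans ?_⟩
  have h := abs_weight_mul_le hχ (abs_le_one_of_mem_lipClass f.2)
  exact add_le_add (abs_integral_le_of_abs_le h) (abs_integral_le_of_abs_le h)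

lemma abs_integral_sub_le_cutDist (hχ : ∀ s, |χ s| ≤ 1) {f : G → ℝ} (hf : f ∈ lipClass) :
    |∫ P, χ P.2.1 * f P ∂μ - ∫ P, χ P.2.1 * f P ∂ν| ≤ cutDist χ μ ν :=
  le_ciSup (bddAbove_range_cutDist μ ν hχ) ⟨f, hf⟩

lemma abs_integral_sub_le_mul_cutDist (hχ : ∀ s, |χ s| ≤ 1) {F : G → ℝ} {c : ℝ} (hc : 0 < c)
    (hF : ∀ P, F P ∈ Set.Icc 0 c) (h : ∀ P Q, |F P - F Q| ≤ c * distG P Q) :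
    |∫ P, χ P.2.1 * F P ∂μ - ∫ P, χ P.2.1 * F P ∂ν| ≤ c * cutDist χ μ ν := by
  have key := abs_integral_sub_le_cutDist μ ν hχ (div_mem_lipClass hc hF h)
  simp_rw [← mul_div_assoc, integral_div] at key
  rwa [← sub_div, abs_div, abs_of_pos hc, div_le_iff₀' hc] at key

lemma abs_integral_sub_le_blDist {f : G → ℝ} (hf : f ∈ lipClass) :
    |∫ P, f P ∂μ - ∫ P, f P ∂ν| ≤ blDist μ ν := by
  simpa only [blDist_eq_cutDist_one, one_mul] using
    abs_integral_sub_le_cutDist μ ν (χ := fun _ => 1) (by simp) hf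

lemma abs_integral_sub_le_mul_blDist {F : G → ℝ} {a c : ℝ} (hc : 0 ≤ c)
    (hF : ∀ P, F P ∈ Set.Icc a (a + c)) (h : ∀ P Q, |F P - F Q| ≤ c * distG P Q) :
    |∫ P, F P ∂μ - ∫ P, F P ∂ν| ≤ c * blDist μ ν := by
  rcases hc.eq_or_lt with rfl | hc
  · obtain rfl : F = fun _ => a := funext fun P =>
      le_antisymm ((hF P).2.trans_eq (add_zero a)) (hF P).1
    simp
  have hshift : ∀ (η : Measure G) [IsProbabilityMeasure η],
      ∫ P, (F P - a) ∂η = ∫ P, F P ∂η - a := fun η _ => by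
    rw [integral_sub (.of_mem_Icc a (a + c) (continuous_of_abs_sub_le_distG h).aemeasurable
      (Eventually.of_forall hF)) (integrable_const a)]
    simp
  have key := abs_integral_sub_le_mul_cutDist μ ν (χ := fun _ => 1) (F := fun P => F P - a)
    (by simp) hc (fun P => ⟨by linarith [(hF P).1], by linarith [(hF P).2]⟩)
    (by simpa only [sub_sub_sub_cancel_right] using h)
  simpa only [one_mul, hshift, sub_sub_sub_cancel_right, ← blDist_eq_cutDist_one] using key

end ProbabilityMeasures

/-- `W` is bounded by `B`, and Lipschitz continuous with constant `B` for the `ℓ¹` distance. -/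
structure KernelBound (W : I → I → ℝ) (B : ℝ) : Prop where
  bound : ∀ x y, |W x y| ≤ B
  lip : ∀ x₁ y₁ x₂ y₂ : I,
    |W x₁ y₁ - W x₂ y₂| ≤ B * (|(x₁ : ℝ) - x₂| + |(y₁ : ℝ) - y₂|)

lemma sqrt_sq_add_sq_le_abs_add_abs (a b : ℝ) : √(a ^ 2 + b ^ 2) ≤ |a| + |b| := by
  refine Real.sqrt_le_iff.mpr ⟨by positivity, ?_⟩
  nlinarith [sq_abs a, sq_abs b, mul_nonneg (abs_nonneg a) (abs_nonneg b)]

lemma exists_kernelBound {W : I → I → ℝ} {L : ℝ} (hW : ∀ x₁ y₁ x₂ y₂ : I, |W x₁ y₁ - W x₂ y₂| ≤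
      L * √(((x₁ : ℝ) - (x₂ : ℝ)) ^ 2 + ((y₁ : ℝ) - (y₂ : ℝ)) ^ 2)) : ∃ B, KernelBound W B := by
  have hlip (x₁ y₁ x₂ y₂ : I) :
      |W x₁ y₁ - W x₂ y₂| ≤ |L| * (|(x₁ : ℝ) - x₂| + |(y₁ : ℝ) - y₂|) :=
    (hW _ _ _ _).trans (mul_le_mul (le_abs_self L) (sqrt_sq_add_sq_le_abs_add_abs _ _)
      (Real.sqrt_nonneg _) (abs_nonneg _))
  have hI (x : I) : |(x : ℝ) - (0 : I)| ≤ 1 := by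
    simpa [abs_of_nonneg x.2.1] using x.2.2
  refine ⟨|W 0 0| + 2 * |L|, fun x y => ?_, fun x₁ y₁ x₂ y₂ => (hlip x₁ y₁ x₂ y₂).trans ?_⟩
  · have htri : |W x y| ≤ |W x y - W 0 0| + |W 0 0| := by
      simpa only [sub_add_cancel] using abs_add_le (W x y - W 0 0) (W 0 0)
    nlinarith [abs_nonneg L, hlip x y 0 0, hI x, hI y]
  · gcongr
    linarith [abs_nonneg L, abs_nonneg (W 0 0)]

namespace KernelBound

variable {W : I → I → ℝ} {B : ℝ}

lemma nonneg (hW : KernelBound W B) : 0 ≤ B := (abs_nonneg _).trans (hW.bound 0 0)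

lemma continuous (hW : KernelBound W B) : Continuous fun p : I × I => W p.1 p.2 := by
  refine (LipschitzWith.of_dist_le' (K := B * 2) fun p q => ?_).continuous
  have h₁ : |(p.1 : ℝ) - q.1| ≤ dist p q := le_max_left _ _
  have h₂ : |(p.2 : ℝ) - q.2| ≤ dist p q := le_max_right _ _
  calc |W p.1 p.2 - W q.1 q.2|
      ≤ B * (|(p.1 : ℝ) - q.1| + |(p.2 : ℝ) - q.2|) := hW.lip _ _ _ _
    _ ≤ B * (dist p q + dist p q) := by gcongr; exact hW.nonneg
    _ = B * 2 * dist p q := by ring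

end KernelBound

/-- The interaction of an oscillator at `P` with an oscillator at `Q`. -/
def coupling (W : I → I → ℝ) (P Q : G) : ℝ := W P.2.2 Q.2.2 * sinPhase (Q.1 - P.1)

/-- The mean coupling of an oscillator at `P` with oscillators distributed according to `μ`. -/
def drift (W : I → I → ℝ) (μ : Measure G) (P : G) : ℝ := ∫ Q, coupling W P Q ∂μ

/-- The mean-field velocity at `P` generated by the measure `μ`: the analogue of `velocity` for
measures without a density. -/
def vel (K : ℝ) (W : I → I → ℝ) (μ : Measure G) (P : G) : ℝ := P.2.1 + K * drift W μ P

section Coupling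

variable {W : I → I → ℝ} {B : ℝ}

lemma continuous_coupling (hW : KernelBound W B) :
    Continuous fun p : G × G => coupling W p.1 p.2 :=
  (hW.continuous.comp (f := fun p : G × G => (p.1.2.2, p.2.2.2)) (by fun_prop)).mul
    (continuous_sinPhase.comp (by fun_prop))

lemma abs_coupling_le (hW : KernelBound W B) (P Q : G) : |coupling W P Q| ≤ B :=
  calc |coupling W P Q| = |W P.2.2 Q.2.2| * |sinPhase (Q.1 - P.1)| := abs_mul _ _
    _ ≤ B * 1 := mul_le_mul (hW.bound _ _) (abs_sinPhase_le_one _) (abs_nonneg _) hW.nonneg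
    _ = B := mul_one B

lemma abs_coupling_sub_le (hW : KernelBound W B) (P Q P' Q' : G) :
    |coupling W P Q - coupling W P' Q'| ≤
      B * (dist P.1 P'.1 + |(P.2.2 : ℝ) - P'.2.2| + (dist Q.1 Q'.1 + |(Q.2.2 : ℝ) - Q'.2.2|)) := by
  have hsin : |sinPhase (Q.1 - P.1) - sinPhase (Q'.1 - P'.1)| ≤ dist Q.1 Q'.1 + dist P.1 P'.1 :=
    (abs_sinPhase_sub_le _ _).trans (dist_sub_sub_le _ _ _ _)
  have hWlip := hW.lip P.2.2 Q.2.2 P'.2.2 Q'.2.2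
  calc |coupling W P Q - coupling W P' Q'|
      = |(W P.2.2 Q.2.2 - W P'.2.2 Q'.2.2) * sinPhase (Q.1 - P.1) +
          W P'.2.2 Q'.2.2 * (sinPhase (Q.1 - P.1) - sinPhase (Q'.1 - P'.1))| := by
        unfold coupling; ring_nf
    _ ≤ |W P.2.2 Q.2.2 - W P'.2.2 Q'.2.2| * |sinPhase (Q.1 - P.1)| +
          |W P'.2.2 Q'.2.2| * |sinPhase (Q.1 - P.1) - sinPhase (Q'.1 - P'.1)| := by
        rw [← abs_mul, ← abs_mul]; exact abs_add_le _ _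
    _ ≤ B * (|(P.2.2 : ℝ) - P'.2.2| + |(Q.2.2 : ℝ) - Q'.2.2|) * 1 +
          B * (dist Q.1 Q'.1 + dist P.1 P'.1) :=
        add_le_add
          (mul_le_mul hWlip (abs_sinPhase_le_one _) (abs_nonneg _) ((abs_nonneg _).trans hWlip))
          (mul_le_mul (hW.bound _ _) hsin (abs_nonneg _) hW.nonneg)
    _ = _ := by ring

lemma abs_coupling_sub_left_le (hW : KernelBound W B) (P P' Q : G) :
    |coupling W P Q - coupling W P' Q| ≤ B * (dist P.1 P'.1 + |(P.2.2 : ℝ) - P'.2.2|) := by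
  simpa using abs_coupling_sub_le hW P Q P' Q

lemma abs_coupling_sub_right_le (hW : KernelBound W B) (P Q Q' : G) :
    |coupling W P Q - coupling W P Q'| ≤ B * (dist Q.1 Q'.1 + |(Q.2.2 : ℝ) - Q'.2.2|) := by
  simpa using abs_coupling_sub_le hW P Q P Q'

lemma abs_coupling_sub_right_le_distG (hW : KernelBound W B) (P Q Q' : G) :
    |coupling W P Q - coupling W P Q'| ≤ 2 * B * distG Q Q' := by
  refine (abs_coupling_sub_right_le hW P Q Q').trans ?_
  nlinarith [dist_phase_le_distG Q Q', abs_pos_sub_le_distG Q Q', hW.nonneg]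

lemma integrable_coupling (hW : KernelBound W B) (μ : Measure G) [IsFiniteMeasure μ] (P : G) :
    Integrable (coupling W P) μ :=
  .of_bound ((continuous_coupling hW).comp (Continuous.prodMk_right P)).aestronglyMeasurable B
    (Eventually.of_forall (abs_coupling_le hW P))

variable (K : ℝ) (μ ν : Measure G) [IsProbabilityMeasure μ] [IsProbabilityMeasure ν]

lemma abs_drift_le (hW : KernelBound W B) (P : G) : |drift W μ P| ≤ B :=
  abs_integral_le_of_abs_le (abs_coupling_le hW P)

lemma abs_drift_sub_le (hW : KernelBound W B) (P P' : G) :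
    |drift W μ P - drift W μ P'| ≤ B * (dist P.1 P'.1 + |(P.2.2 : ℝ) - P'.2.2|) := by
  rw [drift, drift, ← integral_sub (integrable_coupling hW μ P) (integrable_coupling hW μ P')]
  exact abs_integral_le_of_abs_le (abs_coupling_sub_left_le hW P P')

lemma abs_drift_sub_le_distG (hW : KernelBound W B) (P P' : G) :
    |drift W μ P - drift W μ P'| ≤ 2 * B * distG P P' := by
  refine (abs_drift_sub_le μ hW P P').trans ?_
  nlinarith [dist_phase_le_distG P P', abs_pos_sub_le_distG P P', hW.nonneg]

lemma continuous_drift (hW : KernelBound W B) : Continuous (drift W μ) :=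
  continuous_of_abs_sub_le_distG (abs_drift_sub_le_distG μ hW)

lemma continuous_vel (hW : KernelBound W B) : Continuous (vel K W μ) :=
  (continuous_fst.comp continuous_snd).add (continuous_const.mul (continuous_drift μ hW))

lemma abs_vel_sub_le_distG (hW : KernelBound W B) (P P' : G) :
    |vel K W μ P - vel K W μ P'| ≤ (1 + 2 * |K| * B) * distG P P' :=
  calc |vel K W μ P - vel K W μ P'|
      = |(P.2.1 - P'.2.1) + K * (drift W μ P - drift W μ P')| := by unfold vel; ring_nf
    _ ≤ |P.2.1 - P'.2.1| + |K| * |drift W μ P - drift W μ P'| := by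
        rw [← abs_mul]; exact abs_add_le _ _
    _ ≤ distG P P' + |K| * (2 * B * distG P P') := by
        gcongr
        exacts [abs_freq_sub_le_distG P P', abs_drift_sub_le_distG μ hW P P']
    _ = (1 + 2 * |K| * B) * distG P P' := by ring

lemma abs_drift_sub_drift_le (hW : KernelBound W B) (P : G) :
    |drift W μ P - drift W ν P| ≤ 2 * B * blDist μ ν :=
  abs_integral_sub_le_mul_blDist μ ν (a := -B) (by linarith [hW.nonneg])
    (fun Q => ⟨neg_le_of_abs_le (abs_coupling_le hW P Q),
      by linarith [le_of_abs_le (abs_coupling_le hW P Q)]⟩)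
    (abs_coupling_sub_right_le_distG hW P)

lemma abs_vel_sub_vel_le (hW : KernelBound W B) (P : G) :
    |vel K W μ P - vel K W ν P| ≤ 2 * |K| * B * blDist μ ν :=
  calc |vel K W μ P - vel K W ν P| = |K| * |drift W μ P - drift W ν P| := by
        rw [← abs_mul, vel, vel]; ring_nf
    _ ≤ |K| * (2 * B * blDist μ ν) := by gcongr; exact abs_drift_sub_drift_le μ ν hW P
    _ = 2 * |K| * B * blDist μ ν := by ring

end Coupling

section Gronwall

variable {a : ℝ → ℝ} {b c : ℝ}

lemma le_mul_exp_of_step_le (ha : ∀ t, 0 ≤ a t) (hb : 0 ≤ b) (hc : 0 ≤ c) {t h₀ : ℝ}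
    (ht : 0 ≤ t) (hh₀ : 0 < h₀)
    (hstep : ∀ s h, 0 ≤ s → 0 < h → h ≤ h₀ → s + h ≤ t → a (s + h) ≤ (1 + c * h) * a s + b * h) :
    a t ≤ (a 0 + b * t) * Real.exp (c * t) := by
  rcases ht.eq_or_lt with rfl | ht
  · simp
  obtain ⟨N, hN⟩ := exists_nat_gt (t / h₀)
  have hN0 : (0 : ℝ) < N := (by positivity : 0 ≤ t / h₀).trans_lt hN
  set h := t / N
  have hh : 0 < h := by positivity
  have hNh : N * h = t := mul_div_cancel₀ t hN0.ne'
  have hle : h ≤ h₀ := (div_le_comm₀ hh₀ hN0).mp hN.le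
  have hgrid : ∀ k : ℕ, a ((min (k + 1) N : ℕ) * h) ≤
      (1 + c * h) * a ((min k N : ℕ) * h) + b * h := fun k => by
    rcases lt_or_ge k N with hk | hk
    · have hkN : (k + 1 : ℝ) * h ≤ t := hNh ▸ by gcongr; exact_mod_cast hk
      rw [min_eq_left hk.le, min_eq_left (Nat.succ_le_iff.mpr hk), Nat.cast_succ, add_one_mul]
      exact hstep _ h (by positivity) hh hle (by linarith)
    · rw [min_eq_right hk, min_eq_right (hk.trans k.le_succ)]
      nlinarith [mul_nonneg (mul_nonneg hc hh.le) (ha (N * h)), mul_nonneg hb hh.le]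
  have key := discrete_gronwall (u := fun k => a ((min k N : ℕ) * h)) (ha _) (n₀ := 0)
    (fun k _ => hgrid k) (fun _ _ => by positivity) (fun _ _ => by positivity) N.zero_le
  simpa [mul_left_comm (N : ℝ), hNh] using key

lemma le_mul_exp_of_forall_step_le (ha : ∀ t, 0 ≤ a t) (hb : 0 ≤ b) (hc : 0 ≤ c) {T : ℝ}
    (hstep : ∀ ε > 0, ∃ h₀ > 0, ∀ t h, 0 ≤ t → 0 < h → h ≤ h₀ → t + h ≤ T →
      a (t + h) ≤ (1 + c * h) * a t + (b + ε) * h) {t : ℝ} (ht : t ∈ Set.Icc 0 T) :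
    a t ≤ (a 0 + b * t) * Real.exp (c * t) := by
  have key : ∀ ε > 0, a t ≤ (a 0 + (b + ε) * t) * Real.exp (c * t) := fun ε hε => by
    obtain ⟨h₀, hh₀, H⟩ := hstep ε hε
    exact le_mul_exp_of_step_le ha (add_nonneg hb hε.le) hc ht.1 hh₀
      fun s h hs hh hle hst => H s h hs hh hle (hst.trans ht.2)
  have hlim : Tendsto (fun ε => (a 0 + (b + ε) * t) * Real.exp (c * t)) (𝓝[>] 0)
      (𝓝 ((a 0 + (b + 0) * t) * Real.exp (c * t))) :=
    tendsto_nhdsWithin_of_tendsto_nhds (Continuous.tendsto (by fun_prop) 0)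
  rw [add_zero] at hlim
  exact ge_of_tendsto hlim (eventually_mem_of_tendsto_nhdsWithin tendsto_id |>.mono key)

end Gronwall

lemma isCompact_abs_freq_le (R : ℝ) : IsCompact {P : G | |P.2.1| ≤ R} := by
  have : {P : G | |P.2.1| ≤ R} = Set.univ ×ˢ (Set.Icc (-R) R ×ˢ Set.univ) := by
    ext P
    simp only [abs_le, Set.mem_ofPred_eq, Set.mem_prod, Set.mem_univ, Set.mem_Icc, true_and,
      and_true]
  rw [this]
  exact isCompact_univ.prod (isCompact_Icc.prod isCompact_univ)

/-- A `C¹` cutoff function of the frequency. -/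
structure IsCutoff (χ : ℝ → ℝ) : Prop where
  contDiff : ContDiff ℝ 1 χ
  nonneg : ∀ s, 0 ≤ χ s
  le_one : ∀ s, χ s ≤ 1
  support : ∃ R, 0 ≤ R ∧ ∀ s, R < |s| → χ s = 0

/-- One Euler step of length `h` along the velocity generated by `μ`. -/
def eulerMap (K : ℝ) (W : I → I → ℝ) (μ : Measure G) (h : ℝ) (P : G) : G :=
  (P.1 + ((h * vel K W μ P : ℝ) : Phase), P.2)

/-- Up to an error `o(h)`, uniform in the time and the observable, the curve `μ` of measures is
transported by Euler steps. Both the empirical measures and the weak solutions have this property,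
which is all that their comparison needs. -/
def EulerConsistent (K : ℝ) (W : I → I → ℝ) (T : ℝ) (χ : ℝ → ℝ) (μ : ℝ → Measure G) : Prop :=
  ∀ ε > 0, ∃ h₀ > 0, ∀ t h, 0 ≤ t → 0 < h → h ≤ h₀ → t + h ≤ T → ∀ f ∈ lipClass,
    |∫ P, χ P.2.1 * f P ∂(μ (t + h)) - ∫ P, χ P.2.1 * f (eulerMap K W (μ t) h P) ∂(μ t)| ≤ ε * h

namespace IsCutoff

variable {χ : ℝ → ℝ} (hχ : IsCutoff χ) (μ ν : Measure G) [IsProbabilityMeasure μ]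
  [IsProbabilityMeasure ν]
include hχ

lemma abs_le_one (s : ℝ) : |χ s| ≤ 1 := (abs_of_nonneg (hχ.nonneg s)).trans_le (hχ.le_one s)

lemma continuous_freq : Continuous fun P : G => χ P.2.1 :=
  hχ.contDiff.continuous.comp (continuous_fst.comp continuous_snd)

lemma integrable_mul {f : G → ℝ} (hf : Continuous f) :
    Integrable (fun P => χ P.2.1 * f P) μ := by
  obtain ⟨R, -, hR⟩ := hχ.support
  refine (hχ.continuous_freq.mul hf).integrable_of_hasCompactSupport
    (.intro (isCompact_abs_freq_le R) fun P hP => ?_)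
  exact mul_eq_zero_of_left (hR _ (not_le.mp hP)) _

lemma integrable_freq : Integrable (fun P : G => χ P.2.1) μ := by
  simpa only [mul_one] using hχ.integrable_mul μ (f := fun _ => 1) continuous_const

lemma integral_freq_le_one : ∫ P, χ P.2.1 ∂μ ≤ 1 :=
  le_of_abs_le (abs_integral_le_of_abs_le fun P : G => hχ.abs_le_one P.2.1)

lemma abs_integral_mul_sub_integral_mul_le {f F : G → ℝ} (hf : Continuous f) (hF : Continuous F)
    {c : ℝ} (h : ∀ P, |F P - f P| ≤ c) :
    |∫ P, χ P.2.1 * F P ∂μ - ∫ P, χ P.2.1 * f P ∂μ| ≤ c := by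
  rw [← integral_sub (hχ.integrable_mul μ hF) (hχ.integrable_mul μ hf)]
  simp_rw [← mul_sub]
  exact abs_integral_le_of_abs_le (abs_weight_mul_le hχ.abs_le_one h)

lemma abs_integral_sub_integral_mul_le {f : G → ℝ} (hf : f ∈ lipClass) :
    |∫ P, f P ∂μ - ∫ P, χ P.2.1 * f P ∂μ| ≤ 1 - ∫ P, χ P.2.1 ∂μ := by
  have hfc := continuous_of_mem_lipClass hf
  have hf1 := abs_le_one_of_mem_lipClass hf
  have hif : Integrable f μ := .of_bound hfc.aestronglyMeasurable 1 (Eventually.of_forall hf1)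
  have hχf := hχ.integrable_mul μ hfc
  have hχi := (integrable_const (1 : ℝ)).sub (hχ.integrable_freq μ)
  have hpt (P : G) : |f P - χ P.2.1 * f P| ≤ 1 - χ P.2.1 :=
    calc |f P - χ P.2.1 * f P| = (1 - χ P.2.1) * |f P| := by
          rw [← one_sub_mul, abs_mul, abs_of_nonneg (sub_nonneg.mpr (hχ.le_one _))]
      _ ≤ 1 - χ P.2.1 := mul_le_of_le_one_right (sub_nonneg.mpr (hχ.le_one _)) (hf1 P)
  calc |∫ P, f P ∂μ - ∫ P, χ P.2.1 * f P ∂μ| = |∫ P, (f P - χ P.2.1 * f P) ∂μ| := by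
        rw [integral_sub hif hχf]
    _ ≤ ∫ P, (1 - χ P.2.1) ∂μ :=
        abs_integral_le_integral_abs.trans (integral_mono (hif.sub hχf).abs hχi hpt)
    _ = 1 - ∫ P, χ P.2.1 ∂μ := by
        rw [integral_sub (integrable_const _) (hχ.integrable_freq μ)]; simp

lemma blDist_le_cutDist_add :
    blDist μ ν ≤ cutDist χ μ ν + ((1 - ∫ P, χ P.2.1 ∂μ) + (1 - ∫ P, χ P.2.1 ∂ν)) :=
  blDist_le fun f hf => by
    have hμ := abs_le.mp (hχ.abs_integral_sub_integral_mul_le μ hf)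
    have hν := abs_le.mp (hχ.abs_integral_sub_integral_mul_le ν hf)
    have hcut := abs_le.mp (abs_integral_sub_le_cutDist μ ν hχ.abs_le_one hf)
    exact abs_le.mpr ⟨by linarith, by linarith⟩

lemma cutDist_le_blDist_add :
    cutDist χ μ ν ≤ blDist μ ν + ((1 - ∫ P, χ P.2.1 ∂μ) + (1 - ∫ P, χ P.2.1 ∂ν)) :=
  cutDist_le fun f hf => by
    have hμ := abs_le.mp (hχ.abs_integral_sub_integral_mul_le μ hf)
    have hν := abs_le.mp (hχ.abs_integral_sub_integral_mul_le ν hf)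
    have hbl := abs_le.mp (abs_integral_sub_le_blDist μ ν hf)
    exact abs_le.mpr ⟨by linarith, by linarith⟩

end IsCutoff

section EulerSteps

variable {K : ℝ} {W : I → I → ℝ} {B : ℝ} {χ : ℝ → ℝ}

lemma continuous_eulerMap (hW : KernelBound W B) (μ : Measure G) [IsProbabilityMeasure μ] (h : ℝ) :
    Continuous (eulerMap K W μ h) := by
  have := continuous_vel K μ hW
  exact (continuous_fst.add ((AddCircle.continuous_mk' _).comp (by fun_prop))).prodMk continuous_snd

lemma distG_eulerMap_le (hW : KernelBound W B) (μ : Measure G) [IsProbabilityMeasure μ] {h : ℝ}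
    (hh : 0 ≤ h) (P Q : G) :
    distG (eulerMap K W μ h P) (eulerMap K W μ h Q) ≤ (1 + (1 + 2 * |K| * B) * h) * distG P Q := by
  have hB := hW.nonneg
  have hd := distG_nonneg P Q
  have hvel := abs_vel_sub_le_distG K μ hW P Q
  calc distG (eulerMap K W μ h P) (eulerMap K W μ h Q)
      ≤ distG P Q + h * ((1 + 2 * |K| * B) * distG P Q) := by
        refine distG_le_add_of_phase (by positivity) ((dist_add_coe_le _ _ _ _).trans ?_) rfl rfl
        rw [← mul_sub, abs_mul, abs_of_nonneg hh]
        gcongr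
    _ = (1 + (1 + 2 * |K| * B) * h) * distG P Q := by ring

lemma distG_eulerMap_eulerMap_le (hW : KernelBound W B) (μ ν : Measure G) [IsProbabilityMeasure μ]
    [IsProbabilityMeasure ν] {h : ℝ} (hh : 0 ≤ h) (P : G) :
    distG (eulerMap K W μ h P) (eulerMap K W ν h P) ≤ h * (2 * |K| * B * blDist μ ν) := by
  rw [eulerMap, eulerMap, distG_mk_mk]
  refine (dist_add_coe_self_le _ _ _).trans ?_
  rw [← mul_sub, abs_mul, abs_of_nonneg hh]
  gcongr
  exact abs_vel_sub_vel_le K μ ν hW P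

lemma abs_integral_eulerMap_sub_le (hW : KernelBound W B) (hχ : IsCutoff χ) (μ ν : Measure G)
    [IsProbabilityMeasure μ] [IsProbabilityMeasure ν] {h : ℝ} (hh : 0 ≤ h) {f : G → ℝ}
    (hf : f ∈ lipClass) :
    |∫ P, χ P.2.1 * f (eulerMap K W μ h P) ∂μ - ∫ P, χ P.2.1 * f (eulerMap K W ν h P) ∂ν| ≤
      (1 + (1 + 2 * |K| * B) * h) * cutDist χ μ ν + h * (2 * |K| * B * blDist μ ν) := by
  have hB := hW.nonneg
  have hc (η : Measure G) [IsProbabilityMeasure η] : Continuous fun P => f (eulerMap K W η h P) :=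
    (continuous_of_mem_lipClass hf).comp (continuous_eulerMap hW η h)
  have hC : 0 ≤ (1 + 2 * |K| * B) * h := by positivity
  have hmeasure : |∫ P, χ P.2.1 * f (eulerMap K W μ h P) ∂μ -
      ∫ P, χ P.2.1 * f (eulerMap K W μ h P) ∂ν| ≤
        (1 + (1 + 2 * |K| * B) * h) * cutDist χ μ ν :=
    abs_integral_sub_le_mul_cutDist μ ν hχ.abs_le_one (by linarith)
      (fun P => ⟨(hf.1 _).1, (hf.1 _).2.trans (by linarith)⟩)
      fun P Q => (hf.2 _ _).trans (distG_eulerMap_le hW μ hh P Q)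
  have hmap : |∫ P, χ P.2.1 * f (eulerMap K W μ h P) ∂ν -
      ∫ P, χ P.2.1 * f (eulerMap K W ν h P) ∂ν| ≤ h * (2 * |K| * B * blDist μ ν) :=
    hχ.abs_integral_mul_sub_integral_mul_le ν (hc ν) (hc μ) fun P =>
      (hf.2 _ _).trans (distG_eulerMap_eulerMap_le hW μ ν hh P)
  exact (abs_sub_le _ _ _).trans (add_le_add hmeasure hmap)

lemma cutDist_step_le (hW : KernelBound W B) (hχ : IsCutoff χ) {μ ν μ' ν' : Measure G}
    [IsProbabilityMeasure μ] [IsProbabilityMeasure ν] {h ε κ : ℝ} (hh : 0 ≤ h)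
    (hμκ : 1 - ∫ P, χ P.2.1 ∂μ ≤ κ) (hνκ : 1 - ∫ P, χ P.2.1 ∂ν ≤ κ)
    (hμ' : ∀ f ∈ lipClass,
      |∫ P, χ P.2.1 * f P ∂μ' - ∫ P, χ P.2.1 * f (eulerMap K W μ h P) ∂μ| ≤ ε * h)
    (hν' : ∀ f ∈ lipClass,
      |∫ P, χ P.2.1 * f P ∂ν' - ∫ P, χ P.2.1 * f (eulerMap K W ν h P) ∂ν| ≤ ε * h) :
    cutDist χ μ' ν' ≤ (1 + (1 + 4 * |K| * B) * h) * cutDist χ μ ν +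
      (4 * |K| * B * κ + 2 * ε) * h := by
  have hB := hW.nonneg
  have hbl : h * (2 * |K| * B * blDist μ ν) ≤ h * (2 * |K| * B * (cutDist χ μ ν + 2 * κ)) := by
    gcongr
    linarith [hχ.blDist_le_cutDist_add μ ν]
  refine cutDist_le fun f hf => abs_le.mpr ?_
  have hμf := abs_le.mp (hμ' f hf)
  have hνf := abs_le.mp (hν' f hf)
  have heuler := abs_le.mp (abs_integral_eulerMap_sub_le (K := K) hW hχ μ ν hh hf)
  exact ⟨by linarith, by linarith⟩

theorem cutDist_le_of_eulerConsistent (hW : KernelBound W B) (hχ : IsCutoff χ) {T : ℝ}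
    {μ ν : ℝ → Measure G} (hμ : ∀ t ∈ Set.Icc 0 T, IsProbabilityMeasure (μ t))
    (hν : ∀ t ∈ Set.Icc 0 T, IsProbabilityMeasure (ν t))
    (hμs : EulerConsistent K W T χ μ) (hνs : EulerConsistent K W T χ ν) {κ : ℝ}
    (hμκ : ∀ t ∈ Set.Icc 0 T, 1 - ∫ P, χ P.2.1 ∂(μ t) ≤ κ)
    (hνκ : ∀ t ∈ Set.Icc 0 T, 1 - ∫ P, χ P.2.1 ∂(ν t) ≤ κ) {t : ℝ} (ht : t ∈ Set.Icc 0 T) :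
    cutDist χ (μ t) (ν t) ≤
      (cutDist χ (μ 0) (ν 0) + 4 * |K| * B * κ * t) * Real.exp ((1 + 4 * |K| * B) * t) := by
  have hB := hW.nonneg
  have hκ : 0 ≤ κ := by
    have := hμ t ht
    linarith [hμκ t ht, hχ.integral_freq_le_one (μ t)]
  refine le_mul_exp_of_forall_step_le (fun _ => cutDist_nonneg _ _ _) (by positivity)
    (by positivity) (fun ε hε => ?_) ht
  obtain ⟨h₁, hh₁, H₁⟩ := hμs (ε / 2) (by positivity)
  obtain ⟨h₂, hh₂, H₂⟩ := hνs (ε / 2) (by positivity)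
  refine ⟨min h₁ h₂, lt_min hh₁ hh₂, fun s h hs hh hle hsh => ?_⟩
  have hsT : s ∈ Set.Icc 0 T := ⟨hs, by linarith⟩
  have := hμ s hsT
  have := hν s hsT
  have hstep := cutDist_step_le (K := K) hW hχ hh.le (hμκ s hsT) (hνκ s hsT)
    (H₁ s h hs hh (hle.trans (min_le_left _ _)) hsh)
    (H₂ s h hs hh (hle.trans (min_le_right _ _)) hsh)
  rwa [mul_div_cancel₀ ε two_ne_zero] at hstep

end EulerSteps

section EmpiricalMeasures

variable {n : ℕ}

lemma integral_empiricalMeasure (p : Fin n → G) (f : G → ℝ) :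
    ∫ P, f P ∂(empiricalMeasure p) = (n : ℝ)⁻¹ * ∑ i, f (p i) := by
  rw [empiricalMeasure, integral_smul_measure,
    integral_finsetSum_measure fun i _ => integrable_dirac (by simp)]
  simp [integral_dirac]

lemma isProbabilityMeasure_empiricalMeasure (hn : n ≠ 0) (p : Fin n → G) :
    IsProbabilityMeasure (empiricalMeasure p) where
  measure_univ := by
    simpa [empiricalMeasure] using ENNReal.inv_mul_cancel (by simpa) (ENNReal.natCast_ne_top n)

lemma abs_inv_mul_sum_le (hn : n ≠ 0) {a : Fin n → ℝ} {c : ℝ} (ha : ∀ i, |a i| ≤ c) :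
    |(n : ℝ)⁻¹ * ∑ i, a i| ≤ c := by
  have hn0 : (0 : ℝ) < n := Nat.cast_pos.mpr hn.bot_lt
  rw [abs_mul, abs_of_pos (inv_pos.mpr hn0), inv_mul_le_iff₀ hn0]
  calc |∑ i, a i| ≤ ∑ i, |a i| := Finset.abs_sum_le_sum_abs _ _
    _ ≤ ∑ _i : Fin n, c := Finset.sum_le_sum fun i _ => ha i
    _ = n * c := by simp

lemma abs_sub_euler_step_le {f f' : ℝ → ℝ} {t h ε : ℝ} (hh : 0 ≤ h)
    (hf : ∀ s ∈ Set.Icc t (t + h), HasDerivWithinAt f (f' s) (Set.Icc t (t + h)) s)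
    (hf' : ∀ s ∈ Set.Icc t (t + h), |f' s - f' t| ≤ ε) :
    |f (t + h) - (f t + h * f' t)| ≤ ε * h := by
  have hderiv : ∀ s ∈ Set.Icc t (t + h), HasDerivWithinAt (fun s => f s - s * f' t)
      (f' s - f' t) (Set.Icc t (t + h)) s := fun s hs => by
    have hlin := (hasDerivWithinAt_id s (Set.Icc t (t + h))).mul_const (f' t)
    rw [one_mul] at hlin
    exact (hf s hs).sub hlin
  have key := (convex_Icc t (t + h)).norm_image_sub_le_of_norm_hasDerivWithin_le hderiv hf'
    (Set.left_mem_Icc.mpr (by linarith)) (Set.right_mem_Icc.mpr (by linarith))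
  rw [Real.norm_eq_abs, Real.norm_eq_abs, add_sub_cancel_left, abs_of_nonneg hh] at key
  convert key using 2
  ring

variable {K : ℝ} {W : I → I → ℝ} {ξ : Fin n → I} {w : Fin n → ℝ}

lemma vel_empiricalMeasure (a : Fin n → ℝ) (i : Fin n) :
    vel K W (empiricalMeasure fun i => ((a i : Phase), w i, ξ i)) (a i, w i, ξ i) =
      w i + K * (n : ℝ)⁻¹ * ∑ j, W (ξ i) (ξ j) * Real.sin (a j - a i) := by
  rw [vel, drift, integral_empiricalMeasure, mul_assoc]
  rfl

lemma continuousOn_kuramoto_velocity {s : Set ℝ} {ϑ : Fin n → ℝ → ℝ}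
    (hϑ : ∀ i, ContinuousOn (ϑ i) s) : ContinuousOn (fun t i =>
      w i + K * (n : ℝ)⁻¹ * ∑ j, W (ξ i) (ξ j) * Real.sin (ϑ j t - ϑ i t)) s :=
  continuousOn_pi.mpr fun i => continuousOn_const.add <| continuousOn_const.mul <|
    continuousOn_finsetSum _ fun j _ => continuousOn_const.mul <|
      Real.continuous_sin.comp_continuousOn ((hϑ j).sub (hϑ i))

lemma IsKuramotoSolution.exists_lift_euler_step_le {T : ℝ} {θ₀ : Fin n → Phase}
    {θ : Fin n → ℝ → Phase} (hθ : IsKuramotoSolution K W T ξ w θ₀ θ) :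
    ∃ ϑ : Fin n → ℝ → ℝ, (∀ i, ∀ t ∈ Set.Icc 0 T, (ϑ i t : Phase) = θ i t) ∧
      ∀ ε > 0, ∃ h₀ > 0, ∀ t h, 0 ≤ t → 0 < h → h ≤ h₀ → t + h ≤ T → ∀ i,
        |ϑ i (t + h) - (ϑ i t + h *
          (w i + K * (n : ℝ)⁻¹ * ∑ j, W (ξ i) (ξ j) * Real.sin (ϑ j t - ϑ i t)))| ≤ ε * h := by
  obtain ⟨-, ϑ, hlift, hderiv⟩ := hθ
  refine ⟨ϑ, hlift, fun ε hε => ?_⟩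
  have hvel := continuousOn_kuramoto_velocity (K := K) (W := W) (ξ := ξ) (w := w)
    fun i t ht => (hderiv i t ht).continuousWithinAt
  obtain ⟨δ, hδ, H⟩ := Metric.uniformContinuousOn_iff_le.mp
    (isCompact_Icc.uniformContinuousOn_of_continuous hvel) ε hε
  refine ⟨δ, hδ, fun t h ht hh hhδ hT i => ?_⟩
  have hsub : Set.Icc t (t + h) ⊆ Set.Icc 0 T := Set.Icc_subset_Icc ht hT
  refine abs_sub_euler_step_le (f' := fun t =>
      w i + K * (n : ℝ)⁻¹ * ∑ j, W (ξ i) (ξ j) * Real.sin (ϑ j t - ϑ i t)) hh.le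
    (fun s hs => (hderiv i s (hsub hs)).mono hsub) fun s hs => ?_
  refine (dist_le_pi_dist _ _ i).trans (H s (hsub hs) t ⟨ht, by linarith⟩ ?_)
  rw [Real.dist_eq, abs_of_nonneg (by linarith [hs.1])]
  linarith [hs.2]

theorem IsKuramotoSolution.eulerConsistent {χ : ℝ → ℝ} (hχ : ∀ s, |χ s| ≤ 1) {T : ℝ} (hn : n ≠ 0)
    {θ₀ : Fin n → Phase} {θ : Fin n → ℝ → Phase} (hθ : IsKuramotoSolution K W T ξ w θ₀ θ) :
    EulerConsistent K W T χ fun t => empiricalMeasure fun i => (θ i t, w i, ξ i) := by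
  obtain ⟨ϑ, hlift, hstep⟩ := hθ.exists_lift_euler_step_le
  intro ε hε
  obtain ⟨h₀, hh₀, H⟩ := hstep ε hε
  refine ⟨h₀, hh₀, fun t h ht hh hle hT f hf => ?_⟩
  have ht' : t ∈ Set.Icc 0 T := ⟨ht, by linarith⟩
  have hth : t + h ∈ Set.Icc 0 T := ⟨by linarith, hT⟩
  simp only [integral_empiricalMeasure, ← hlift _ t ht', ← hlift _ _ hth, ← mul_sub,
    ← Finset.sum_sub_distrib]
  refine abs_inv_mul_sum_le hn fun i => ?_
  refine (abs_mul _ _).trans_le <| (mul_le_of_le_one_left (abs_nonneg _) (hχ _)).trans <|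
    (hf.2 _ _).trans <| le_trans ?_ (H t h ht hh hle hT i)
  rw [eulerMap, vel_empiricalMeasure, distG_mk_mk, dist_eq_norm, ← AddCircle.coe_add,
    ← AddCircle.coe_sub]
  exact norm_coe_phase_le _

end EmpiricalMeasures

section Mollification

/-- The extension of `f : G → ℝ` to `ℝ × ℝ × ℝ`, periodic in the phase and constant in the position
outside of `[0,1]`. -/
def liftG (f : G → ℝ) (p : ℝ × ℝ × ℝ) : ℝ :=
  f ((p.1 : Phase), p.2.1, Set.projIcc 0 1 zero_le_one p.2.2)

/-- The convolution of `f : G → ℝ`, extended as in `liftG`, with a normalized bump function. -/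
def mollify (φ : ContDiffBump (0 : ℝ × ℝ × ℝ)) (f : G → ℝ) (a : Phase) (s x : ℝ) : ℝ :=
  ∫ u : ℝ × ℝ × ℝ, φ.normed volume u *
    f (a - (u.1 : Phase), s - u.2.1, Set.projIcc 0 1 zero_le_one (x - u.2.2))

variable {f : G → ℝ} {L M : ℝ}

lemma liftG_val (f : G → ℝ) (y s : ℝ) (x : I) : liftG f (y, s, x) = f ((y : Phase), s, x) := by
  simp only [liftG, Set.projIcc_val]

lemma abs_projIcc_sub_le (x y : ℝ) :
    |((Set.projIcc (0 : ℝ) 1 zero_le_one x : I) : ℝ) - (Set.projIcc (0 : ℝ) 1 zero_le_one y : I)| ≤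
      |x - y| := by
  simpa [Real.dist_eq, Subtype.dist_eq] using
    (LipschitzWith.projIcc (zero_le_one (α := ℝ))).dist_le_mul x y

lemma abs_liftG_sub_le (hL : 0 ≤ L) (hf : ∀ P Q, |f P - f Q| ≤ L * distG P Q) (p q : ℝ × ℝ × ℝ) :
    |liftG f p - liftG f q| ≤ L * (3 * dist p q) := by
  refine (hf _ _).trans (mul_le_mul_of_nonneg_left ((distG_le_add _ _).trans ?_) hL)
  have hphase : dist (p.1 : Phase) (q.1 : Phase) ≤ dist p q := by
    rw [dist_eq_norm, ← AddCircle.coe_sub]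
    exact (norm_coe_phase_le _).trans (le_max_left _ _)
  have hfreq : |p.2.1 - q.2.1| ≤ dist p q := (le_max_left _ _).trans (le_max_right _ _)
  have hpos : |p.2.2 - q.2.2| ≤ dist p q := (le_max_right _ _).trans (le_max_right _ _)
  simp only
  linarith [abs_projIcc_sub_le p.2.2 q.2.2]

lemma continuous_liftG (hf : Continuous f) : Continuous (liftG f) :=
  hf.comp (((AddCircle.continuous_mk' _).comp continuous_fst).prodMk
    ((continuous_fst.comp continuous_snd).prodMk
      (continuous_projIcc.comp (continuous_snd.comp continuous_snd))))

instance isAddHaarMeasure_volume_prod : (volume : Measure (ℝ × ℝ × ℝ)).IsAddHaarMeasure :=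
  have : (volume : Measure (ℝ × ℝ)).IsAddHaarMeasure :=
    Measure.prod.instIsAddHaarMeasure (volume : Measure ℝ) (volume : Measure ℝ)
  Measure.prod.instIsAddHaarMeasure (volume : Measure ℝ) (volume : Measure (ℝ × ℝ))

lemma mollify_coe (φ : ContDiffBump (0 : ℝ × ℝ × ℝ)) (f : G → ℝ) (p : ℝ × ℝ × ℝ) :
    mollify φ f (p.1 : Phase) p.2.1 p.2.2 =
      convolution (φ.normed volume) (liftG f) (ContinuousLinearMap.lsmul ℝ ℝ) volume p := by
  simp only [mollify, convolution, liftG, ContinuousLinearMap.lsmul_apply, smul_eq_mul,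
    Prod.fst_sub, Prod.snd_sub, AddCircle.coe_sub]

lemma contDiff_mollify (φ : ContDiffBump (0 : ℝ × ℝ × ℝ)) (hf : Continuous f) :
    ContDiff ℝ 1 fun p : ℝ × ℝ × ℝ => mollify φ f (p.1 : Phase) p.2.1 p.2.2 := by
  simp_rw [mollify_coe]
  exact φ.hasCompactSupport_normed.contDiff_convolution_left _ φ.contDiff_normed
    (continuous_liftG hf).locallyIntegrable

lemma abs_mollify_sub_le (φ : ContDiffBump (0 : ℝ × ℝ × ℝ)) (hL : 0 ≤ L)
    (hf : ∀ P Q, |f P - f Q| ≤ L * distG P Q) (P : G) :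
    |mollify φ f P.1 P.2.1 P.2.2 - f P| ≤ L * (3 * φ.rOut) := by
  obtain ⟨a, s, x⟩ := P
  induction a using QuotientAddGroup.induction_on with
  | H y =>
    have hconv := mollify_coe φ f (y, s, x)
    have hlift := liftG_val f y s x
    simp only at hconv ⊢
    refine (congrArg₂ (fun u v => |u - v|) hconv hlift.symm).trans_le ?_
    refine φ.dist_normed_convolution_le
      (continuous_liftG (continuous_of_abs_sub_le_distG hf)).aestronglyMeasurable fun p hp => ?_
    refine (abs_liftG_sub_le hL hf _ _).trans ?_
    gcongr
    exact (Metric.mem_ball.mp hp).le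

lemma abs_mollify_sub_mollify_le (φ : ContDiffBump (0 : ℝ × ℝ × ℝ)) (hf : Continuous f)
    (hM : ∀ a b s x, |f (a, s, x) - f (b, s, x)| ≤ M * dist a b) (a b : Phase) (s x : ℝ) :
    |mollify φ f a s x - mollify φ f b s x| ≤ M * dist a b := by
  have hint (a : Phase) : Integrable fun u : ℝ × ℝ × ℝ => φ.normed volume u *
      f (a - (u.1 : Phase), s - u.2.1, Set.projIcc 0 1 zero_le_one (x - u.2.2)) := by
    refine Continuous.integrable_of_hasCompactSupport (φ.continuous_normed.mul (hf.comp ?_))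
      φ.hasCompactSupport_normed.mul_right
    exact (continuous_const.sub ((AddCircle.continuous_mk' _).comp continuous_fst)).prodMk
      ((by fun_prop : Continuous fun u : ℝ × ℝ × ℝ => s - u.2.1).prodMk
        (continuous_projIcc.comp (by fun_prop)))
  rw [mollify, mollify, ← integral_sub (hint a) (hint b)]
  calc _ ≤ ∫ u : ℝ × ℝ × ℝ, φ.normed volume u * (M * dist a b) := by
        rw [← Real.norm_eq_abs]
        refine norm_integral_le_of_norm_le (φ.integrable_normed.mul_const _)
          (Eventually.of_forall fun u => ?_)
        rw [← mul_sub, norm_mul, Real.norm_of_nonneg (φ.nonneg_normed u)]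
        refine mul_le_mul_of_nonneg_left ((hM _ _ _ _).trans_eq ?_) (φ.nonneg_normed u)
        rw [dist_sub_right]
    _ = M * dist a b := by rw [integral_mul_const, φ.integral_normed, one_mul]

lemma exists_contDiff_approx (hf : ∀ P Q, |f P - f Q| ≤ L * distG P Q)
    (hM : ∀ a b s x, |f (a, s, x) - f (b, s, x)| ≤ M * dist a b) {ε : ℝ} (hε : 0 < ε) :
    ∃ F : Phase → ℝ → ℝ → ℝ, ContDiff ℝ 1 (fun p : ℝ × ℝ × ℝ => F (p.1 : Phase) p.2.1 p.2.2) ∧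
      (∀ P : G, |F P.1 P.2.1 P.2.2 - f P| ≤ ε) ∧
      ∀ a b s x, |F a s x - F b s x| ≤ M * dist a b := by
  have hfc := continuous_of_abs_sub_le_distG hf
  have hL (P Q) : |f P - f Q| ≤ max L 1 * distG P Q :=
    (hf P Q).trans (mul_le_mul_of_nonneg_right (le_max_left _ _) (distG_nonneg _ _))
  have hL0 : 0 < max L 1 := lt_max_of_lt_right one_pos
  let φ : ContDiffBump (0 : ℝ × ℝ × ℝ) :=
    ⟨ε / (6 * max L 1), ε / (3 * max L 1), by positivity, by gcongr; norm_num⟩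
  refine ⟨mollify φ f, contDiff_mollify φ hfc, fun P => ?_, abs_mollify_sub_mollify_le φ hfc hM⟩
  refine (abs_mollify_sub_le φ hL0.le hL P).trans_eq ?_
  simp only [φ]
  field_simp

end Mollification

namespace IsTestFunction

variable {ψ : ℝ → Phase → ℝ → ℝ → ℝ}

/-- The lift of a test function to an ordinary function of four real variables. -/
def lift (ψ : ℝ → Phase → ℝ → ℝ → ℝ) (p : ℝ × ℝ × ℝ × ℝ) : ℝ :=
  ψ p.1 (p.2.1 : Phase) p.2.2.1 p.2.2.2

lemma hasFDerivAt (hψ : IsTestFunction ψ) (p : ℝ × ℝ × ℝ × ℝ) :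
    HasFDerivAt (lift ψ) (fderiv ℝ (lift ψ) p) p :=
  (hψ.contDiff.differentiable one_ne_zero p).hasFDerivAt

lemma deriv_time_eq (hψ : IsTestFunction ψ) (t y s x : ℝ) :
    deriv (fun t => ψ t (y : Phase) s x) t = fderiv ℝ (lift ψ) (t, y, s, x) (1, 0, 0, 0) := by
  have h : HasDerivAt (fun t : ℝ => (t, y, s, x)) ((1 : ℝ), (0 : ℝ), (0 : ℝ), (0 : ℝ)) t :=
    (hasDerivAt_id t).prodMk (hasDerivAt_const t _)
  exact ((hψ.hasFDerivAt (t, y, s, x)).comp_hasDerivAt t h).deriv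

lemma derivPhase_eq (hψ : IsTestFunction ψ) (t y s x : ℝ) :
    derivPhase (fun θ => ψ t θ s x) (y : Phase) =
      fderiv ℝ (lift ψ) (t, y, s, x) (0, 1, 0, 0) := by
  have h : HasDerivAt (fun u : ℝ => (t, y + u, s, x)) ((0 : ℝ), (1 : ℝ), (0 : ℝ), (0 : ℝ)) 0 :=
    (hasDerivAt_const _ t).prodMk (((hasDerivAt_id (0 : ℝ)).const_add y).prodMk
      (hasDerivAt_const _ _))
  have hψ₀ : HasFDerivAt (lift ψ) (fderiv ℝ (lift ψ) (t, y, s, x))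
      ((fun u : ℝ => (t, y + u, s, x)) 0) := by
    simpa only [add_zero] using hψ.hasFDerivAt (t, y, s, x)
  exact (hψ₀.comp_hasDerivAt (0 : ℝ) h).deriv

lemma isOpenQuotientMap_coe :
    IsOpenQuotientMap fun p : ℝ × ℝ × ℝ × ℝ => (p.1, (p.2.1 : Phase), p.2.2) :=
  IsOpenQuotientMap.prodMap .id (QuotientAddGroup.isOpenQuotientMap_mk.prodMap .id)

lemma continuous_of_lift {F : ℝ → Phase → ℝ → ℝ → ℝ}
    (hF : Continuous fun p : ℝ × ℝ × ℝ × ℝ => F p.1 (p.2.1 : Phase) p.2.2.1 p.2.2.2) :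
    Continuous fun q : ℝ × G => F q.1 q.2.1 q.2.2.1 q.2.2.2 := by
  have h : Continuous fun q : ℝ × Phase × ℝ × ℝ => F q.1 q.2.1 q.2.2.1 q.2.2.2 :=
    isOpenQuotientMap_coe.isQuotientMap.continuous_iff.mpr hF
  exact h.comp (f := fun q : ℝ × G => (q.1, q.2.1, q.2.2.1, (q.2.2.2 : ℝ))) (by fun_prop)

lemma continuous (hψ : IsTestFunction ψ) :
    Continuous fun q : ℝ × G => ψ q.1 q.2.1 q.2.2.1 q.2.2.2 :=
  continuous_of_lift hψ.contDiff.continuous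

lemma continuous_apply (hψ : IsTestFunction ψ) (t : ℝ) :
    Continuous fun P : G => ψ t P.1 P.2.1 P.2.2 :=
  hψ.continuous.comp (f := fun P : G => (t, P)) (by fun_prop)

lemma continuous_fderiv_apply (hψ : IsTestFunction ψ) (v : ℝ × ℝ × ℝ × ℝ) :
    Continuous fun p => fderiv ℝ (lift ψ) p v :=
  (hψ.contDiff.continuous_fderiv one_ne_zero).clm_apply continuous_const

lemma continuous_deriv_time (hψ : IsTestFunction ψ) :
    Continuous fun q : ℝ × G => deriv (fun t => ψ t q.2.1 q.2.2.1 q.2.2.2) q.1 := by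
  refine continuous_of_lift (F := fun t a s x => deriv (fun t => ψ t a s x) t) ?_
  simp_rw [hψ.deriv_time_eq]
  exact hψ.continuous_fderiv_apply _

lemma continuous_derivPhase (hψ : IsTestFunction ψ) :
    Continuous fun q : ℝ × G => derivPhase (fun θ => ψ q.1 θ q.2.2.1 q.2.2.2) q.2.1 := by
  refine continuous_of_lift (F := fun t a s x => derivPhase (fun θ => ψ t θ s x) a) ?_
  simp_rw [hψ.derivPhase_eq]
  exact hψ.continuous_fderiv_apply _

end IsTestFunction

/-- The derivative `∂ₜψ + v ∂_θψ` of `ψ` along a phase that moves with velocity `v`. -/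
def transportDeriv (ψ : ℝ → Phase → ℝ → ℝ → ℝ) (v t : ℝ) (P : G) : ℝ :=
  deriv (fun s => ψ s P.1 P.2.1 P.2.2) t + v * derivPhase (fun θ => ψ t θ P.2.1 P.2.2) P.1

section TransportDeriv

variable {ψ : ℝ → Phase → ℝ → ℝ → ℝ}

lemma hasDerivAt_comp_phase (hψ : IsTestFunction ψ) {γ : ℝ → ℝ} {t v : ℝ} (hγ : HasDerivAt γ v t)
    (s : ℝ) (x : I) : HasDerivAt (fun t => ψ t (γ t : Phase) s x)
      (transportDeriv ψ v t ((γ t : Phase), s, x)) t := by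
  have h : HasDerivAt (fun t : ℝ => (t, γ t, s, (x : ℝ))) ((1 : ℝ), v, (0 : ℝ), (0 : ℝ)) t :=
    (hasDerivAt_id t).prodMk (hγ.prodMk (hasDerivAt_const _ _))
  refine ((hψ.hasFDerivAt (t, γ t, s, x)).comp_hasDerivAt t h).congr_deriv ?_
  have hdir : ((1 : ℝ), v, (0 : ℝ), (0 : ℝ)) =
      ((1 : ℝ), (0 : ℝ), (0 : ℝ), (0 : ℝ)) + v • ((0 : ℝ), (1 : ℝ), (0 : ℝ), (0 : ℝ)) := by simp
  rw [transportDeriv, hψ.deriv_time_eq, hψ.derivPhase_eq, hdir, map_add, map_smul, smul_eq_mul]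

lemma transportDeriv_eq_zero {R : ℝ} (hR : ∀ t θ ω x, R < |ω| → ψ t θ ω x = 0) (v t : ℝ) {P : G}
    (hP : R < |P.2.1|) : transportDeriv ψ v t P = 0 := by
  simp [transportDeriv, derivPhase, hR _ _ _ _ hP]

end TransportDeriv

/-! ### Measure-valued weak solutions -/

/-- Weak solutions of the mean-field equation in the class of weakly continuous curves of
probability measures, with initial measure `m`. -/
structure IsMeasureSolution (K : ℝ) (W : I → I → ℝ) (T : ℝ) (m : Measure G) (μ : ℝ → Measure G) :
    Prop where
  prob : ∀ t ∈ Set.Icc 0 T, IsProbabilityMeasure (μ t)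
  cont : ∀ f : BoundedContinuousFunction G ℝ, ContinuousOn (fun t => ∫ P, f P ∂(μ t)) (Set.Icc 0 T)
  weak : ∀ ψ, IsTestFunction ψ → ∀ τ ∈ Set.Icc 0 T,
    ∫ P : G, ψ τ P.1 P.2.1 P.2.2 ∂(μ τ) = (∫ P : G, ψ 0 P.1 P.2.1 P.2.2 ∂m) +
      ∫ t in (0 : ℝ)..τ, ∫ P : G, transportDeriv ψ (vel K W (μ t) P) t P ∂(μ t)

section WithDensity

variable {α : Type*} [MeasurableSpace α] {μ : Measure α} {r : α → ℝ}

lemma integral_withDensity_ofReal (hr : Measurable r) (hr0 : ∀ a, 0 ≤ r a) (f : α → ℝ) :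
    ∫ a, f a ∂(μ.withDensity fun a => ENNReal.ofReal (r a)) = ∫ a, f a * r a ∂μ := by
  rw [integral_withDensity_eq_integral_toReal_smul hr.ennreal_ofReal
    (Eventually.of_forall fun _ => ENNReal.ofReal_lt_top)]
  simp_rw [ENNReal.toReal_ofReal (hr0 _), smul_eq_mul, mul_comm]

lemma integrable_withDensity_ofReal_iff (hr : Measurable r) (hr0 : ∀ a, 0 ≤ r a) {f : α → ℝ} :
    Integrable f (μ.withDensity fun a => ENNReal.ofReal (r a)) ↔
      Integrable (fun a => f a * r a) μ := by
  rw [integrable_withDensity_iff hr.ennreal_ofReal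
    (Eventually.of_forall fun _ => ENNReal.ofReal_lt_top)]
  simp_rw [ENNReal.toReal_ofReal (hr0 _)]

lemma isProbabilityMeasure_withDensity_ofReal (hr0 : ∀ a, 0 ≤ r a) (hr1 : ∫ a, r a ∂μ = 1) :
    IsProbabilityMeasure (μ.withDensity fun a => ENNReal.ofReal (r a)) := by
  constructor
  rw [withDensity_apply _ MeasurableSet.univ, Measure.restrict_univ,
    ← ofReal_integral_eq_lintegral_ofReal (integrable_of_integral_eq_one hr1)
      (Eventually.of_forall hr0), hr1, ENNReal.ofReal_one]

end WithDensity

section DensityMeasure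

variable {r : G → ℝ}

lemma integral_densityMeasure (hr : Measurable r) (hr0 : ∀ P, 0 ≤ r P) (f : G → ℝ) :
    ∫ P, f P ∂(densityMeasure r) = ∫ P, f P * r P :=
  integral_withDensity_ofReal hr hr0 f

lemma velocity_eq_vel (hr : Measurable r) (hr0 : ∀ P, 0 ≤ r P) (K : ℝ) (W : I → I → ℝ) (P : G) :
    velocity K W r P = vel K W (densityMeasure r) P := by
  rw [velocity, vel, drift, integral_densityMeasure hr hr0]
  rfl

theorem IsWeakSolution.isMeasureSolution {K : ℝ} {W : I → I → ℝ} {T : ℝ} {ρ₀ : G → ℝ}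
    {ρ : ℝ → G → ℝ} (hρ₀ : Measurable ρ₀) (hρ₀_nonneg : ∀ P, 0 ≤ ρ₀ P)
    (h : IsWeakSolution K W T ρ₀ ρ) :
    IsMeasureSolution K W T (densityMeasure ρ₀) fun t => densityMeasure (ρ t) where
  prob t ht := isProbabilityMeasure_withDensity_ofReal (h.nonneg t ht) (h.integral_eq_one t ht)
  cont f := (h.weaklyContinuous f).congr fun t ht =>
    integral_densityMeasure (h.measurable t ht) (h.nonneg t ht) _
  weak ψ hψ τ hτ := by
    rw [integral_densityMeasure (h.measurable τ hτ) (h.nonneg τ hτ),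
      integral_densityMeasure hρ₀ hρ₀_nonneg, h.weak ψ hψ τ hτ]
    congr 1
    refine intervalIntegral.integral_congr fun t ht => ?_
    rw [Set.uIcc_of_le hτ.1] at ht
    have htT : t ∈ Set.Icc 0 T := ⟨ht.1, ht.2.trans hτ.2⟩
    rw [integral_densityMeasure (h.measurable t htT) (h.nonneg t htT)]
    simp_rw [transportDeriv, velocity_eq_vel (h.measurable t htT) (h.nonneg t htT)]

end DensityMeasure

section TimeDependentObservables

variable {T : ℝ} {H : ℝ → G → ℝ} {R : ℝ}
  (hH : ContinuousOn (fun q : ℝ × G => H q.1 q.2) (Set.Icc 0 T ×ˢ Set.univ))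
include hH

lemma exists_uniform_modulus (hR : ∀ t P, R < |P.2.1| → H t P = 0) {ε : ℝ} (hε : 0 < ε) :
    ∃ δ > 0, ∀ s ∈ Set.Icc 0 T, ∀ t ∈ Set.Icc 0 T, |s - t| < δ → ∀ P, |H s P - H t P| < ε := by
  have huc := (isCompact_Icc.prod (isCompact_abs_freq_le R)).uniformContinuousOn_of_continuous
    (hH.mono (Set.prod_mono subset_rfl (Set.subset_univ _)))
  obtain ⟨δ, hδ, hclose⟩ := Metric.uniformContinuousOn_iff.mp huc ε hε
  refine ⟨δ, hδ, fun s hs t ht hst P => ?_⟩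
  rcases le_or_gt |P.2.1| R with hP | hP
  · exact hclose (s, P) ⟨hs, hP⟩ (t, P) ⟨ht, hP⟩
      (by simpa [Prod.dist_eq, Real.dist_eq, hδ] using hst)
  · simpa [hR _ _ hP] using hε

lemma exists_uniform_bound (hR : ∀ t P, R < |P.2.1| → H t P = 0) :
    ∃ c, ∀ t ∈ Set.Icc 0 T, ∀ P, |H t P| ≤ c := by
  obtain ⟨c, hc⟩ := (isCompact_Icc.prod (isCompact_abs_freq_le R)).exists_bound_of_continuousOn
    (hH.mono (Set.prod_mono subset_rfl (Set.subset_univ _)))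
  refine ⟨max c 0, fun t ht P => ?_⟩
  rcases le_or_gt |P.2.1| R with hP | hP
  · exact (hc (t, P) ⟨ht, hP⟩).trans (le_max_left _ _)
  · simp [hR _ _ hP]

lemma continuous_slice {t : ℝ} (ht : t ∈ Set.Icc 0 T) : Continuous (H t) :=
  hH.comp_continuous (f := fun P : G => (t, P)) (by fun_prop) fun _ => ⟨ht, trivial⟩

end TimeDependentObservables

namespace IsMeasureSolution

variable {K : ℝ} {W : I → I → ℝ} {B T : ℝ} {m : Measure G} {μ : ℝ → Measure G}

lemma continuousOn_integral (h : IsMeasureSolution K W T m μ) {H : ℝ → G → ℝ} {R : ℝ}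
    (hH : ContinuousOn (fun q : ℝ × G => H q.1 q.2) (Set.Icc 0 T ×ˢ Set.univ))
    (hR : ∀ t P, R < |P.2.1| → H t P = 0) :
    ContinuousOn (fun t => ∫ P, H t P ∂(μ t)) (Set.Icc 0 T) := by
  obtain ⟨c, hc⟩ := exists_uniform_bound hH hR
  rw [Metric.continuousOn_iff]
  intro t ht ε hε
  obtain ⟨δ, hδ, hmod⟩ := exists_uniform_modulus hH hR (half_pos hε)
  have hfrozen := h.cont (BoundedContinuousFunction.ofNormedAddCommGroup (H t)
    (continuous_slice hH ht) c (hc t ht))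
  obtain ⟨δ', hδ', hweak⟩ := Metric.continuousOn_iff.mp hfrozen t ht (ε / 2) (half_pos hε)
  refine ⟨min δ δ', lt_min hδ hδ', fun s hs hst => ?_⟩
  have := h.prob s hs
  have hint {u : ℝ} (hu : u ∈ Set.Icc 0 T) : Integrable (H u) (μ s) :=
    .of_bound (continuous_slice hH hu).aestronglyMeasurable c (Eventually.of_forall (hc u hu))
  have hobs : |∫ P, H s P ∂(μ s) - ∫ P, H t P ∂(μ s)| ≤ ε / 2 := by
    rw [← integral_sub (hint hs) (hint ht)]
    exact abs_integral_le_of_abs_le fun P =>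
      (hmod s hs t ht (hst.trans_le (min_le_left _ _)) P).le
  have hmeas := hweak s hs (hst.trans_le (min_le_right _ _))
  simp only [BoundedContinuousFunction.coe_ofNormedAddCommGroup, Real.dist_eq] at hmeas ⊢
  linarith [abs_sub_le (∫ P, H s P ∂(μ s)) (∫ P, H t P ∂(μ s)) (∫ P, H t P ∂(μ t))]

lemma continuousOn_drift (h : IsMeasureSolution K W T m μ) (hW : KernelBound W B) :
    ContinuousOn (fun q : ℝ × G => drift W (μ q.1) q.2) (Set.Icc 0 T ×ˢ Set.univ) := by
  refine continuousOn_prod_of_continuousOn_lipschitzOnWith' _ (Real.toNNReal (2 * B * 3))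
    (fun t ht => ?_) fun P _ => ?_
  · have := h.prob t ht
    refine (LipschitzWith.of_dist_le' fun P Q => ?_).lipschitzOnWith
    refine (abs_drift_sub_le_distG (μ t) hW P Q).trans ?_
    rw [mul_assoc (2 * B)]
    exact mul_le_mul_of_nonneg_left (distG_le_three_mul_dist P Q) (by linarith [hW.nonneg])
  · exact h.cont (BoundedContinuousFunction.ofNormedAddCommGroup (coupling W P)
      ((continuous_coupling hW).comp (by fun_prop : Continuous fun Q : G => (P, Q))) B
      (abs_coupling_le hW P))

lemma continuousOn_vel (h : IsMeasureSolution K W T m μ) (hW : KernelBound W B) :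
    ContinuousOn (fun q : ℝ × G => vel K W (μ q.1) q.2) (Set.Icc 0 T ×ˢ Set.univ) :=
  (by fun_prop : Continuous fun q : ℝ × G => q.2.2.1).continuousOn.add
    (continuousOn_const.mul (h.continuousOn_drift hW))

lemma continuousOn_integral_transportDeriv (h : IsMeasureSolution K W T m μ)
    (hW : KernelBound W B) {ψ : ℝ → Phase → ℝ → ℝ → ℝ} (hψ : IsTestFunction ψ) :
    ContinuousOn (fun t => ∫ P, transportDeriv ψ (vel K W (μ t) P) t P ∂(μ t)) (Set.Icc 0 T) := by
  obtain ⟨R, hR⟩ := hψ.support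
  refine h.continuousOn_integral ?_ fun t P => transportDeriv_eq_zero hR _ t
  exact hψ.continuous_deriv_time.continuousOn.add
    ((h.continuousOn_vel hW).mul hψ.continuous_derivPhase.continuousOn)

lemma integral_sub_integral (h : IsMeasureSolution K W T m μ) (hW : KernelBound W B)
    {ψ : ℝ → Phase → ℝ → ℝ → ℝ} (hψ : IsTestFunction ψ) {s t : ℝ} (hs : s ∈ Set.Icc 0 T)
    (ht : t ∈ Set.Icc 0 T) :
    ∫ P : G, ψ t P.1 P.2.1 P.2.2 ∂(μ t) - ∫ P : G, ψ s P.1 P.2.1 P.2.2 ∂(μ s) =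
      ∫ u in s..t, ∫ P : G, transportDeriv ψ (vel K W (μ u) P) u P ∂(μ u) := by
  have hint {u : ℝ} (hu : u ∈ Set.Icc 0 T) : IntervalIntegrable
      (fun u => ∫ P : G, transportDeriv ψ (vel K W (μ u) P) u P ∂(μ u)) volume 0 u := by
    refine ((h.continuousOn_integral_transportDeriv hW hψ).mono ?_).intervalIntegrable
    rw [Set.uIcc_of_le hu.1]
    exact Set.Icc_subset_Icc_right hu.2
  rw [h.weak ψ hψ t ht, h.weak ψ hψ s hs, add_sub_add_left_eq_sub,
    intervalIntegral.integral_interval_sub_left (hint ht) (hint hs)]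

end IsMeasureSolution

/-! ### Weak solutions are consistent with Euler steps -/

lemma abs_le_of_hasDerivAt_of_abs_sub_le {f c : ℝ → ℝ} {D s : ℝ} (hf : HasDerivAt f D s)
    (hc : ContinuousAt c s) (h : ∀ u, |f u - f s| ≤ c u * |u - s|) : |D| ≤ c s := by
  refine le_of_tendsto_of_tendsto (hasDerivAt_iff_tendsto_slope.mp hf).norm
    (hc.tendsto.mono_left nhdsWithin_le_nhds) ?_
  filter_upwards [self_mem_nhdsWithin] with u hu
  rw [slope_def_field, norm_div, Real.norm_eq_abs, Real.norm_eq_abs,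
    div_le_iff₀ (abs_pos.mpr (sub_ne_zero.mpr hu))]
  exact h u

/-- The test function that is `χ F` at time `σ` and is transported backwards from `σ` along the
frozen velocity field `U`, up to an error of second order in time. -/
def transportTest (χ : ℝ → ℝ) (F U : Phase → ℝ → ℝ → ℝ) (σ t : ℝ) (θ : Phase) (s x : ℝ) : ℝ :=
  χ s * F (θ + (((σ - t) * U θ s x : ℝ) : Phase)) s x

section TransportTest

variable {χ : ℝ → ℝ} {F U : Phase → ℝ → ℝ → ℝ}

lemma IsCutoff.isTestFunction_mul (hχ : IsCutoff χ)
    (hF : ContDiff ℝ 1 (fun p : ℝ × ℝ × ℝ => F (p.1 : Phase) p.2.1 p.2.2)) :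
    IsTestFunction fun _ θ s x => χ s * F θ s x where
  contDiff := (hχ.contDiff.comp (by fun_prop : ContDiff ℝ 1 fun p : ℝ × ℝ × ℝ × ℝ => p.2.2.1)).mul
    (hF.comp (by fun_prop : ContDiff ℝ 1 fun p : ℝ × ℝ × ℝ × ℝ => p.2))
  support := by
    obtain ⟨R, -, hR⟩ := hχ.support
    exact ⟨R, fun _ _ s _ h => mul_eq_zero_of_left (hR s h) _⟩

lemma IsCutoff.isTestFunction_transportTest (hχ : IsCutoff χ)
    (hF : ContDiff ℝ 1 (fun p : ℝ × ℝ × ℝ => F (p.1 : Phase) p.2.1 p.2.2))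
    (hU : ContDiff ℝ 1 (fun p : ℝ × ℝ × ℝ => U (p.1 : Phase) p.2.1 p.2.2)) (σ : ℝ) :
    IsTestFunction (transportTest χ F U σ) where
  contDiff := by
    have hU' : ContDiff ℝ 1 fun p : ℝ × ℝ × ℝ × ℝ => U (p.2.1 : Phase) p.2.2.1 p.2.2.2 :=
      hU.comp (by fun_prop : ContDiff ℝ 1 fun p : ℝ × ℝ × ℝ × ℝ => p.2)
    have hχ' : ContDiff ℝ 1 fun p : ℝ × ℝ × ℝ × ℝ => χ p.2.2.1 := hχ.contDiff.comp (by fun_prop)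
    have hshift : ContDiff ℝ 1 fun p : ℝ × ℝ × ℝ × ℝ =>
        (p.2.1 + (σ - p.1) * U (p.2.1 : Phase) p.2.2.1 p.2.2.2, p.2.2.1, p.2.2.2) :=
      ((by fun_prop : ContDiff ℝ 1 fun p : ℝ × ℝ × ℝ × ℝ => p.2.1).add
        ((by fun_prop : ContDiff ℝ 1 fun p : ℝ × ℝ × ℝ × ℝ => σ - p.1).mul hU')).prodMk
        (by fun_prop)
    exact hχ'.mul (hF.comp hshift)
  support := by
    obtain ⟨R, -, hR⟩ := hχ.support
    exact ⟨R, fun _ _ s _ h => mul_eq_zero_of_left (hR s h) _⟩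

lemma abs_transportDeriv_transportTest_le (hχ : IsCutoff χ)
    (hF : ContDiff ℝ 1 (fun p : ℝ × ℝ × ℝ => F (p.1 : Phase) p.2.1 p.2.2))
    (hU : ContDiff ℝ 1 (fun p : ℝ × ℝ × ℝ => U (p.1 : Phase) p.2.1 p.2.2))
    (hF1 : ∀ a b s x, |F a s x - F b s x| ≤ 1 * dist a b) {M : ℝ} (hM : 0 ≤ M)
    (hUM : ∀ a b s x, |U a s x - U b s x| ≤ M * dist a b) (σ v t : ℝ) (P : G) :
    |transportDeriv (transportTest χ F U σ) v t P| ≤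
      χ P.2.1 * (|v - U P.1 P.2.1 P.2.2| + |σ - t| * (M * |v|)) := by
  obtain ⟨θ, s, x⟩ := P
  induction θ using QuotientAddGroup.induction_on with
  | H y =>
    have hγ : HasDerivAt (fun u : ℝ => y + v * (u - t)) v t := by
      simpa using (((hasDerivAt_id t).sub_const t).const_mul v).const_add y
    have hderiv := hasDerivAt_comp_phase (hχ.isTestFunction_transportTest hF hU σ) hγ s x
    have hγt : y + v * (t - t) = y := by ring
    rw [hγt] at hderiv
    refine abs_le_of_hasDerivAt_of_abs_sub_le hderiv
      (c := fun u => χ s * (|v - U (y : Phase) s x| + |σ - u| * (M * |v|)))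
      (by fun_prop) fun u => ?_
    simp only [transportTest, hγt]
    set z := y + v * (u - t) with hz
    have hUz : |U (z : Phase) s x - U (y : Phase) s x| ≤ M * |v| * |u - t| := by
      refine (hUM _ _ _ _).trans ?_
      rw [mul_assoc, ← abs_mul]
      gcongr
      rw [dist_eq_norm, ← AddCircle.coe_sub]
      exact (norm_coe_phase_le _).trans_eq (by rw [hz, add_sub_cancel_left])
    rw [← mul_sub, abs_mul, abs_of_nonneg (hχ.nonneg s), mul_assoc]
    refine mul_le_mul_of_nonneg_left ((hF1 _ _ _ _).trans ?_) (hχ.nonneg s)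
    rw [one_mul, dist_eq_norm, ← AddCircle.coe_add, ← AddCircle.coe_add, ← AddCircle.coe_sub]
    calc _ ≤ |z + (σ - u) * U z s x - (y + (σ - t) * U y s x)| := norm_coe_phase_le _
      _ = |(v - U y s x) * (u - t) + (σ - u) * (U z s x - U y s x)| := by rw [hz]; ring_nf
      _ ≤ |v - U y s x| * |u - t| + |σ - u| * (M * |v| * |u - t|) := by
          refine (abs_add_le _ _).trans ?_
          rw [abs_mul, abs_mul]
          gcongr
      _ = _ := by ring

lemma continuous_of_contDiff_lift
    (hF : ContDiff ℝ 1 (fun p : ℝ × ℝ × ℝ => F (p.1 : Phase) p.2.1 p.2.2)) :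
    Continuous fun P : G => F P.1 P.2.1 P.2.2 :=
  (IsTestFunction.continuous_of_lift (F := fun _ => F)
    (hF.continuous.comp (by fun_prop : Continuous fun p : ℝ × ℝ × ℝ × ℝ => p.2))).comp
    (f := fun P : G => ((0 : ℝ), P)) (by fun_prop)

lemma abs_integral_transportTest_self_sub_le (hχ : IsCutoff χ)
    (hF : ContDiff ℝ 1 (fun p : ℝ × ℝ × ℝ => F (p.1 : Phase) p.2.1 p.2.2)) {f : G → ℝ}
    (hf : Continuous f) {e : ℝ} (hFf : ∀ P : G, |F P.1 P.2.1 P.2.2 - f P| ≤ e) (σ : ℝ)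
    (ν : Measure G) [IsProbabilityMeasure ν] :
    |∫ P : G, transportTest χ F U σ σ P.1 P.2.1 P.2.2 ∂ν - ∫ P, χ P.2.1 * f P ∂ν| ≤ e := by
  simp only [transportTest, sub_self, zero_mul, QuotientAddGroup.mk_zero, add_zero]
  exact hχ.abs_integral_mul_sub_integral_mul_le ν hf (continuous_of_contDiff_lift hF) hFf

lemma abs_integral_transportTest_sub_eulerMap_le {K : ℝ} {W : I → I → ℝ} {B : ℝ}
    (hW : KernelBound W B) (hχ : IsCutoff χ)
    (hF : ContDiff ℝ 1 (fun p : ℝ × ℝ × ℝ => F (p.1 : Phase) p.2.1 p.2.2))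
    (hU : ContDiff ℝ 1 (fun p : ℝ × ℝ × ℝ => U (p.1 : Phase) p.2.1 p.2.2))
    (hF1 : ∀ a b s x, |F a s x - F b s x| ≤ 1 * dist a b) {f : G → ℝ} (hf : Continuous f) {e : ℝ}
    (hFf : ∀ P : G, |F P.1 P.2.1 P.2.2 - f P| ≤ e) (ν : Measure G) [IsProbabilityMeasure ν]
    (hUv : ∀ P : G, |U P.1 P.2.1 P.2.2 - vel K W ν P| ≤ e) (t : ℝ) {h : ℝ} (hh : 0 ≤ h) :
    |∫ P : G, transportTest χ F U (t + h) t P.1 P.2.1 P.2.2 ∂ν -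
      ∫ P, χ P.2.1 * f (eulerMap K W ν h P) ∂ν| ≤ h * e + e := by
  have hUc := continuous_of_contDiff_lift hU
  have hcont : Continuous fun P : G =>
      F (P.1 + ((h * U P.1 P.2.1 P.2.2 : ℝ) : Phase)) P.2.1 P.2.2 :=
    (continuous_of_contDiff_lift hF).comp (f := fun P : G =>
      (P.1 + ((h * U P.1 P.2.1 P.2.2 : ℝ) : Phase), P.2))
      ((continuous_fst.add ((AddCircle.continuous_mk' _).comp
        (continuous_const.mul hUc))).prodMk continuous_snd)
  simp only [transportTest, add_sub_cancel_left]
  refine hχ.abs_integral_mul_sub_integral_mul_le ν (hf.comp (continuous_eulerMap hW ν h)) hcont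
    fun P => ?_
  have hphase : |F (P.1 + ((h * U P.1 P.2.1 P.2.2 : ℝ) : Phase)) P.2.1 P.2.2 -
      F (eulerMap K W ν h P).1 P.2.1 P.2.2| ≤ h * e := by
    refine (hF1 _ _ _ _).trans ?_
    rw [one_mul, eulerMap, dist_add_left, dist_eq_norm, ← AddCircle.coe_sub, ← mul_sub]
    refine (norm_coe_phase_le _).trans ?_
    rw [abs_mul, abs_of_nonneg hh]
    exact mul_le_mul_of_nonneg_left (hUv P) hh
  exact (abs_sub_le _ _ _).trans (add_le_add hphase (hFf (eulerMap K W ν h P)))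

end TransportTest

namespace IsMeasureSolution

variable {K : ℝ} {W : I → I → ℝ} {B T : ℝ} {m : Measure G} {μ : ℝ → Measure G} {χ : ℝ → ℝ}

lemma cutoff_mul_abs_vel_le (hW : KernelBound W B) (hχ : IsCutoff χ) {R : ℝ} (hR0 : 0 ≤ R)
    (hR : ∀ s, R < |s| → χ s = 0) (ν : Measure G) [IsProbabilityMeasure ν] (P : G) :
    χ P.2.1 * |vel K W ν P| ≤ R + |K| * B := by
  have hB := hW.nonneg
  rcases lt_or_ge R |P.2.1| with hP | hP
  · rw [hR _ hP, zero_mul]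
    positivity
  · calc χ P.2.1 * |vel K W ν P| ≤ |vel K W ν P| :=
          mul_le_of_le_one_left (abs_nonneg _) (hχ.le_one _)
      _ ≤ |P.2.1| + |K| * |drift W ν P| := by rw [← abs_mul]; exact abs_add_le _ _
      _ ≤ R + |K| * B := by
          gcongr
          exact abs_drift_le ν hW P

lemma abs_integral_transportTest_sub_le (hμ : IsMeasureSolution K W T m μ) (hW : KernelBound W B)
    (hχ : IsCutoff χ) {R : ℝ} (hR0 : 0 ≤ R) (hR : ∀ s, R < |s| → χ s = 0)
    {F U : Phase → ℝ → ℝ → ℝ}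
    (hF : ContDiff ℝ 1 (fun p : ℝ × ℝ × ℝ => F (p.1 : Phase) p.2.1 p.2.2))
    (hU : ContDiff ℝ 1 (fun p : ℝ × ℝ × ℝ => U (p.1 : Phase) p.2.1 p.2.2))
    (hF1 : ∀ a b s x, |F a s x - F b s x| ≤ 1 * dist a b)
    (hUM : ∀ a b s x, |U a s x - U b s x| ≤ |K| * B * dist a b) {t h e κ : ℝ} (ht : 0 ≤ t)
    (hh : 0 ≤ h) (hT : t + h ≤ T) (hUv : ∀ P : G, |U P.1 P.2.1 P.2.2 - vel K W (μ t) P| ≤ e)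
    (hκ : ∀ u ∈ Set.Icc t (t + h), ∀ P : G,
      χ P.2.1 * |vel K W (μ u) P - vel K W (μ t) P| ≤ κ) :
    |∫ P : G, transportTest χ F U (t + h) (t + h) P.1 P.2.1 P.2.2 ∂(μ (t + h)) -
      ∫ P : G, transportTest χ F U (t + h) t P.1 P.2.1 P.2.2 ∂(μ t)| ≤
        (κ + e + h * (|K| * B * (R + |K| * B))) * h := by
  have hB := hW.nonneg
  have hψ := hχ.isTestFunction_transportTest hF hU (t + h)
  rw [hμ.integral_sub_integral hW hψ ⟨ht, by linarith⟩ ⟨by linarith, hT⟩]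
  have hspeed : ∀ u ∈ Set.uIoc t (t + h),
      ‖∫ P, transportDeriv (transportTest χ F U (t + h)) (vel K W (μ u) P) u P ∂(μ u)‖ ≤
        κ + e + h * (|K| * B * (R + |K| * B)) := by
    intro u hu
    rw [Set.uIoc_of_le (by linarith)] at hu
    have := hμ.prob u ⟨by linarith [hu.1], by linarith [hu.2]⟩
    refine abs_integral_le_of_abs_le fun P =>
      (abs_transportDeriv_transportTest_le hχ hF hU hF1 (by positivity) hUM _ _ _ _).trans ?_
    have hfrozen : χ P.2.1 * |vel K W (μ u) P - U P.1 P.2.1 P.2.2| ≤ κ + e :=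
      calc χ P.2.1 * |vel K W (μ u) P - U P.1 P.2.1 P.2.2|
          ≤ χ P.2.1 * |vel K W (μ u) P - vel K W (μ t) P| +
              χ P.2.1 * |vel K W (μ t) P - U P.1 P.2.1 P.2.2| := by
            rw [← mul_add]
            exact mul_le_mul_of_nonneg_left (abs_sub_le _ _ _) (hχ.nonneg _)
        _ ≤ κ + e := by
            refine add_le_add (hκ u ⟨hu.1.le, hu.2⟩ P) ?_
            rw [abs_sub_comm]
            exact (mul_le_of_le_one_left (abs_nonneg _) (hχ.le_one _)).trans (hUv P)
    have hremaining : |t + h - u| ≤ h := by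
      rw [abs_of_nonneg] <;> linarith [hu.1, hu.2]
    calc χ P.2.1 * (|vel K W (μ u) P - U P.1 P.2.1 P.2.2| +
          |t + h - u| * (|K| * B * |vel K W (μ u) P|))
        = χ P.2.1 * |vel K W (μ u) P - U P.1 P.2.1 P.2.2| +
            |t + h - u| * (|K| * B * (χ P.2.1 * |vel K W (μ u) P|)) := by ring
      _ ≤ κ + e + h * (|K| * B * (R + |K| * B)) := by
          have := hχ.nonneg P.2.1
          gcongr
          exact cutoff_mul_abs_vel_le hW hχ hR0 hR (μ u) P
  simpa [abs_of_nonneg hh] using intervalIntegral.norm_integral_le_of_norm_le_const hspeed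

lemma abs_integral_sub_integral_eulerMap_le (hμ : IsMeasureSolution K W T m μ)
    (hW : KernelBound W B) (hχ : IsCutoff χ) {R : ℝ} (hR0 : 0 ≤ R)
    (hR : ∀ s, R < |s| → χ s = 0) {t h κ : ℝ} (ht : 0 ≤ t) (hh : 0 ≤ h) (hT : t + h ≤ T)
    (hκ : ∀ u ∈ Set.Icc t (t + h), ∀ P : G, χ P.2.1 * |vel K W (μ u) P - vel K W (μ t) P| ≤ κ)
    {f : G → ℝ} (hf : f ∈ lipClass) :
    |∫ P, χ P.2.1 * f P ∂(μ (t + h)) - ∫ P, χ P.2.1 * f (eulerMap K W (μ t) h P) ∂(μ t)| ≤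
      (κ + h * (|K| * B * (R + |K| * B))) * h := by
  have := hμ.prob t ⟨ht, by linarith⟩
  have := hμ.prob (t + h) ⟨by linarith, hT⟩
  refine le_of_forall_pos_le_add fun δ hδ => ?_
  set e := δ / (2 + 2 * h) with he_def
  have he : 0 < e := by positivity
  have hfc := continuous_of_mem_lipClass hf
  obtain ⟨F, hF, hFf, hF1⟩ := exists_contDiff_approx (f := f) (L := 1) (M := 1)
    (fun P Q => by simpa using hf.2 P Q)
    (fun a b s x => by simpa [distG_mk_mk] using hf.2 (a, s, x) (b, s, x)) he
  obtain ⟨U, hU, hUv, hUM⟩ := exists_contDiff_approx (M := |K| * B)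
    (abs_vel_sub_le_distG K (μ t) hW) (fun a b s x => by
      rw [vel, vel, add_sub_add_left_eq_sub, ← mul_sub, abs_mul, mul_assoc]
      simpa using mul_le_mul_of_nonneg_left (abs_drift_sub_le (μ t) hW (a, s, x) (b, s, x))
        (abs_nonneg K)) he
  have hend := abs_le.mp <|
    abs_integral_transportTest_self_sub_le (U := U) hχ hF hfc hFf (t + h) (μ (t + h))
  have hstart := abs_le.mp <|
    abs_integral_transportTest_sub_eulerMap_le hW hχ hF hU hF1 hfc hFf (μ t) hUv t hh
  have htransport := abs_le.mp <|
    hμ.abs_integral_transportTest_sub_le hW hχ hR0 hR hF hU hF1 hUM ht hh hT hUv hκ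
  have hδe : δ = 2 * e + 2 * h * e := by rw [he_def]; field_simp
  rw [abs_le]
  constructor <;> nlinarith

theorem eulerConsistent (hμ : IsMeasureSolution K W T m μ) (hW : KernelBound W B)
    (hχ : IsCutoff χ) : EulerConsistent K W T χ μ := by
  obtain ⟨R, hR0, hR⟩ := hχ.support
  have hB := hW.nonneg
  intro ε hε
  obtain ⟨δ, hδ, hmod⟩ := exists_uniform_modulus (H := fun t P => χ P.2.1 * vel K W (μ t) P)
    ((hχ.continuous_freq.comp continuous_snd).continuousOn.mul (hμ.continuousOn_vel hW))
    (fun t P hP => mul_eq_zero_of_left (hR _ hP) _) (half_pos hε)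
  set C := |K| * B * (R + |K| * B)
  have : 0 ≤ C := by positivity
  refine ⟨min (δ / 2) (ε / (2 * (C + 1))), by positivity, fun t h ht hh hh₀ hT f hf => ?_⟩
  have hκ : ∀ u ∈ Set.Icc t (t + h), ∀ P : G,
      χ P.2.1 * |vel K W (μ u) P - vel K W (μ t) P| ≤ ε / 2 := by
    intro u hu P
    have hut : |u - t| < δ := by
      rw [abs_of_nonneg] <;> linarith [hu.1, hu.2, min_le_left (δ / 2) (ε / (2 * (C + 1)))]
    rw [← abs_of_nonneg (hχ.nonneg P.2.1), ← abs_mul, mul_sub]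
    exact (hmod u ⟨by linarith [hu.1], by linarith [hu.2]⟩ t ⟨ht, by linarith⟩ hut P).le
  refine (hμ.abs_integral_sub_integral_eulerMap_le hW hχ hR0 hR ht hh.le hT hκ hf).trans ?_
  have hhC : h * C ≤ ε / 2 := by
    have := (le_div_iff₀ (by positivity)).mp (hh₀.trans (min_le_right _ _))
    nlinarith
  exact mul_le_mul_of_nonneg_right (by linarith) hh.le

lemma integral_cutoff_eq (hμ : IsMeasureSolution K W T m μ) (hχ : IsCutoff χ) {t : ℝ}
    (ht : t ∈ Set.Icc 0 T) : ∫ P, χ P.2.1 ∂(μ t) = ∫ P, χ P.2.1 ∂m := by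
  have hψ := hχ.isTestFunction_mul (F := fun _ _ _ => 1) contDiff_const
  simpa [transportDeriv, derivPhase] using hμ.weak _ hψ t ht

lemma integral_initial_eq [IsProbabilityMeasure m] (hμ : IsMeasureSolution K W T m μ)
    (hT : 0 ≤ T) (hχ : IsCutoff χ) {f : G → ℝ} (hf : f ∈ lipClass) :
    ∫ P, χ P.2.1 * f P ∂(μ 0) = ∫ P, χ P.2.1 * f P ∂m := by
  have h0 : (0 : ℝ) ∈ Set.Icc 0 T := ⟨le_rfl, hT⟩
  have := hμ.prob 0 h0
  have hfc := continuous_of_mem_lipClass hf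
  refine eq_of_forall_dist_le fun ε hε => ?_
  obtain ⟨F, hF, hFf, -⟩ := exists_contDiff_approx (f := f) (L := 1) (M := 1)
    (fun P Q => by simpa using hf.2 P Q)
    (fun a b s x => by simpa [distG_mk_mk] using hf.2 (a, s, x) (b, s, x)) (half_pos hε)
  have hFc := continuous_of_contDiff_lift hF
  have hsmooth : ∫ P : G, χ P.2.1 * F P.1 P.2.1 P.2.2 ∂(μ 0) =
      ∫ P : G, χ P.2.1 * F P.1 P.2.1 P.2.2 ∂m := by
    simpa using hμ.weak _ (hχ.isTestFunction_mul hF) 0 h0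
  have hμ₀ := abs_le.mp (hχ.abs_integral_mul_sub_integral_mul_le (μ 0) hfc hFc hFf)
  have hm := abs_le.mp (hχ.abs_integral_mul_sub_integral_mul_le m hfc hFc hFf)
  rw [Real.dist_eq, abs_le]
  constructor <;> linarith

end IsMeasureSolution

/-! ### The law of the initial data -/

section Scheffe

variable {α ι : Type*} [MeasurableSpace α] {μ : Measure α} {l : Filter ι}
  [l.IsCountablyGenerated] {p : ι → α → ℝ} {p₀ : α → ℝ}
  (hp : ∀ i, Integrable (p i) μ) (hp_nonneg : ∀ i a, 0 ≤ p i a) (hp₀ : Integrable p₀ μ)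
  (hmass : ∀ i, ∫ a, p i a ∂μ = ∫ a, p₀ a ∂μ) (hlim : ∀ a, Tendsto (p · a) l (𝓝 (p₀ a)))
include hp hp_nonneg hp₀ hmass hlim

-- Scheffé: since the masses agree, it suffices to control the part of `p₀ - p i` below `p₀`.
lemma tendsto_integral_abs_sub_of_tendsto :
    Tendsto (fun i => ∫ a, |p i a - p₀ a| ∂μ) l (𝓝 0) := by
  have hpos_part : Tendsto (fun i => ∫ a, max (p₀ a - p i a) 0 ∂μ) l (𝓝 (∫ _, 0 ∂μ)) := by
    refine tendsto_integral_filter_of_dominated_convergence (fun a => |p₀ a|)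
      (Eventually.of_forall fun i => (hp₀.sub (hp i)).pos_part.aestronglyMeasurable)
      (Eventually.of_forall fun i => Eventually.of_forall fun a => ?_) hp₀.abs
      (Eventually.of_forall fun a => ?_)
    · rw [Real.norm_eq_abs, abs_of_nonneg (le_max_right _ _)]
      exact max_le (by linarith [le_abs_self (p₀ a), hp_nonneg i a]) (abs_nonneg _)
    · simpa using ((hlim a).const_sub (p₀ a)).max (tendsto_const_nhds (x := (0 : ℝ)))
  have habs (i) : ∫ a, |p i a - p₀ a| ∂μ = 2 * ∫ a, max (p₀ a - p i a) 0 ∂μ :=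
    calc ∫ a, |p i a - p₀ a| ∂μ = ∫ a, (p i a - p₀ a) + 2 * max (p₀ a - p i a) 0 ∂μ := by
          congr 1 with a
          rcases le_total (p i a) (p₀ a) with h | h
          · rw [abs_of_nonpos (by linarith), max_eq_left (by linarith)]; ring
          · rw [abs_of_nonneg (by linarith), max_eq_right (by linarith)]; ring
      _ = 2 * ∫ a, max (p₀ a - p i a) 0 ∂μ := by
          have hmax : Integrable (fun a => 2 * max (p₀ a - p i a) 0) μ :=
            (hp₀.sub (hp i)).pos_part.const_mul 2
          rw [integral_add (by exact (hp i).sub hp₀) hmax, integral_sub (hp i) hp₀, hmass i,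
            sub_self, zero_add, integral_const_mul]
  simpa [habs] using hpos_part.const_mul 2

lemma tendsto_integral_mul_of_tendsto {f : ι → α → ℝ} {f₀ : α → ℝ} {c : ℝ}
    (hf : ∀ i, AEStronglyMeasurable (f i) μ) (hfc : ∀ i a, |f i a| ≤ c)
    (hflim : ∀ a, Tendsto (f · a) l (𝓝 (f₀ a))) :
    Tendsto (fun i => ∫ a, f i a * p i a ∂μ) l (𝓝 (∫ a, f₀ a * p₀ a ∂μ)) := by
  have hint (i) {r : α → ℝ} (hr : Integrable r μ) : Integrable (fun a => f i a * r a) μ :=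
    hr.bdd_mul (hf i) (Eventually.of_forall (hfc i))
  have hfrozen : Tendsto (fun i => ∫ a, f i a * p₀ a ∂μ) l (𝓝 (∫ a, f₀ a * p₀ a ∂μ)) := by
    refine tendsto_integral_filter_of_dominated_convergence (fun a => c * |p₀ a|)
      (Eventually.of_forall fun i => (hint i hp₀).aestronglyMeasurable)
      (Eventually.of_forall fun i => Eventually.of_forall fun a => ?_) (hp₀.abs.const_mul c)
      (Eventually.of_forall fun a => (hflim a).mul_const _)
    rw [Real.norm_eq_abs, abs_mul]
    exact mul_le_mul_of_nonneg_right (hfc i a) (abs_nonneg _)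
  have hdiff : Tendsto (fun i => ∫ a, f i a * p i a ∂μ - ∫ a, f i a * p₀ a ∂μ) l (𝓝 0) := by
    refine squeeze_zero_norm (a := fun i => c * ∫ a, |p i a - p₀ a| ∂μ) (fun i => ?_)
      (by simpa using (tendsto_integral_abs_sub_of_tendsto hp hp_nonneg hp₀ hmass hlim).const_mul c)
    rw [← integral_sub (hint i (hp i)) (hint i hp₀), ← integral_const_mul]
    refine norm_integral_le_of_norm_le (((hp i).sub hp₀).abs.const_mul c)
      (Eventually.of_forall fun a => ?_)
    rw [← mul_sub, Real.norm_eq_abs, abs_mul]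
    exact mul_le_mul_of_nonneg_right (hfc i a) (abs_nonneg _)
  simpa using hdiff.add hfrozen

end Scheffe

/-- The law of the frequencies. -/
def freqLaw (g : ℝ → ℝ) : Measure ℝ := volume.withDensity fun s => ENNReal.ofReal (g s)

/-- The conditional law of the phase at the position `x`, given the frequency `s`. -/
def phaseLaw (q : Phase → ℝ → I → ℝ) (x : I) (s : ℝ) : Measure Phase :=
  volume.withDensity fun φ => ENNReal.ofReal (q φ s x)

/-- The joint law of phase and frequency at the position `x`. -/
def pairLaw (g : ℝ → ℝ) (q : Phase → ℝ → I → ℝ) (x : I) : Measure (Phase × ℝ) :=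
  volume.withDensity fun p => ENNReal.ofReal (q p.1 p.2 x * g p.2)

/-- The initial law of the mean-field equation, under which the position is uniformly
distributed. -/
def initialLaw (g : ℝ → ℝ) (q : Phase → ℝ → I → ℝ) : Measure G :=
  densityMeasure fun P => q P.1 P.2.1 P.2.2 * g P.2.1

/-- `g` is a probability density of the frequencies, and `q · s x` is a conditional probability
density of the phases which depends continuously on the position `x`. -/
structure IsInitialDensity (g : ℝ → ℝ) (q : Phase → ℝ → I → ℝ) : Prop where
  measurable_freq : Measurable g
  nonneg_freq : ∀ s, 0 ≤ g s
  prob_freq : IsProbabilityMeasure (freqLaw g)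
  measurable : Measurable fun P : G => q P.1 P.2.1 P.2.2
  nonneg : ∀ φ s x, 0 ≤ q φ s x
  integral_eq_one : ∀ s x, ∫ φ, q φ s x = 1
  continuous_pos : ∀ φ s, Continuous (q φ s)

namespace IsInitialDensity

variable {g : ℝ → ℝ} {q : Phase → ℝ → I → ℝ} (h : IsInitialDensity g q)
include h

lemma measurable_density : Measurable fun P : G => q P.1 P.2.1 P.2.2 * g P.2.1 :=
  h.measurable.mul (h.measurable_freq.comp (by fun_prop))

lemma density_nonneg (P : G) : 0 ≤ q P.1 P.2.1 P.2.2 * g P.2.1 :=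
  mul_nonneg (h.nonneg _ _ _) (h.nonneg_freq _)

lemma measurable_pair (x : I) : Measurable fun p : Phase × ℝ => q p.1 p.2 x :=
  h.measurable.comp (f := fun p : Phase × ℝ => (p.1, p.2, x)) (by fun_prop)

lemma measurable_pairDensity (x : I) : Measurable fun p : Phase × ℝ => q p.1 p.2 x * g p.2 :=
  (h.measurable_pair x).mul (h.measurable_freq.comp measurable_snd)

lemma pairDensity_nonneg (x : I) (p : Phase × ℝ) : 0 ≤ q p.1 p.2 x * g p.2 :=
  mul_nonneg (h.nonneg _ _ _) (h.nonneg_freq _)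

lemma isProbabilityMeasure_phaseLaw (x : I) (s : ℝ) : IsProbabilityMeasure (phaseLaw q x s) :=
  isProbabilityMeasure_withDensity_ofReal (fun _ => h.nonneg _ _ _) (h.integral_eq_one s x)

lemma measurable_phaseLaw_apply (x : I) {A : Set (Phase × ℝ)} (hA : MeasurableSet A) :
    Measurable fun s => phaseLaw q x s {φ | (φ, s) ∈ A} := by
  have hindicator (s : ℝ) : phaseLaw q x s {φ | (φ, s) ∈ A} =
      ∫⁻ φ, A.indicator (fun p => ENNReal.ofReal (q p.1 p.2 x)) (φ, s) := by
    have hs : MeasurableSet {φ | (φ, s) ∈ A} := measurable_prodMk_right hA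
    rw [phaseLaw, withDensity_apply _ hs, ← lintegral_indicator hs]
    rfl
  simp_rw [hindicator]
  exact ((h.measurable_pair x).ennreal_ofReal.indicator hA).lintegral_prod_left'

lemma pairLaw_apply (x : I) {A : Set (Phase × ℝ)} (hA : MeasurableSet A) :
    pairLaw g q x A = ∫⁻ s, phaseLaw q x s {φ | (φ, s) ∈ A} ∂(freqLaw g) := by
  rw [pairLaw, withDensity_apply _ hA, ← lintegral_indicator hA, Measure.volume_eq_prod,
    lintegral_prod_symm' _ ((h.measurable_pairDensity x).ennreal_ofReal.indicator hA), freqLaw,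
    lintegral_withDensity_eq_lintegral_mul _ h.measurable_freq.ennreal_ofReal
      (h.measurable_phaseLaw_apply x hA)]
  refine lintegral_congr fun s => ?_
  have hs : MeasurableSet {φ | (φ, s) ∈ A} := measurable_prodMk_right hA
  rw [Pi.mul_apply, phaseLaw, withDensity_apply _ hs, ← lintegral_indicator hs,
    ← lintegral_const_mul' _ _ ENNReal.ofReal_ne_top]
  refine lintegral_congr fun φ => ?_
  by_cases hφ : (φ, s) ∈ A
  · rw [Set.indicator_of_mem hφ, Set.indicator_of_mem (show φ ∈ {φ | (φ, s) ∈ A} from hφ),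
      ENNReal.ofReal_mul (h.nonneg _ _ _), mul_comm]
  · rw [Set.indicator_of_notMem hφ, Set.indicator_of_notMem (show φ ∉ {φ | (φ, s) ∈ A} from hφ),
      mul_zero]

lemma isProbabilityMeasure_pairLaw (x : I) : IsProbabilityMeasure (pairLaw g q x) := by
  have := h.prob_freq
  have := h.isProbabilityMeasure_phaseLaw x
  constructor
  rw [h.pairLaw_apply x MeasurableSet.univ]
  simp

lemma integral_pairLaw (x : I) (f : Phase × ℝ → ℝ) :
    ∫ p, f p ∂(pairLaw g q x) = ∫ p : Phase × ℝ, f p * (q p.1 p.2 x * g p.2) :=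
  integral_withDensity_ofReal (h.measurable_pairDensity x) (h.pairDensity_nonneg x) f

lemma integral_pairDensity (x : I) : ∫ p : Phase × ℝ, q p.1 p.2 x * g p.2 = 1 := by
  have := h.isProbabilityMeasure_pairLaw x
  simpa using (h.integral_pairLaw x fun _ => 1).symm

lemma isProbabilityMeasure_initialLaw : IsProbabilityMeasure (initialLaw g q) := by
  have hm := h.measurable_density.ennreal_ofReal
  have hassoc := volume_preserving_prodAssoc (α₁ := Phase) (β₁ := ℝ) (γ₁ := I)
  have hmass (x : I) : ∫⁻ p : Phase × ℝ, ENNReal.ofReal (q p.1 p.2 x * g p.2) = 1 := by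
    have := h.isProbabilityMeasure_pairLaw x
    simpa [pairLaw] using measure_univ (μ := pairLaw g q x)
  constructor
  rw [initialLaw, densityMeasure, withDensity_apply _ MeasurableSet.univ, Measure.restrict_univ,
    ← hassoc.lintegral_comp hm, Measure.volume_eq_prod (Phase × ℝ) I]
  exact (lintegral_prod_symm' _ (hm.comp hassoc.measurable)).trans <|
    (lintegral_congr hmass).trans (by simp)

lemma integral_initialLaw {f : G → ℝ} (hf : Integrable f (initialLaw g q)) :
    ∫ P, f P ∂(initialLaw g q) = ∫ x : I, ∫ p : Phase × ℝ, f (p.1, p.2, x) ∂(pairLaw g q x) := by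
  have hassoc := volume_preserving_prodAssoc (α₁ := Phase) (β₁ := ℝ) (γ₁ := I)
  have hint := (integrable_withDensity_ofReal_iff h.measurable_density h.density_nonneg).mp hf
  simp_rw [h.integral_pairLaw]
  rw [initialLaw, integral_densityMeasure h.measurable_density h.density_nonneg,
    ← hassoc.integral_comp MeasurableEquiv.prodAssoc.measurableEmbedding,
    Measure.volume_eq_prod (Phase × ℝ) I]
  exact integral_prod_symm _ (hassoc.integrable_comp_of_integrable hint)

lemma continuous_integral_pairLaw {f : G → ℝ} (hf : Continuous f) {c : ℝ} (hc : ∀ P, |f P| ≤ c) :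
    Continuous fun x : I => ∫ p : Phase × ℝ, f (p.1, p.2, x) ∂(pairLaw g q x) := by
  have hint (x : I) := integrable_of_integral_eq_one (h.integral_pairDensity x)
  simp_rw [h.integral_pairLaw]
  refine continuous_iff_continuousAt.mpr fun x₀ => ?_
  exact tendsto_integral_mul_of_tendsto hint h.pairDensity_nonneg (hint x₀)
    (fun x => by rw [h.integral_pairDensity, h.integral_pairDensity])
    (fun p => ((h.continuous_pos _ _).tendsto x₀).mul_const _)
    (fun x => (by fun_prop : Continuous fun p : Phase × ℝ => f (p.1, p.2, x)).aestronglyMeasurable)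
    (fun _ _ => hc _) (fun p => (by fun_prop : Continuous fun x : I => f (p.1, p.2, x)).tendsto x₀)

end IsInitialDensity

namespace IsSampled

variable {Ω : Type*} [MeasurableSpace Ω] {Pr : Measure Ω} [IsProbabilityMeasure Pr] {g : ℝ → ℝ}
  {q : Phase → ℝ → I → ℝ} {ξ : (n : ℕ) → Fin n → I} {ω : ℕ → Ω → ℝ}
  {θ₀ : (n : ℕ) → Fin n → Ω → Phase} (hs : IsSampled Pr g q ξ ω θ₀) (h : IsInitialDensity g q)
include hs

lemma measurable_pair (n : ℕ) (i : Fin n) : Measurable fun z => (θ₀ n i z, ω i z) :=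
  (hs.measurable_phase n i).prodMk (hs.measurable_freq i)

include h

lemma map_pair_pi_apply (n : ℕ) {A : Fin n → Set (Phase × ℝ)} (hA : ∀ i, MeasurableSet (A i)) :
    Pr.map (fun z (i : Fin n) => (θ₀ n i z, ω i z)) (Set.univ.pi A) =
      ∫⁻ z, ∏ i, phaseLaw q (ξ n i) (ω i z) {φ | (φ, ω i z) ∈ A i} ∂Pr := by
  have hω : Measurable fun z (i : Fin n) => ω i z :=
    measurable_pi_lambda _ fun i => hs.measurable_freq i
  have hθ : Measurable fun z (i : Fin n) => θ₀ n i z :=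
    measurable_pi_lambda _ fun i => hs.measurable_phase n i
  set D : Set ((Fin n → ℝ) × (Fin n → Phase)) := {p | ∀ i, (p.2 i, p.1 i) ∈ A i} with hD
  have hDm : MeasurableSet D := by
    rw [hD, Set.ofPred_forall]
    refine MeasurableSet.iInter fun i => ?_
    exact (by fun_prop : Measurable fun p : (Fin n → ℝ) × (Fin n → Phase) => (p.2 i, p.1 i)) (hA i)
  have hcond : ∀ᵐ w ∂(Pr.map fun z (i : Fin n) => ω i z),
      condDistrib (fun z (i : Fin n) => θ₀ n i z) (fun z (i : Fin n) => ω i z) Pr w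
        (Prod.mk w ⁻¹' D) = ∏ i, phaseLaw q (ξ n i) (w i) {φ | (φ, w i) ∈ A i} := by
    filter_upwards [hs.condLaw_phase n] with w hw
    have := fun i : Fin n => h.isProbabilityMeasure_phaseLaw (ξ n i) (w i)
    have hsection : Prod.mk w ⁻¹' D = Set.univ.pi fun i => {φ | (φ, w i) ∈ A i} := by
      ext φ; simp [hD]
    rw [hw, hsection]
    exact Measure.pi_pi (fun i => phaseLaw q (ξ n i) (w i)) _
  calc Pr.map (fun z (i : Fin n) => (θ₀ n i z, ω i z)) (Set.univ.pi A)
      = Pr.map (fun z => ((fun i : Fin n => ω i z), fun i : Fin n => θ₀ n i z)) D := by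
        rw [Measure.map_apply (measurable_pi_lambda _ (hs.measurable_pair n))
          (MeasurableSet.univ_pi hA), Measure.map_apply (hω.prodMk hθ) hDm]
        congr 1
        ext z
        simp [hD]
    _ = ∫⁻ w, ∏ i, phaseLaw q (ξ n i) (w i) {φ | (φ, w i) ∈ A i}
          ∂(Pr.map fun z (i : Fin n) => ω i z) := by
        rw [← compProd_map_condDistrib hθ.aemeasurable, Measure.compProd_apply hDm,
          lintegral_congr_ae hcond]
    _ = _ := lintegral_map (Finset.measurable_prod _ fun i _ =>
        (h.measurable_phaseLaw_apply _ (hA i)).comp (measurable_pi_apply i)) hω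

lemma map_pair_eq (n : ℕ) :
    Pr.map (fun z (i : Fin n) => (θ₀ n i z, ω i z)) =
      Measure.pi fun i : Fin n => pairLaw g q (ξ n i) := by
  have := fun i : Fin n => h.isProbabilityMeasure_pairLaw (ξ n i)
  refine (Measure.pi_eq fun A hA => ?_).symm
  have hmeas (i : Fin n) : Measurable fun s => phaseLaw q (ξ n i) s {φ | (φ, s) ∈ A i} :=
    h.measurable_phaseLaw_apply _ (hA i)
  have hind : iIndepFun (fun (i : Fin n) z => phaseLaw q (ξ n i) (ω i z) {φ | (φ, ω i z) ∈ A i})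
      Pr := (hs.indep_freq.precomp (Fin.val_injective (n := n))).comp
        (fun i s => phaseLaw q (ξ n i) s {φ | (φ, s) ∈ A i}) hmeas
  rw [hs.map_pair_pi_apply h n hA, lintegral_prod_eq_prod_lintegral_of_indepFun Finset.univ _ hind
    fun i => (hmeas i).comp (hs.measurable_freq i)]
  refine Finset.prod_congr rfl fun i _ => ?_
  rw [h.pairLaw_apply _ (hA i), freqLaw, ← hs.law_freq i,
    lintegral_map (hmeas i) (hs.measurable_freq i)]

lemma map_pair_apply_eq (n : ℕ) (i : Fin n) :
    Pr.map (fun z => (θ₀ n i z, ω i z)) = pairLaw g q (ξ n i) := by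
  have := fun i : Fin n => h.isProbabilityMeasure_pairLaw (ξ n i)
  rw [← (measurePreserving_eval (fun i : Fin n => pairLaw g q (ξ n i)) i).map_eq,
    ← hs.map_pair_eq h n, Measure.map_map (measurable_pi_apply i)
      (measurable_pi_lambda _ (hs.measurable_pair n))]
  rfl

lemma iIndepFun_pair (n : ℕ) : iIndepFun (fun (i : Fin n) z => (θ₀ n i z, ω i z)) Pr := by
  rw [iIndepFun_iff_map_fun_eq_pi_map fun i => (hs.measurable_pair n i).aemeasurable,
    hs.map_pair_eq h n]
  simp_rw [hs.map_pair_apply_eq h n]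

end IsSampled

/-! ### Convergence of the initial empirical measures -/

section PartitionOfUnity

variable {X ι : Type*} [TopologicalSpace X] {A : Set X} (φ : PartitionOfUnity ι X A)

lemma abs_partition_le_one (j : ι) (P : X) : |φ j P| ≤ 1 := by
  rw [abs_of_nonneg (φ.nonneg j P)]
  exact φ.le_one j P

lemma integrable_partition [MeasurableSpace X] [BorelSpace X] (ν : Measure X) [IsFiniteMeasure ν]
    (j : ι) : Integrable (φ j) ν :=
  .of_bound (φ j).continuous.measurable.aestronglyMeasurable 1
    (Eventually.of_forall (abs_partition_le_one φ j))

variable [Fintype ι]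

lemma sum_partition_le_one (P : X) : ∑ j, φ j P ≤ 1 := by
  simpa only [finsum_eq_sum_of_fintype] using φ.sum_le_one P

lemma sum_partition_eq_one {P : X} (hP : P ∈ A) : ∑ j, φ j P = 1 := by
  simpa only [finsum_eq_sum_of_fintype] using φ.sum_eq_one hP

lemma abs_sub_sum_mul_partition_le {f : X → ℝ} {p : ι → X} {δ : ℝ} (hδ : 0 ≤ δ)
    (hf : ∀ P, |f P| ≤ 1) (hosc : ∀ j P, φ j P ≠ 0 → |f P - f (p j)| ≤ δ) (P : X) :
    |f P - ∑ j, f (p j) * φ j P| ≤ δ + (1 - ∑ j, φ j P) := by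
  have hterm (j) : |(f P - f (p j)) * φ j P| ≤ δ * φ j P := by
    rw [abs_mul, abs_of_nonneg (φ.nonneg j P)]
    by_cases hj : φ j P = 0
    · simp [hj]
    · exact mul_le_mul_of_nonneg_right (hosc j P hj) (φ.nonneg j P)
  have hrest : 0 ≤ 1 - ∑ j, φ j P := sub_nonneg.mpr (sum_partition_le_one φ P)
  calc |f P - ∑ j, f (p j) * φ j P|
      = |∑ j, (f P - f (p j)) * φ j P + f P * (1 - ∑ j, φ j P)| := by
        simp_rw [sub_mul, Finset.sum_sub_distrib, ← Finset.mul_sum]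
        ring_nf
    _ ≤ ∑ j, δ * φ j P + 1 * (1 - ∑ j, φ j P) := by
        refine (abs_add_le _ _).trans (add_le_add ?_ ?_)
        · exact (Finset.abs_sum_le_sum_abs _ _).trans (Finset.sum_le_sum fun j _ => hterm j)
        · rw [abs_mul, abs_of_nonneg hrest]
          exact mul_le_mul_of_nonneg_right (hf P) hrest
    _ ≤ δ + (1 - ∑ j, φ j P) := by
        rw [← Finset.mul_sum, one_mul]
        exact add_le_add_left (mul_le_of_le_one_right hδ (sum_partition_le_one φ P)) _

variable [MeasurableSpace X] [BorelSpace X]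

section Integral

variable (ν : Measure X) [IsProbabilityMeasure ν]

lemma integral_one_sub_sum_partition :
    ∫ P, (1 - ∑ j, φ j P) ∂ν = 1 - ∑ j, ∫ P, φ j P ∂ν := by
  have hφ (j) := integrable_partition φ ν j
  rw [integral_sub (integrable_const _) (integrable_finsetSum _ fun j _ => hφ j),
    integral_finsetSum _ fun j _ => hφ j]
  simp

lemma integrable_one_sub_sum_partition : Integrable (fun P => 1 - ∑ j, φ j P) ν :=
  (integrable_const _).sub (integrable_finsetSum _ fun j _ => integrable_partition φ ν j)

lemma one_sub_sum_integral_partition_le (hA : MeasurableSet A) :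
    1 - ∑ j, ∫ P, φ j P ∂ν ≤ ν.real Aᶜ := by
  rw [← integral_one_sub_sum_partition, ← integral_indicator_one hA.compl]
  refine integral_mono (integrable_one_sub_sum_partition φ ν)
    ((integrable_const _).indicator hA.compl) fun P => ?_
  by_cases hP : P ∈ A
  · simp [hP, sum_partition_eq_one φ hP]
  · simpa [hP] using Finset.sum_nonneg fun j _ => φ.nonneg j P

lemma abs_integral_sub_sum_mul_integral_partition_le {f : X → ℝ} {p : ι → X} {δ : ℝ}
    (hδ : 0 ≤ δ) (hfi : Integrable f ν) (hf : ∀ P, |f P| ≤ 1)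
    (hosc : ∀ j P, φ j P ≠ 0 → |f P - f (p j)| ≤ δ) :
    |∫ P, f P ∂ν - ∑ j, f (p j) * ∫ P, φ j P ∂ν| ≤ δ + (1 - ∑ j, ∫ P, φ j P ∂ν) := by
  have hφ (j) : Integrable (fun P => f (p j) * φ j P) ν :=
    (integrable_partition φ ν j).const_mul _
  calc |∫ P, f P ∂ν - ∑ j, f (p j) * ∫ P, φ j P ∂ν|
      = ‖∫ P, (f P - ∑ j, f (p j) * φ j P) ∂ν‖ := by
        rw [integral_sub hfi (integrable_finsetSum _ fun j _ => hφ j),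
          integral_finsetSum _ fun j _ => hφ j]
        simp_rw [integral_const_mul, Real.norm_eq_abs]
    _ ≤ ∫ P, (δ + (1 - ∑ j, φ j P)) ∂ν :=
        norm_integral_le_of_norm_le
          ((integrable_const _).add (integrable_one_sub_sum_partition φ ν))
          (Eventually.of_forall (abs_sub_sum_mul_partition_le φ hδ hf hosc))
    _ = δ + (1 - ∑ j, ∫ P, φ j P ∂ν) := by
        rw [integral_add (integrable_const _) (integrable_one_sub_sum_partition φ ν),
          integral_one_sub_sum_partition]
        simp

end Integral

lemma abs_integral_sub_integral_le_of_partition (hA : MeasurableSet A) (ν m : Measure X)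
    [IsProbabilityMeasure ν] [IsProbabilityMeasure m] {f : X → ℝ} {p : ι → X} {δ : ℝ}
    (hδ : 0 ≤ δ) (hfm : Measurable f) (hf : ∀ P, |f P| ≤ 1)
    (hosc : ∀ j P, φ j P ≠ 0 → |f P - f (p j)| ≤ δ) :
    |∫ P, f P ∂ν - ∫ P, f P ∂m| ≤
      2 * ∑ j, |∫ P, φ j P ∂ν - ∫ P, φ j P ∂m| + 2 * (δ + m.real Aᶜ) := by
  have happrox (κ : Measure X) [IsProbabilityMeasure κ] :=
    abs_integral_sub_sum_mul_integral_partition_le φ κ hδ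
      (.of_bound hfm.aestronglyMeasurable 1 (Eventually.of_forall hf)) hf hosc
  have hmass := one_sub_sum_integral_partition_le φ m hA
  have hweighted : |∑ j, f (p j) * ∫ P, φ j P ∂ν - ∑ j, f (p j) * ∫ P, φ j P ∂m| ≤
      ∑ j, |∫ P, φ j P ∂ν - ∫ P, φ j P ∂m| := by
    rw [← Finset.sum_sub_distrib]
    refine (Finset.abs_sum_le_sum_abs _ _).trans (Finset.sum_le_sum fun j _ => ?_)
    rw [← mul_sub, abs_mul]
    exact mul_le_of_le_one_left (abs_nonneg _) (hf _)
  have hplain : |∑ j, ∫ P, φ j P ∂ν - ∑ j, ∫ P, φ j P ∂m| ≤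
      ∑ j, |∫ P, φ j P ∂ν - ∫ P, φ j P ∂m| := by
    rw [← Finset.sum_sub_distrib]
    exact Finset.abs_sum_le_sum_abs _ _
  have hν := happrox ν
  have hm := happrox m
  rw [abs_le] at *
  constructor <;> linarith

end PartitionOfUnity

lemma exists_partitionOfUnity_isSubordinate_ball {X : Type*} [MetricSpace X] {A : Set X}
    (hA : IsCompact A) {r : ℝ} (hr : 0 < r) :
    ∃ (t : Finset X) (φ : PartitionOfUnity t X A), φ.IsSubordinate fun p => Metric.ball p r := by
  obtain ⟨t, -, ht⟩ := hA.elim_nhds_subcover (fun P => Metric.ball P r)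
    fun P _ => Metric.ball_mem_nhds P hr
  exact ⟨t, PartitionOfUnity.exists_isSubordinate_of_locallyFinite hA.isClosed _
    (fun _ => Metric.isOpen_ball) (locallyFinite_of_finite _)
    (by simpa [Set.iUnion_subtype] using ht)⟩

lemma exists_isCompact_measureReal_compl_le {X : Type*} [MetricSpace X] [CompleteSpace X]
    [SecondCountableTopology X] [MeasurableSpace X] [BorelSpace X] (m : Measure X)
    [IsFiniteMeasure m] {ε : ℝ} (hε : 0 < ε) : ∃ A, IsCompact A ∧ m.real Aᶜ ≤ ε := by
  obtain ⟨A, hA, hAm⟩ := isTightMeasureSet_iff_exists_isCompact_measure_compl_le.mp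
    (isTightMeasureSet_singleton (μ := m)) (ENNReal.ofReal ε) (by simpa using hε)
  exact ⟨A, hA, ENNReal.toReal_le_of_le_ofReal hε.le (hAm m rfl)⟩

-- A partition of unity on a compact set carrying most of `m`, with small supports, discretizes
-- all functions of `lipClass` at once.
lemma exists_finite_observables (m : Measure G) [IsProbabilityMeasure m] {ε : ℝ} (hε : 0 < ε) :
    ∃ (t : Finset G) (φ : t → G → ℝ), (∀ j, Continuous (φ j)) ∧ (∀ j P, |φ j P| ≤ 1) ∧
      ∀ (ν : Measure G) [IsProbabilityMeasure ν],
        blDist ν m ≤ 2 * ∑ j, |∫ P, φ j P ∂ν - ∫ P, φ j P ∂m| + ε := by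
  obtain ⟨A, hA, hAm⟩ := exists_isCompact_measureReal_compl_le m (by positivity : 0 < ε / 4)
  obtain ⟨t, φ, hφ⟩ :=
    exists_partitionOfUnity_isSubordinate_ball hA (by positivity : 0 < ε / 12)
  refine ⟨t, fun j => φ j, fun j => (φ j).continuous, abs_partition_le_one φ,
    fun ν _ => blDist_le fun f hf => ?_⟩
  have hosc : ∀ j P, φ j P ≠ 0 → |f P - f j| ≤ ε / 4 := fun j P hj => by
    have hP : dist P j < ε / 12 := hφ j (subset_tsupport _ hj)
    linarith [hf.2 P j, distG_le_three_mul_dist P j]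
  have := abs_integral_sub_integral_le_of_partition φ hA.measurableSet ν m
    (by positivity : 0 ≤ ε / 4) (continuous_of_mem_lipClass hf).measurable
    (abs_le_one_of_mem_lipClass hf) hosc
  linarith

lemma tendsto_zero_of_forall_eventually_lt {α : Type*} {l : Filter α} {a : α → ℝ}
    (h : ∀ k : ℕ, ∀ᶠ n in l, |a n| < 1 / (k + 1 : ℝ)) : Tendsto a l (𝓝 0) := by
  refine Metric.tendsto_nhds.mpr fun ε hε => ?_
  obtain ⟨k, hk⟩ := exists_nat_one_div_lt hε
  filter_upwards [h k] with n hn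
  rw [Real.dist_eq, sub_zero]
  exact hn.trans hk

section TriangularArray

variable {Ω : Type*} [MeasurableSpace Ω] {Pr : Measure Ω} [IsProbabilityMeasure Pr]

lemma measureReal_sum_sub_integral_ge_le {n : ℕ} {X : Fin n → Ω → ℝ} (hX : ∀ i, Measurable (X i))
    (hX1 : ∀ i z, |X i z| ≤ 1) (hind : iIndepFun X Pr) {ε : ℝ} (hε : 0 ≤ ε) :
    Pr.real {z | ε * n ≤ ∑ i, (X i z - ∫ z', X i z' ∂Pr)} ≤ Real.exp (-(ε ^ 2 / 2)) ^ n := by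
  have hsub (i) : HasSubgaussianMGF (fun z => X i z - ∫ z', X i z' ∂Pr) 1 Pr := by
    convert hasSubgaussianMGF_of_mem_Icc (μ := Pr) (a := -1) (b := 1) (hX i).aemeasurable
      (Eventually.of_forall fun z => abs_le.mp (hX1 i z)) using 1
    ext
    norm_num
  have hind' : iIndepFun (fun i z => X i z - ∫ z', X i z' ∂Pr) Pr :=
    hind.comp (fun i x => x - ∫ z', X i z' ∂Pr) fun i => measurable_id.sub_const _
  refine (HasSubgaussianMGF.measure_sum_ge_le_of_iIndepFun hind' (fun i _ => hsub i)
    (by positivity : 0 ≤ ε * n)).trans_eq ?_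
  rw [← Real.exp_nat_mul]
  congr 1
  simp only [Finset.sum_const, Finset.card_univ, Fintype.card_fin, nsmul_eq_mul, mul_one,
    NNReal.coe_natCast]
  rcases eq_or_ne n 0 with rfl | hn
  · simp
  · have : (n : ℝ) ≠ 0 := by exact_mod_cast hn
    field_simp

variable {X : (n : ℕ) → Fin n → Ω → ℝ} (hX : ∀ n i, Measurable (X n i))
  (hX1 : ∀ n i z, |X n i z| ≤ 1) (hind : ∀ n, iIndepFun (X n) Pr)
include hX hX1 hind

lemma ae_eventually_sum_sub_integral_lt {ε : ℝ} (hε : 0 < ε) :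
    ∀ᵐ z ∂Pr, ∀ᶠ n : ℕ in atTop, ∑ i, (X n i z - ∫ z', X n i z' ∂Pr) < ε * n := by
  have hr : Real.exp (-(ε ^ 2 / 2)) < 1 := Real.exp_lt_one_iff.mpr (neg_neg_of_pos (by positivity))
  have hsummable := (summable_geometric_of_lt_one (Real.exp_pos _).le hr).tsum_ofReal_ne_top
  have hae := ae_eventually_notMem (μ := Pr)
    (s := fun n : ℕ => {z | ε * n ≤ ∑ i, (X n i z - ∫ z', X n i z' ∂Pr)})
    (ne_top_of_le_ne_top hsummable <| ENNReal.tsum_le_tsum fun n => by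
      rw [← ofReal_measureReal (measure_ne_top _ _)]
      exact ENNReal.ofReal_le_ofReal
        (measureReal_sum_sub_integral_ge_le (hX n) (hX1 n) (hind n) hε.le))
  filter_upwards [hae] with z hz
  filter_upwards [hz] with n hn
  simpa using hn

-- No assumption on the joint law of different rows: Hoeffding's bound is summable, so that the
-- first Borel–Cantelli lemma suffices.
lemma ae_tendsto_inv_mul_sum_sub_integral :
    ∀ᵐ z ∂Pr, Tendsto (fun n : ℕ => (n : ℝ)⁻¹ * ∑ i, (X n i z - ∫ z', X n i z' ∂Pr)) atTop
      (𝓝 0) := by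
  have hupper : ∀ᵐ z ∂Pr, ∀ k : ℕ, ∀ᶠ n : ℕ in atTop,
      ∑ i, (X n i z - ∫ z', X n i z' ∂Pr) < 1 / (k + 1 : ℝ) * n :=
    ae_all_iff.mpr fun k => ae_eventually_sum_sub_integral_lt hX hX1 hind (by positivity)
  have hlower : ∀ᵐ z ∂Pr, ∀ k : ℕ, ∀ᶠ n : ℕ in atTop,
      ∑ i, (-X n i z - ∫ z', -X n i z' ∂Pr) < 1 / (k + 1 : ℝ) * n :=
    ae_all_iff.mpr fun k => ae_eventually_sum_sub_integral_lt (X := fun n i z => -X n i z)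
      (fun n i => (hX n i).neg) (fun n i z => by simpa using hX1 n i z)
      (fun n => (hind n).comp (fun _ x => -x) fun _ => measurable_neg) (by positivity)
  filter_upwards [hupper, hlower] with z hz_upper hz_lower
  refine tendsto_zero_of_forall_eventually_lt fun k => ?_
  filter_upwards [hz_upper k, hz_lower k, eventually_gt_atTop 0] with n h_upper h_lower hn
  have hn' : (0 : ℝ) < n := by exact_mod_cast hn
  simp only [integral_neg, ← neg_sub', Finset.sum_neg_distrib] at h_lower
  rw [abs_mul, abs_of_pos (inv_pos.mpr hn'), inv_mul_lt_iff₀ hn', abs_lt]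
  constructor <;> linarith

end TriangularArray

namespace IsSampled

variable {Ω : Type*} [MeasurableSpace Ω] {Pr : Measure Ω} [IsProbabilityMeasure Pr] {g : ℝ → ℝ}
  {q : Phase → ℝ → I → ℝ} {ξ : (n : ℕ) → Fin n → I} {ω : ℕ → Ω → ℝ}
  {θ₀ : (n : ℕ) → Fin n → Ω → Phase} (hs : IsSampled Pr g q ξ ω θ₀) (h : IsInitialDensity g q)
  (hξ : Equidistributed ξ)
include hs h hξ

theorem ae_tendsto_integral_empiricalMeasure {f : G → ℝ} (hf : Continuous f)
    (hf1 : ∀ P, |f P| ≤ 1) :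
    ∀ᵐ z ∂Pr, Tendsto (fun n : ℕ => ∫ P, f P
      ∂(empiricalMeasure fun i : Fin n => (θ₀ n i z, ω i z, ξ n i))) atTop
      (𝓝 (∫ P, f P ∂(initialLaw g q))) := by
  have := h.isProbabilityMeasure_initialLaw
  have hfx (x : I) : Continuous fun p : Phase × ℝ => f (p.1, p.2, x) := hf.comp (by fun_prop)
  have hmean (n : ℕ) (i : Fin n) : ∫ z, f (θ₀ n i z, ω i z, ξ n i) ∂Pr =
      ∫ p : Phase × ℝ, f (p.1, p.2, ξ n i) ∂(pairLaw g q (ξ n i)) := by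
    rw [← hs.map_pair_apply_eq h n i, integral_map (hs.measurable_pair n i).aemeasurable
      (hfx _).aestronglyMeasurable]
  have hmeans : Tendsto (fun n : ℕ => (n : ℝ)⁻¹ * ∑ i : Fin n,
      ∫ z, f (θ₀ n i z, ω i z, ξ n i) ∂Pr) atTop (𝓝 (∫ P, f P ∂(initialLaw g q))) := by
    simp_rw [hmean]
    rw [h.integral_initialLaw (.of_bound hf.aestronglyMeasurable 1 (Eventually.of_forall hf1))]
    exact hξ ⟨_, h.continuous_integral_pairLaw hf hf1⟩
  have hdeviation := ae_tendsto_inv_mul_sum_sub_integral (Pr := Pr)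
    (X := fun n i z => f (θ₀ n i z, ω i z, ξ n i))
    (fun n i => (hfx _).measurable.comp (hs.measurable_pair n i)) (fun _ _ _ => hf1 _)
    fun n => (hs.iIndepFun_pair h n).comp (fun i p => f (p.1, p.2, ξ n i))
      fun i => (hfx _).measurable
  filter_upwards [hdeviation] with z hz
  refine (zero_add (∫ P, f P ∂(initialLaw g q)) ▸ hz.add hmeans).congr fun n => ?_
  rw [integral_empiricalMeasure, ← mul_add, Finset.sum_sub_distrib, sub_add_cancel]

theorem ae_tendsto_blDist_initialLaw :
    ∀ᵐ z ∂Pr, Tendsto (fun n : ℕ => blDist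
      (empiricalMeasure fun i : Fin n => (θ₀ n i z, ω i z, ξ n i)) (initialLaw g q)) atTop
      (𝓝 0) := by
  have := h.isProbabilityMeasure_initialLaw
  choose t φ hφc hφ1 hφ using fun k : ℕ =>
    exists_finite_observables (initialLaw g q) (ε := 1 / (2 * (k + 1 : ℝ))) (by positivity)
  have hall := ae_all_iff.mpr fun k => ae_all_iff.mpr fun j =>
    hs.ae_tendsto_integral_empiricalMeasure h hξ (hφc k j) (hφ1 k j)
  filter_upwards [hall] with z hz
  refine tendsto_zero_of_forall_eventually_lt fun k => ?_
  have hobservables : Tendsto (fun n : ℕ => 2 * ∑ j, |∫ P, φ k j P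
      ∂(empiricalMeasure fun i : Fin n => (θ₀ n i z, ω i z, ξ n i)) -
      ∫ P, φ k j P ∂(initialLaw g q)|) atTop (𝓝 0) := by
    simpa using (tendsto_finsetSum (s := Finset.univ) (fun j _ =>
      ((hz k j).sub_const (∫ P, φ k j P ∂(initialLaw g q))).abs)).const_mul 2
  filter_upwards [hobservables.eventually_lt_const (by positivity : 0 < 1 / (2 * (k + 1 : ℝ))),
    eventually_ne_atTop 0] with n hn hn0
  have := isProbabilityMeasure_empiricalMeasure hn0 fun i : Fin n => (θ₀ n i z, ω i z, ξ n i)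
  rw [abs_of_nonneg (blDist_nonneg _ _)]
  calc _ ≤ _ := hφ k _
    _ < 1 / (2 * (k + 1 : ℝ)) + 1 / (2 * (k + 1 : ℝ)) := add_lt_add_left hn _
    _ = 1 / (k + 1 : ℝ) := by field_simp; norm_num

end IsSampled

/-! ### The mean-field flow -/

section VolterraEquation

lemma abs_integral_le_of_abs_le_exp_of_nonneg {f : ℝ → ℝ} {l c t : ℝ} (hl : 0 < l)
    (h : ∀ s, |f s| ≤ c * Real.exp (l * |s|)) (ht : 0 ≤ t) :
    |∫ s in (0 : ℝ)..t, f s| ≤ c / l * Real.exp (l * t) := by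
  have hc : 0 ≤ c := by simpa using (abs_nonneg _).trans (h 0)
  have hderiv (s : ℝ) :
      HasDerivAt (fun s => c / l * Real.exp (l * s)) (c * Real.exp (l * s)) s := by
    refine ((((hasDerivAt_id s).const_mul l).exp).const_mul (c / l)).congr_deriv ?_
    simp only [id, mul_one]
    field_simp
  have hint : IntervalIntegrable (fun s => c * Real.exp (l * s)) volume 0 t :=
    (by fun_prop : Continuous fun s => c * Real.exp (l * s)).intervalIntegrable _ _
  calc |∫ s in (0 : ℝ)..t, f s|
      ≤ ∫ s in (0 : ℝ)..t, c * Real.exp (l * s) :=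
        intervalIntegral.norm_integral_le_of_norm_le (f := f) ht
          (Eventually.of_forall fun s hs => by simpa [abs_of_pos hs.1] using h s) hint
    _ = c / l * Real.exp (l * t) - c / l * Real.exp (l * 0) :=
        intervalIntegral.integral_eq_sub_of_hasDerivAt (fun s _ => hderiv s) hint
    _ ≤ c / l * Real.exp (l * t) := sub_le_self _ (by positivity)

lemma abs_integral_le_of_abs_le_exp {f : ℝ → ℝ} {l c : ℝ} (hl : 0 < l)
    (h : ∀ s, |f s| ≤ c * Real.exp (l * |s|)) (t : ℝ) :
    |∫ s in (0 : ℝ)..t, f s| ≤ c / l * Real.exp (l * |t|) := by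
  rcases le_total 0 t with ht | ht
  · rw [abs_of_nonneg ht]
    exact abs_integral_le_of_abs_le_exp_of_nonneg hl h ht
  · have hreflect := abs_integral_le_of_abs_le_exp_of_nonneg hl (f := fun s => f (-s))
      (fun s => by simpa using h (-s)) (neg_nonneg.mpr ht)
    rwa [intervalIntegral.integral_comp_neg, neg_neg, neg_zero, intervalIntegral.integral_symm,
      abs_neg, ← abs_of_nonpos ht] at hreflect

variable {X : Type*} [TopologicalSpace X]

/-- The primitive in the time variable that vanishes at time `0`. -/
def timePrimitive (w : C(ℝ × X, ℝ)) : C(ℝ × X, ℝ) where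
  toFun q := ∫ s in (0 : ℝ)..q.1, w (s, q.2)
  continuous_toFun := intervalIntegral.continuous_parametric_intervalIntegral_of_continuous
    (f := fun (q : ℝ × X) s => w (s, q.2)) (by fun_prop) continuous_fst

/-- Multiplication by the exponential weight `exp (l |t|)`, which makes the Volterra operator a
contraction for the supremum norm. -/
def expWeight (l : ℝ) (u : C(ℝ × X, ℝ)) : C(ℝ × X, ℝ) :=
  ⟨fun q => Real.exp (l * |q.1|) * u q, by fun_prop⟩

lemma expWeight_expWeight_neg (l : ℝ) (u : C(ℝ × X, ℝ)) :
    expWeight l (expWeight (-l) u) = u := by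
  ext q
  simp [expWeight, ← mul_assoc, ← Real.exp_add]

lemma expWeight_sub (l : ℝ) (u v : C(ℝ × X, ℝ)) :
    expWeight l (u - v) = expWeight l u - expWeight l v := by
  ext q
  exact mul_sub _ _ _

lemma timePrimitive_sub (u v : C(ℝ × X, ℝ)) :
    timePrimitive (u - v) = timePrimitive u - timePrimitive v := by
  ext q
  have hint (w : C(ℝ × X, ℝ)) : IntervalIntegrable (fun s => w (s, q.2)) volume 0 q.1 :=
    (by fun_prop : Continuous fun s => w (s, q.2)).intervalIntegrable _ _
  exact intervalIntegral.integral_sub (hint u) (hint v)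

lemma abs_expWeight_neg_timePrimitive_le {l c : ℝ} (hl : 0 < l) {w : C(ℝ × X, ℝ)}
    (h : ∀ q, |w q| ≤ c * Real.exp (l * |q.1|)) (q : ℝ × X) :
    |expWeight (-l) (timePrimitive w) q| ≤ c / l :=
  calc |expWeight (-l) (timePrimitive w) q|
      = Real.exp (-l * |q.1|) * |∫ s in (0 : ℝ)..q.1, w (s, q.2)| :=
        (abs_mul _ _).trans (by rw [abs_of_pos (Real.exp_pos _)]; rfl)
    _ ≤ Real.exp (-l * |q.1|) * (c / l * Real.exp (l * |q.1|)) := by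
        gcongr
        exact abs_integral_le_of_abs_le_exp hl (fun s => h (s, q.2)) q.1
    _ = c / l * (Real.exp (-l * |q.1|) * Real.exp (l * |q.1|)) := by ring
    _ = c / l := by rw [← Real.exp_add]; simp

theorem exists_eq_timePrimitive {H : C(ℝ × X, ℝ) → C(ℝ × X, ℝ)} {M L : ℝ}
    (hM : ∀ u q, |H u q| ≤ M) (hL₀ : 0 ≤ L)
    (hL : ∀ u v t d, (∀ x, |u (t, x) - v (t, x)| ≤ d) →
      ∀ x, |H u (t, x) - H v (t, x)| ≤ L * d) :
    ∃ u, u = timePrimitive (H u) := by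
  set l := 2 * L + 1
  have hl : 0 < l := by positivity
  have hbound (u : C(ℝ × X, ℝ)) (q : ℝ × X) : |expWeight (-l) (timePrimitive (H u)) q| ≤ M / l := by
    refine abs_expWeight_neg_timePrimitive_le hl (fun q => (hM u q).trans ?_) q
    exact le_mul_of_one_le_right ((abs_nonneg _).trans (hM u q)) (Real.one_le_exp (by positivity))
  let Γ (v : BoundedContinuousFunction (ℝ × X) ℝ) : BoundedContinuousFunction (ℝ × X) ℝ :=
    .ofNormedAddCommGroup _ (expWeight (-l) (timePrimitive (H (expWeight l v)))).continuous _
      (hbound _)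
  have hΓ : ContractingWith (1 / 2) Γ := by
    refine ⟨NNReal.half_lt_self one_ne_zero, LipschitzWith.of_dist_le_mul fun u v => ?_⟩
    refine (BoundedContinuousFunction.dist_le (by positivity)).mpr fun q => ?_
    have hH (q : ℝ × X) : |(H (expWeight l u) - H (expWeight l v)) q| ≤
        L * dist u v * Real.exp (l * |q.1|) := by
      rw [mul_assoc]
      refine hL _ _ q.1 _ (fun x => ?_) q.2
      calc |Real.exp (l * |q.1|) * u (q.1, x) - Real.exp (l * |q.1|) * v (q.1, x)|
          = |u (q.1, x) - v (q.1, x)| * Real.exp (l * |q.1|) := by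
            rw [← mul_sub, abs_mul, abs_of_pos (Real.exp_pos _), mul_comm]
        _ ≤ dist u v * Real.exp (l * |q.1|) := by
            gcongr
            exact BoundedContinuousFunction.dist_coe_le_dist (f := u) (g := v) (q.1, x)
    calc dist (Γ u q) (Γ v q)
        = |expWeight (-l) (timePrimitive (H (expWeight l u) - H (expWeight l v))) q| := by
          rw [timePrimitive_sub, expWeight_sub]
          rfl
      _ ≤ L * dist u v / l := abs_expWeight_neg_timePrimitive_le hl hH q
      _ = L / l * dist u v := by ring
      _ ≤ 1 / 2 * dist u v := by
          refine mul_le_mul_of_nonneg_right ?_ dist_nonneg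
          rw [div_le_div_iff₀ hl two_pos]
          linarith
      _ = _ := by norm_num
  have : Nonempty (BoundedContinuousFunction (ℝ × X) ℝ) := ⟨0⟩
  set v := ContractingWith.fixedPoint Γ hΓ
  refine ⟨expWeight l v, ?_⟩
  have hv : (v : C(ℝ × X, ℝ)) = expWeight (-l) (timePrimitive (H (expWeight l v))) :=
    (congrArg _ hΓ.fixedPoint_isFixedPt.eq).symm
  conv_lhs => rw [hv]
  exact expWeight_expWeight_neg _ _

end VolterraEquation

/-- The transformation of `G` that rotates the phase of `P` by `y P`. -/
def shiftPhase (y : G → ℝ) (P : G) : G := (P.1 + (y P : Phase), P.2)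

/-- `y` is the phase displacement along the characteristics of the mean-field equation with initial
measure `m`: the characteristic from `P` is at `shiftPhase (y t) P` at time `t`, and the measure at
time `t` is the image of `m` under the characteristics. -/
structure IsMeanFieldFlow (K : ℝ) (W : I → I → ℝ) (m : Measure G) (y : ℝ → G → ℝ) : Prop where
  continuous : Continuous fun q : ℝ × G => y q.1 q.2
  zero : ∀ P, y 0 P = 0
  hasDerivAt : ∀ t P, HasDerivAt (fun t => y t P)
    (vel K W (m.map (shiftPhase (y t))) (shiftPhase (y t) P)) t

section ShiftPhase

lemma continuous_shiftPhase {y : G → ℝ} (hy : Continuous y) : Continuous (shiftPhase y) :=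
  (continuous_fst.add ((AddCircle.continuous_mk' _).comp hy)).prodMk continuous_snd

lemma continuous_shiftPhase_uncurry {y : ℝ → G → ℝ} (hy : Continuous fun q : ℝ × G => y q.1 q.2) :
    Continuous fun q : ℝ × G => shiftPhase (y q.1) q.2 :=
  ((continuous_fst.comp continuous_snd).add ((AddCircle.continuous_mk' _).comp hy)).prodMk
    (continuous_snd.comp continuous_snd)

lemma dist_shiftPhase_le (y y' : G → ℝ) (P : G) :
    dist (shiftPhase y P).1 (shiftPhase y' P).1 ≤ |y P - y' P| := by
  simpa [shiftPhase] using dist_add_coe_le P.1 P.1 (y P) (y' P)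

variable {K : ℝ} {W : I → I → ℝ} {B : ℝ} {m : Measure G}

lemma drift_map_shiftPhase (hW : KernelBound W B) {y : G → ℝ} (hy : Continuous y) (P : G) :
    drift W (m.map (shiftPhase y)) P = ∫ Q, coupling W P (shiftPhase y Q) ∂m :=
  integral_map (continuous_shiftPhase hy).aemeasurable
    ((continuous_coupling hW).comp (Continuous.prodMk_right P)).aestronglyMeasurable

variable [IsProbabilityMeasure m]

lemma continuous_drift_shiftPhase (hW : KernelBound W B) {y : ℝ → G → ℝ}
    (hy : Continuous fun q : ℝ × G => y q.1 q.2) : Continuous fun q : ℝ × G =>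
      drift W (m.map (shiftPhase (y q.1))) (shiftPhase (y q.1) q.2) := by
  have hyt (t : ℝ) : Continuous (y t) := hy.comp (Continuous.prodMk_right t)
  have hshift := continuous_shiftPhase_uncurry hy
  simp_rw [fun q : ℝ × G => drift_map_shiftPhase (m := m) hW (hyt q.1)]
  refine continuous_of_dominated (bound := fun _ => B) (fun q => ?_)
    (fun q => Eventually.of_forall fun Q => abs_coupling_le hW _ _) (integrable_const B)
    (Eventually.of_forall fun Q => ?_)
  · exact ((continuous_coupling hW).comp
      (continuous_const.prodMk (continuous_shiftPhase (hyt q.1)))).aestronglyMeasurable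
  · exact (continuous_coupling hW).comp (hshift.prodMk
      (hshift.comp (f := fun q : ℝ × G => (q.1, Q)) (by fun_prop)))

lemma abs_drift_shiftPhase_sub_le (hW : KernelBound W B) {y y' : G → ℝ} (hy : Continuous y)
    (hy' : Continuous y') {d : ℝ} (h : ∀ P, |y P - y' P| ≤ d) (P : G) :
    |drift W (m.map (shiftPhase y)) (shiftPhase y P) -
      drift W (m.map (shiftPhase y')) (shiftPhase y' P)| ≤ 2 * B * d := by
  have hint {z : G → ℝ} (hz : Continuous z) :
      Integrable (fun Q => coupling W (shiftPhase z P) (shiftPhase z Q)) m :=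
    .of_bound ((continuous_coupling hW).comp
      (continuous_const.prodMk (continuous_shiftPhase hz))).aestronglyMeasurable B
      (Eventually.of_forall fun _ => abs_coupling_le hW _ _)
  rw [drift_map_shiftPhase hW hy, drift_map_shiftPhase hW hy', ← integral_sub (hint hy) (hint hy')]
  refine abs_integral_le_of_abs_le fun Q => (abs_coupling_sub_le hW _ _ _ _).trans ?_
  have hdist (P : G) : dist (shiftPhase y P).1 (shiftPhase y' P).1 ≤ d :=
    (dist_shiftPhase_le y y' P).trans (h P)
  have hpos (P : G) : |((shiftPhase y P).2.2 : ℝ) - (shiftPhase y' P).2.2| = 0 := by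
    simp [shiftPhase]
  rw [hpos, hpos]
  nlinarith [hdist P, hdist Q, hW.nonneg]

theorem exists_isMeanFieldFlow (K : ℝ) (m : Measure G) [IsProbabilityMeasure m]
    (hW : KernelBound W B) : ∃ y, IsMeanFieldFlow K W m y := by
  let y (u : C(ℝ × G, ℝ)) (t : ℝ) (P : G) : ℝ := t * P.2.1 + u (t, P)
  have hy (u : C(ℝ × G, ℝ)) : Continuous fun q : ℝ × G => y u q.1 q.2 := by fun_prop
  have hyt (u : C(ℝ × G, ℝ)) (t : ℝ) : Continuous (y u t) := (hy u).comp (Continuous.prodMk_right t)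
  let H (u : C(ℝ × G, ℝ)) : C(ℝ × G, ℝ) :=
    ⟨fun q => K * drift W (m.map (shiftPhase (y u q.1))) (shiftPhase (y u q.1) q.2),
      continuous_const.mul (continuous_drift_shiftPhase hW (hy u))⟩
  have hH_bound (u : C(ℝ × G, ℝ)) (q : ℝ × G) : |H u q| ≤ |K| * B := by
    have := Measure.isProbabilityMeasure_map (μ := m)
      (continuous_shiftPhase (hyt u q.1)).aemeasurable
    exact (abs_mul _ _).trans_le (by gcongr; exact abs_drift_le _ hW _)
  have hH_lip (u v : C(ℝ × G, ℝ)) (t d : ℝ) (h : ∀ P, |u (t, P) - v (t, P)| ≤ d) (P : G) :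
      |H u (t, P) - H v (t, P)| ≤ |K| * (2 * B) * d := by
    have hdrift := abs_drift_shiftPhase_sub_le (m := m) hW (hyt u t) (hyt v t) (d := d)
      (fun P => by simpa only [y, add_sub_add_left_eq_sub] using h P) P
    calc |H u (t, P) - H v (t, P)|
        = |K| * |drift W (m.map (shiftPhase (y u t))) (shiftPhase (y u t) P) -
            drift W (m.map (shiftPhase (y v t))) (shiftPhase (y v t) P)| := by
          rw [← abs_mul, mul_sub]; rfl
      _ ≤ |K| * (2 * B * d) := by gcongr
      _ = |K| * (2 * B) * d := by ring
  have hB := hW.nonneg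
  obtain ⟨u, hu⟩ := exists_eq_timePrimitive hH_bound (by positivity) hH_lip
  have hu_apply (t : ℝ) (P : G) : u (t, P) = ∫ s in (0 : ℝ)..t, H u (s, P) :=
    DFunLike.congr_fun hu (t, P)
  refine ⟨y u, hy u, fun P => by simp [y, hu_apply], fun t P => ?_⟩
  have hHc : Continuous fun s => H u (s, P) := by fun_prop
  have hderiv : HasDerivAt (fun t => u (t, P)) (H u (t, P)) t := by
    simp_rw [hu_apply]
    exact intervalIntegral.integral_hasDerivAt_right (hHc.intervalIntegrable _ _)
      (hHc.stronglyMeasurableAtFilter _ _) hHc.continuousAt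
  exact (((hasDerivAt_id t).mul_const P.2.1).add hderiv).congr_deriv (by rw [one_mul]; rfl)

end ShiftPhase

section AbsoluteContinuity

lemma quasiMeasurePreserving_coe_phase :
    Measure.QuasiMeasurePreserving fun r : ℝ => (r : Phase) where
  measurable := AddCircle.measurable_mk'
  absolutelyContinuous := by
    have h := (isAddFundamentalDomain_Ioc' Real.two_pi_pos 0).absolutelyContinuous_map
    rwa [(AddCircle.measurePreserving_mk (2 * π) 0).map_eq] at h

lemma volume_absolutelyContinuous_map_coe_phase :
    (volume : Measure Phase) ≪ volume.map fun r : ℝ => (r : Phase) := by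
  rw [← (AddCircle.measurePreserving_mk (2 * π) 0).map_eq]
  exact Measure.restrict_le_self.absolutelyContinuous.map AddCircle.measurable_mk'

lemma volume_preimage_eq_zero_of_antilipschitz {f : ℝ → ℝ} {c : NNReal}
    (hf : AntilipschitzWith c f) {A : Set ℝ} (hA : volume A = 0) : volume (f ⁻¹' A) = 0 := by
  have h := hf.hausdorffMeasure_preimage_le zero_le_one A
  rw [hausdorffMeasure_real, hA, mul_zero] at h
  exact nonpos_iff_eq_zero.mp h

end AbsoluteContinuity

namespace IsMeanFieldFlow

variable {K : ℝ} {W : I → I → ℝ} {B : ℝ} {m : Measure G} {y : ℝ → G → ℝ}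

lemma continuous_apply (h : IsMeanFieldFlow K W m y) (t : ℝ) : Continuous (y t) :=
  h.continuous.comp (Continuous.prodMk_right t)

lemma continuous_shiftPhase_apply (h : IsMeanFieldFlow K W m y) (t : ℝ) :
    Continuous (shiftPhase (y t)) :=
  continuous_shiftPhase (h.continuous_apply t)

lemma continuous_uncurry_shiftPhase (h : IsMeanFieldFlow K W m y) :
    Continuous fun q : ℝ × G => shiftPhase (y q.1) q.2 :=
  continuous_shiftPhase_uncurry h.continuous

lemma integral_map_shiftPhase (h : IsMeanFieldFlow K W m y) (t : ℝ) {f : G → ℝ}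
    (hf : Continuous f) : ∫ P, f P ∂(m.map (shiftPhase (y t))) = ∫ P, f (shiftPhase (y t) P) ∂m :=
  integral_map (h.continuous_shiftPhase_apply t).aemeasurable hf.aestronglyMeasurable

lemma hasDerivAt_lift (h : IsMeanFieldFlow K W m y) (t r : ℝ) (p : ℝ × I) :
    HasDerivAt (fun t => r + y t ((r : Phase), p))
      (vel K W (m.map (shiftPhase (y t))) (((r + y t ((r : Phase), p) : ℝ) : Phase), p)) t :=
  (h.hasDerivAt t ((r : Phase), p)).const_add r

variable [IsProbabilityMeasure m]

lemma isProbabilityMeasure_map (h : IsMeanFieldFlow K W m y) (t : ℝ) :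
    IsProbabilityMeasure (m.map (shiftPhase (y t))) :=
  Measure.isProbabilityMeasure_map (h.continuous_shiftPhase_apply t).aemeasurable

end IsMeanFieldFlow

lemma abs_vel_coe_sub_vel_coe_le {K : ℝ} {W : I → I → ℝ} {B : ℝ} {μ : Measure G}
    [IsProbabilityMeasure μ] (hW : KernelBound W B) (p : ℝ × I) (r r' : ℝ) :
    |vel K W μ ((r : Phase), p) - vel K W μ ((r' : Phase), p)| ≤ |K| * B * |r - r'| := by
  have hdist : dist (r : Phase) (r' : Phase) ≤ |r - r'| := by
    rw [dist_eq_norm, ← AddCircle.coe_sub]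
    exact norm_coe_phase_le _
  have hdrift := abs_drift_sub_le μ hW ((r : Phase), p) ((r' : Phase), p)
  rw [sub_self, abs_zero, add_zero] at hdrift
  calc |vel K W μ ((r : Phase), p) - vel K W μ ((r' : Phase), p)|
      = |K| * |drift W μ ((r : Phase), p) - drift W μ ((r' : Phase), p)| := by
        rw [vel, vel, add_sub_add_left_eq_sub, ← mul_sub, abs_mul]
    _ ≤ |K| * (B * |r - r'|) := by
        gcongr
        exact hdrift.trans (mul_le_mul_of_nonneg_left hdist hW.nonneg)
    _ = |K| * B * |r - r'| := (mul_assoc _ _ _).symm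

namespace IsMeanFieldFlow

variable {K : ℝ} {W : I → I → ℝ} {B : ℝ} {m : Measure G} [IsProbabilityMeasure m] {y : ℝ → G → ℝ}

-- Gronwall's inequality for the flow run backwards in time.
lemma exists_antilipschitzWith (h : IsMeanFieldFlow K W m y) (hW : KernelBound W B) {t : ℝ}
    (ht : 0 ≤ t) (p : ℝ × I) :
    ∃ c, AntilipschitzWith c fun r : ℝ => r + y t ((r : Phase), p) := by
  set L := Real.toNNReal (|K| * B)
  have hlip (s : ℝ) : LipschitzWith L fun r : ℝ =>
      -vel K W (m.map (shiftPhase (y (t - s)))) ((r : Phase), p) := by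
    have := h.isProbabilityMeasure_map (t - s)
    refine LipschitzWith.of_dist_le' fun r r' => ?_
    rw [dist_neg_neg]
    exact abs_vel_coe_sub_vel_coe_le hW p r r'
  have hderiv (r s : ℝ) : HasDerivAt (fun s => r + y (t - s) ((r : Phase), p))
      (-vel K W (m.map (shiftPhase (y (t - s))))
        (((r + y (t - s) ((r : Phase), p) : ℝ) : Phase), p)) s :=
    (h.hasDerivAt_lift (t - s) r p).comp_const_sub t s
  refine ⟨Real.toNNReal (Real.exp (L * t)), AntilipschitzWith.of_le_mul_dist fun r r' => ?_⟩
  have hgronwall := dist_le_of_trajectories_ODE (a := 0) (b := t) hlip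
    (fun s _ => (hderiv r s).continuousAt.continuousWithinAt)
    (fun s _ => (hderiv r s).hasDerivWithinAt)
    (fun s _ => (hderiv r' s).continuousAt.continuousWithinAt)
    (fun s _ => (hderiv r' s).hasDerivWithinAt) le_rfl t ⟨ht, le_rfl⟩
  simp only [sub_self, sub_zero, h.zero, add_zero] at hgronwall
  rwa [Real.coe_toNNReal _ (Real.exp_pos _).le, mul_comm]

theorem absolutelyContinuous_map (h : IsMeanFieldFlow K W m y) (hW : KernelBound W B)
    (hm : m ≪ volume) {t : ℝ} (ht : 0 ≤ t) : m.map (shiftPhase (y t)) ≪ volume := by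
  have hshift : Measurable (shiftPhase (y t)) := (h.continuous_shiftPhase_apply t).measurable
  refine Measure.AbsolutelyContinuous.mk fun A hA hA0 => ?_
  rw [Measure.map_apply hshift hA]
  refine hm ?_
  rw [Measure.volume_eq_prod, Measure.prod_apply_symm hA,
    lintegral_eq_zero_iff (measurable_measure_prodMk_right hA)] at hA0
  rw [Measure.volume_eq_prod, Measure.prod_apply_symm (hshift hA),
    lintegral_eq_zero_iff (measurable_measure_prodMk_right (hshift hA))]
  filter_upwards [hA0] with p hp
  obtain ⟨c, hc⟩ := h.exists_antilipschitzWith hW ht p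
  refine volume_absolutelyContinuous_map_coe_phase ?_
  rw [Measure.map_apply AddCircle.measurable_mk' (measurable_prodMk_right (hshift hA))]
  exact volume_preimage_eq_zero_of_antilipschitz hc
    (quasiMeasurePreserving_coe_phase.preimage_null hp)

lemma continuous_vel_shiftPhase (h : IsMeanFieldFlow K W m y) (hW : KernelBound W B) :
    Continuous fun q : ℝ × G =>
      vel K W (m.map (shiftPhase (y q.1))) (shiftPhase (y q.1) q.2) :=
  (by fun_prop : Continuous fun q : ℝ × G => q.2.2.1).add
    (continuous_const.mul (continuous_drift_shiftPhase hW h.continuous))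

lemma continuous_integral_map (h : IsMeanFieldFlow K W m y) (f : BoundedContinuousFunction G ℝ) :
    Continuous fun t => ∫ P, f P ∂(m.map (shiftPhase (y t))) := by
  simp_rw [h.integral_map_shiftPhase _ f.continuous]
  refine continuous_of_dominated (bound := fun _ => ‖f‖) (fun t => ?_)
    (fun t => Eventually.of_forall fun P => f.norm_coe_le_norm _) (integrable_const _)
    (Eventually.of_forall fun P => ?_)
  · exact (f.continuous.comp (h.continuous_shiftPhase_apply t)).aestronglyMeasurable
  · exact f.continuous.comp
      (h.continuous_uncurry_shiftPhase.comp (f := fun t : ℝ => (t, P)) (by fun_prop))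

variable {ψ : ℝ → Phase → ℝ → ℝ → ℝ}

lemma continuous_transportDeriv_shiftPhase (h : IsMeanFieldFlow K W m y) (hW : KernelBound W B)
    (hψ : IsTestFunction ψ) : Continuous fun q : ℝ × G => transportDeriv ψ
      (vel K W (m.map (shiftPhase (y q.1))) (shiftPhase (y q.1) q.2)) q.1
      (shiftPhase (y q.1) q.2) := by
  have hgraph : Continuous fun q : ℝ × G => (q.1, shiftPhase (y q.1) q.2) :=
    continuous_fst.prodMk h.continuous_uncurry_shiftPhase
  exact (hψ.continuous_deriv_time.comp hgraph).add
    ((h.continuous_vel_shiftPhase hW).mul (hψ.continuous_derivPhase.comp hgraph))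

lemma integral_transportDeriv_shiftPhase (h : IsMeanFieldFlow K W m y) (hW : KernelBound W B)
    (hψ : IsTestFunction ψ) (τ : ℝ) (P : G) :
    ∫ t in (0 : ℝ)..τ, transportDeriv ψ
        (vel K W (m.map (shiftPhase (y t))) (shiftPhase (y t) P)) t (shiftPhase (y t) P) =
      ψ τ (shiftPhase (y τ) P).1 P.2.1 P.2.2 - ψ 0 P.1 P.2.1 P.2.2 := by
  have hcont := (h.continuous_transportDeriv_shiftPhase hW hψ).comp
    (f := fun t : ℝ => (t, P)) (by fun_prop)
  obtain ⟨a, s, x⟩ := P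
  induction a using QuotientAddGroup.induction_on with
  | H r =>
    have hftc := intervalIntegral.integral_eq_sub_of_hasDerivAt
      (fun t _ => hasDerivAt_comp_phase hψ (h.hasDerivAt_lift t r (s, x)) s x)
      (hcont.intervalIntegrable 0 τ)
    rwa [h.zero, add_zero] at hftc

lemma integral_integral_transportDeriv (h : IsMeanFieldFlow K W m y) (hW : KernelBound W B)
    (hψ : IsTestFunction ψ) {τ : ℝ} (hτ : 0 ≤ τ) :
    ∫ t in (0 : ℝ)..τ, ∫ P, transportDeriv ψ (vel K W (m.map (shiftPhase (y t))) P) t P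
        ∂(m.map (shiftPhase (y t))) =
      ∫ P, (∫ t in (0 : ℝ)..τ, transportDeriv ψ
        (vel K W (m.map (shiftPhase (y t))) (shiftPhase (y t) P)) t (shiftPhase (y t) P)) ∂m := by
  have hcont := h.continuous_transportDeriv_shiftPhase hW hψ
  obtain ⟨R, hR⟩ := hψ.support
  obtain ⟨c, hc⟩ := exists_uniform_bound (T := τ) (R := R)
    (H := fun t P => transportDeriv ψ (vel K W (m.map (shiftPhase (y t))) (shiftPhase (y t) P)) t
      (shiftPhase (y t) P))
    hcont.continuousOn fun t P hP => transportDeriv_eq_zero hR _ t (P := shiftPhase (y t) P) hP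
  rw [← intervalIntegral_integral_swap]
  · refine intervalIntegral.integral_congr fun t _ => h.integral_map_shiftPhase t ?_
    have := h.isProbabilityMeasure_map t
    have hslice : Continuous fun P : G => (t, P) := Continuous.prodMk_right t
    exact (hψ.continuous_deriv_time.comp hslice).add
      ((continuous_vel K _ hW).mul (hψ.continuous_derivPhase.comp hslice))
  · rw [Set.uIoc_of_le hτ]
    refine .of_bound hcont.aestronglyMeasurable c ?_
    filter_upwards [Measure.quasiMeasurePreserving_fst.ae (ae_restrict_mem measurableSet_Ioc)]
      with q hq
    exact hc q.1 (Set.Ioc_subset_Icc_self hq) q.2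

theorem isMeasureSolution (h : IsMeanFieldFlow K W m y) (hW : KernelBound W B) (T : ℝ) :
    IsMeasureSolution K W T m fun t => m.map (shiftPhase (y t)) where
  prob t _ := h.isProbabilityMeasure_map t
  cont f := (h.continuous_integral_map f).continuousOn
  weak ψ hψ τ hτ := by
    obtain ⟨R, hR⟩ := hψ.support
    obtain ⟨c, hc⟩ := exists_uniform_bound (T := τ) (R := R)
      (H := fun t P => ψ t P.1 P.2.1 P.2.2) hψ.continuous.continuousOn fun t P => hR _ _ _ _
    have hint {t : ℝ} (ht : t ∈ Set.Icc 0 τ) :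
        Integrable (fun P => ψ t (shiftPhase (y t) P).1 P.2.1 P.2.2) m :=
      .of_bound ((hψ.continuous_apply t).comp
        (h.continuous_shiftPhase_apply t)).aestronglyMeasurable c
        (Eventually.of_forall fun P => hc t ht (shiftPhase (y t) P))
    have hint₀ : Integrable (fun P : G => ψ 0 P.1 P.2.1 P.2.2) m := by
      simpa [shiftPhase, h.zero] using hint ⟨le_rfl, hτ.1⟩
    rw [← sub_eq_iff_eq_add', h.integral_integral_transportDeriv hW hψ hτ.1,
      h.integral_map_shiftPhase τ (hψ.continuous_apply τ)]
    simp_rw [h.integral_transportDeriv_shiftPhase hW hψ τ]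
    exact (integral_sub (hint ⟨hτ.1, le_rfl⟩) hint₀).symm

end IsMeanFieldFlow

lemma densityMeasure_rnDeriv {μ : Measure G} [IsProbabilityMeasure μ] (h : μ ≪ volume) :
    densityMeasure (fun P => (μ.rnDeriv volume P).toReal) = μ := by
  conv_rhs => rw [← Measure.withDensity_rnDeriv_eq μ volume h]
  refine withDensity_congr_ae ?_
  filter_upwards [μ.rnDeriv_lt_top volume] with P hP
  exact ENNReal.ofReal_toReal hP.ne

theorem IsMeasureSolution.exists_isWeakSolution {K : ℝ} {W : I → I → ℝ} {T : ℝ} {ρ₀ : G → ℝ}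
    {μ : ℝ → Measure G} (hρ₀ : Measurable ρ₀) (hρ₀_nonneg : ∀ P, 0 ≤ ρ₀ P)
    (h : IsMeasureSolution K W T (densityMeasure ρ₀) μ) (hac : ∀ t ∈ Set.Icc 0 T, μ t ≪ volume) :
    ∃ ρ : ℝ → G → ℝ, IsWeakSolution K W T ρ₀ ρ := by
  let ρ : ℝ → G → ℝ := fun t P => ((μ t).rnDeriv volume P).toReal
  have hmeas (t : ℝ) : Measurable (ρ t) := (Measure.measurable_rnDeriv _ _).ennreal_toReal
  have hnonneg (t : ℝ) (P : G) : 0 ≤ ρ t P := ENNReal.toReal_nonneg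
  have hdensity {t : ℝ} (ht : t ∈ Set.Icc 0 T) : densityMeasure (ρ t) = μ t :=
    have := h.prob t ht
    densityMeasure_rnDeriv (hac t ht)
  have hint {t : ℝ} (ht : t ∈ Set.Icc 0 T) (f : G → ℝ) : ∫ P, f P * ρ t P = ∫ P, f P ∂(μ t) := by
    rw [← integral_densityMeasure (hmeas t) (hnonneg t), hdensity ht]
  refine ⟨ρ, ?_⟩
  constructor
  case measurable => exact fun t _ => hmeas t
  case nonneg => exact fun t _ => hnonneg t
  case integrable =>
    intro t ht
    have := h.prob t ht
    exact Measure.integrable_toReal_rnDeriv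
  case integral_eq_one =>
    intro t ht
    have := h.prob t ht
    simpa using hint ht fun _ => 1
  case weaklyContinuous => exact fun f => (h.cont f).congr fun t ht => hint ht _
  case weak =>
    intro ψ hψ τ hτ
    rw [hint hτ (fun P => ψ τ P.1 P.2.1 P.2.2), h.weak ψ hψ τ hτ,
      integral_densityMeasure hρ₀ hρ₀_nonneg]
    congr 1
    refine intervalIntegral.integral_congr fun t ht => ?_
    rw [Set.uIcc_of_le hτ.1] at ht
    have htT : t ∈ Set.Icc 0 T := ⟨ht.1, ht.2.trans hτ.2⟩
    simp_rw [velocity_eq_vel (hmeas t) (hnonneg t), hdensity htT]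
    exact (hint htT _).symm

/-! ### The mean-field limit -/

/-- A cutoff of the frequencies at `R + 2`. -/
def freqCutoff (R : ℕ) : ContDiffBump (0 : ℝ) := ⟨R + 1, R + 2, by positivity, by linarith⟩

lemma isCutoff_freqCutoff (R : ℕ) : IsCutoff (freqCutoff R) where
  contDiff := (freqCutoff R).contDiff
  nonneg _ := (freqCutoff R).nonneg
  le_one _ := (freqCutoff R).le_one
  support := ⟨R + 2, by positivity, fun s hs => (freqCutoff R).zero_of_le_dist <| by
    rw [Real.dist_eq, sub_zero]; exact hs.le⟩

lemma freqCutoff_eq_one {R : ℕ} {s : ℝ} (hs : |s| ≤ R) : freqCutoff R s = 1 := by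
  refine (freqCutoff R).one_of_mem_closedBall ?_
  rw [Metric.mem_closedBall, Real.dist_eq, sub_zero]
  exact hs.trans (lt_add_one (R : ℝ)).le

lemma tendsto_integral_freqCutoff (m : Measure G) [IsProbabilityMeasure m] :
    Tendsto (fun R : ℕ => ∫ P, freqCutoff R P.2.1 ∂m) atTop (𝓝 1) := by
  rw [show (1 : ℝ) = ∫ _ : G, 1 ∂m by simp]
  refine tendsto_integral_of_dominated_convergence (fun _ => 1)
    (fun R => (isCutoff_freqCutoff R).continuous_freq.aestronglyMeasurable) (integrable_const _)
    (fun R => Eventually.of_forall fun P => (isCutoff_freqCutoff R).abs_le_one _)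
    (Eventually.of_forall fun P => ?_)
  refine tendsto_const_nhds.congr' ?_
  filter_upwards [tendsto_natCast_atTop_atTop.eventually_ge_atTop |P.2.1|] with R hR
  exact (freqCutoff_eq_one hR).symm

section MeanFieldLimit

variable {K : ℝ} {W : I → I → ℝ} {B T : ℝ} {m : Measure G} [IsProbabilityMeasure m]
  {μ : ℝ → Measure G}

lemma cutDist_empiricalMeasure_le (hW : KernelBound W B) (hμ : IsMeasureSolution K W T m μ)
    {χ : ℝ → ℝ} (hχ : IsCutoff χ) {n : ℕ} (hn : n ≠ 0) {ξ : Fin n → I} {w : Fin n → ℝ}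
    {θ₀ : Fin n → Phase} {θ : Fin n → ℝ → Phase} (hθ : IsKuramotoSolution K W T ξ w θ₀ θ) {κ : ℝ}
    (hmκ : 1 - ∫ P, χ P.2.1 ∂m ≤ κ)
    (hνκ : 1 - ∫ P, χ P.2.1 ∂(empiricalMeasure fun i => (θ₀ i, w i, ξ i)) ≤ κ)
    {t : ℝ} (ht : t ∈ Set.Icc 0 T) :
    cutDist χ (μ t) (empiricalMeasure fun i => (θ i t, w i, ξ i)) ≤
      (cutDist χ m (empiricalMeasure fun i => (θ₀ i, w i, ξ i)) + 4 * |K| * B * κ * t) *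
        Real.exp ((1 + 4 * |K| * B) * t) := by
  have hinitial : cutDist χ (μ 0) (empiricalMeasure fun i => (θ i 0, w i, ξ i)) =
      cutDist χ m (empiricalMeasure fun i => (θ₀ i, w i, ξ i)) := by
    simp_rw [cutDist, hθ.1, hμ.integral_initial_eq (ht.1.trans ht.2) hχ (Subtype.prop _)]
  rw [← hinitial]
  refine cutDist_le_of_eulerConsistent
    (ν := fun t => empiricalMeasure fun i => (θ i t, w i, ξ i)) hW hχ hμ.prob
    (fun t _ => isProbabilityMeasure_empiricalMeasure hn _) (hμ.eulerConsistent hW hχ)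
    (IsKuramotoSolution.eulerConsistent hχ.abs_le_one hn hθ) (fun s hs => ?_) (fun s _ => ?_) ht
  · rwa [hμ.integral_cutoff_eq hχ hs]
  · simpa only [integral_empiricalMeasure] using hνκ

lemma blDist_empiricalMeasure_le (hW : KernelBound W B) (hμ : IsMeasureSolution K W T m μ)
    {χ : ℝ → ℝ} (hχ : IsCutoff χ) {n : ℕ} (hn : n ≠ 0) {ξ : Fin n → I} {w : Fin n → ℝ}
    {θ₀ : Fin n → Phase} {θ : Fin n → ℝ → Phase} (hθ : IsKuramotoSolution K W T ξ w θ₀ θ) {κ : ℝ}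
    (hκ : (1 - ∫ P, χ P.2.1 ∂m) +
      (1 - ∫ P, χ P.2.1 ∂(empiricalMeasure fun i => (θ₀ i, w i, ξ i))) = κ)
    {t : ℝ} (ht : t ∈ Set.Icc 0 T) :
    blDist (empiricalMeasure fun i => (θ i t, w i, ξ i)) (μ t) ≤
      (blDist (empiricalMeasure fun i => (θ₀ i, w i, ξ i)) m + κ + 4 * |K| * B * κ * T) *
        Real.exp ((1 + 4 * |K| * B) * T) + κ := by
  have hB := hW.nonneg
  set ν₀ := empiricalMeasure fun i => (θ₀ i, w i, ξ i) with hν₀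
  set ν := empiricalMeasure fun i => (θ i t, w i, ξ i) with hν
  have : IsProbabilityMeasure ν₀ := isProbabilityMeasure_empiricalMeasure hn _
  have : IsProbabilityMeasure ν := isProbabilityMeasure_empiricalMeasure hn _
  have := hμ.prob t ht
  have hm_tail := hχ.integral_freq_le_one m
  have hν₀_tail := hχ.integral_freq_le_one ν₀
  have hκ0 : 0 ≤ κ := by linarith
  have htails : (1 - ∫ P, χ P.2.1 ∂(μ t)) + (1 - ∫ P, χ P.2.1 ∂ν) = κ := by
    rw [← hκ, hμ.integral_cutoff_eq hχ ht, hν, hν₀]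
    simp only [integral_empiricalMeasure]
  calc blDist ν (μ t) ≤ cutDist χ (μ t) ν + κ := by
        rw [blDist_comm, ← htails]
        exact hχ.blDist_le_cutDist_add (μ t) ν
    _ ≤ (cutDist χ m ν₀ + 4 * |K| * B * κ * t) * Real.exp ((1 + 4 * |K| * B) * t) + κ := by
        gcongr
        exact cutDist_empiricalMeasure_le hW hμ hχ hn hθ (by linarith) (by linarith) ht
    _ ≤ (blDist ν₀ m + κ + 4 * |K| * B * κ * T) * Real.exp ((1 + 4 * |K| * B) * T) + κ := by
        have hcut : cutDist χ m ν₀ ≤ blDist ν₀ m + κ := by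
          rw [blDist_comm, ← hκ]
          exact hχ.cutDist_le_blDist_add m ν₀
        have hbl := blDist_nonneg ν₀ m
        have htT := ht.2
        have hT := ht.1.trans ht.2
        gcongr

lemma tendsto_iSup_blDist (hT : 0 ≤ T) (hW : KernelBound W B) (hμ : IsMeasureSolution K W T m μ)
    {ξ : (n : ℕ) → Fin n → I} {w : (n : ℕ) → Fin n → ℝ} {θ₀ : (n : ℕ) → Fin n → Phase}
    {θ : (n : ℕ) → Fin n → ℝ → Phase}
    (hθ : ∀ n, IsKuramotoSolution K W T (ξ n) (w n) (θ₀ n) (θ n))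
    (hdist : Tendsto (fun n : ℕ => blDist (empiricalMeasure fun i => (θ₀ n i, w n i, ξ n i)) m)
      atTop (𝓝 0))
    (hcutoff : ∀ R : ℕ, Tendsto (fun n : ℕ => ∫ P, freqCutoff R P.2.1
      ∂(empiricalMeasure fun i => (θ₀ n i, w n i, ξ n i))) atTop
      (𝓝 (∫ P, freqCutoff R P.2.1 ∂m))) :
    Tendsto (fun n : ℕ => ⨆ t : Set.Icc (0 : ℝ) T,
      blDist (empiricalMeasure fun i => (θ n i t, w n i, ξ n i)) (μ t)) atTop (𝓝 0) := by
  have : Nonempty (Set.Icc (0 : ℝ) T) := ⟨⟨0, le_rfl, hT⟩⟩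
  set bound : ℝ → ℝ → ℝ := fun d κ =>
    (d + κ + 4 * |K| * B * κ * T) * Real.exp ((1 + 4 * |K| * B) * T) + κ with hbound
  have hbound_cont : Continuous fun p : ℝ × ℝ => bound p.1 p.2 := by fun_prop
  have hbound_zero : bound 0 0 = 0 := by simp [hbound]
  have htail : Tendsto (fun R : ℕ => 1 - ∫ P, freqCutoff R P.2.1 ∂m) atTop (𝓝 0) := by
    simpa using (tendsto_integral_freqCutoff m).const_sub 1
  refine Metric.tendsto_nhds.mpr fun ε hε => ?_
  obtain ⟨R, hR⟩ : ∃ R : ℕ, bound 0 ((1 - ∫ P, freqCutoff R P.2.1 ∂m) +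
      (1 - ∫ P, freqCutoff R P.2.1 ∂m)) < ε := by
    have hlim := (hbound_cont.tendsto (0, 0)).comp
      (tendsto_const_nhds.prodMk_nhds (by simpa using htail.add htail))
    rw [hbound_zero] at hlim
    exact (hlim.eventually_lt_const hε).exists
  have hlim := (hbound_cont.tendsto _).comp <|
    hdist.prodMk_nhds (((hcutoff R).const_sub 1).const_add (1 - ∫ P, freqCutoff R P.2.1 ∂m))
  filter_upwards [hlim.eventually_lt_const hR, eventually_ne_atTop 0] with n hn hn0
  rw [Real.dist_eq, sub_zero, abs_of_nonneg (Real.iSup_nonneg fun _ => blDist_nonneg _ _)]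
  exact (ciSup_le fun t => blDist_empiricalMeasure_le hW hμ (isCutoff_freqCutoff R) hn0 (hθ n)
    rfl t.2).trans_lt hn

end MeanFieldLimit

section InitialDensity

variable {K : ℝ} {W : I → I → ℝ} {B T : ℝ} {g : ℝ → ℝ} {q : Phase → ℝ → I → ℝ}

theorem IsInitialDensity.exists_isWeakSolution (h : IsInitialDensity g q) (hW : KernelBound W B)
    (K T : ℝ) :
    ∃ ρ : ℝ → G → ℝ, IsWeakSolution K W T (fun P => q P.1 P.2.1 P.2.2 * g P.2.1) ρ := by
  have := h.isProbabilityMeasure_initialLaw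
  obtain ⟨y, hy⟩ := exists_isMeanFieldFlow K (initialLaw g q) hW
  exact (hy.isMeasureSolution hW T).exists_isWeakSolution h.measurable_density h.density_nonneg
    fun t ht => hy.absolutelyContinuous_map hW (withDensity_absolutelyContinuous volume _) ht.1

theorem IsSampled.ae_tendsto_iSup_blDist {Ω : Type*} [MeasurableSpace Ω] {Pr : Measure Ω}
    [IsProbabilityMeasure Pr] {ξ : (n : ℕ) → Fin n → I} {ω : ℕ → Ω → ℝ}
    {θ₀ : (n : ℕ) → Fin n → Ω → Phase} (hs : IsSampled Pr g q ξ ω θ₀)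
    (h : IsInitialDensity g q) (hξ : Equidistributed ξ) (hW : KernelBound W B) (hT : 0 ≤ T)
    {θ : (n : ℕ) → Ω → Fin n → ℝ → Phase}
    (hθ : ∀ n z, IsKuramotoSolution K W T (ξ n) (fun i => ω i z) (fun i => θ₀ n i z) (θ n z))
    {μ : ℝ → Measure G} (hμ : IsMeasureSolution K W T (initialLaw g q) μ) :
    ∀ᵐ z ∂Pr, Tendsto (fun n : ℕ => ⨆ t : Set.Icc (0 : ℝ) T,
      blDist (empiricalMeasure fun i : Fin n => (θ n z i t, ω i z, ξ n i)) (μ t)) atTop (𝓝 0) := by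
  have := h.isProbabilityMeasure_initialLaw
  have hcutoff := ae_all_iff.mpr fun R : ℕ =>
    hs.ae_tendsto_integral_empiricalMeasure h hξ (isCutoff_freqCutoff R).continuous_freq
      fun P => (isCutoff_freqCutoff R).abs_le_one P.2.1
  filter_upwards [hs.ae_tendsto_blDist_initialLaw h hξ, hcutoff] with z hz_dist hz_cutoff
  exact tendsto_iSup_blDist hT hW hμ (fun n => hθ n z) hz_dist hz_cutoff

end InitialDensity

end

end KuramotoMF

open KuramotoMF in
theorem corollary2p2_general
    (K : ℝ) (W : I → I → ℝ) (LW : ℝ)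
    (hWlip : ∀ x₁ y₁ x₂ y₂ : I, |W x₁ y₁ - W x₂ y₂| ≤
      LW * √(((x₁ : ℝ) - (x₂ : ℝ)) ^ 2 + ((y₁ : ℝ) - (y₂ : ℝ)) ^ 2))
    (ξ : (n : ℕ) → Fin n → I) (hξ : Equidistributed ξ)
    (g : ℝ → ℝ) (hg : Measurable g) (hg0 : ∀ s, 0 ≤ g s)
    (q : Phase → ℝ → I → ℝ) (hq : Measurable fun P : G => q P.1 P.2.1 P.2.2)
    (hq_pos : ∀ φ s, Continuous (q φ s)) (hq0 : ∀ φ s x, 0 ≤ q φ s x)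
    (hq1 : ∀ s x, ∫ φ, q φ s x = 1)
    {Ω : Type*} [MeasurableSpace Ω] (Pr : Measure Ω) [IsProbabilityMeasure Pr]
    (ω : ℕ → Ω → ℝ) (θ₀ : (n : ℕ) → Fin n → Ω → Phase)
    (hsample : IsSampled Pr g q ξ ω θ₀)
    (T : ℝ) (hT : 0 ≤ T)
    (θ : (n : ℕ) → Ω → Fin n → ℝ → Phase)
    (hθ : ∀ n z, IsKuramotoSolution K W T (ξ n) (fun i => ω i z) (fun i => θ₀ n i z) (θ n z)) :
    (∃ ρ : ℝ → G → ℝ,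
      IsWeakSolution K W T (fun P => q P.1 P.2.1 P.2.2 * g P.2.1) ρ) ∧
    ∀ ρ : ℝ → G → ℝ,
      IsWeakSolution K W T (fun P => q P.1 P.2.1 P.2.2 * g P.2.1) ρ →
      ∀ᵐ z ∂Pr, Tendsto
        (fun n : ℕ => ⨆ t : Set.Icc (0 : ℝ) T,
          blDist (empiricalMeasure (fun i : Fin n => (θ n z i t, ω i z, ξ n i)))
            (densityMeasure (ρ t)))
        atTop (𝓝 0) := by
  obtain ⟨B, hW⟩ := exists_kernelBound hWlip
  have hg_prob : IsProbabilityMeasure (freqLaw g) := by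
    rw [freqLaw, ← hsample.law_freq 0]
    exact Measure.isProbabilityMeasure_map (hsample.measurable_freq 0).aemeasurable
  have h : IsInitialDensity g q := ⟨hg, hg0, hg_prob, hq, hq0, hq1, hq_pos⟩
  refine ⟨h.exists_isWeakSolution hW K T, fun ρ hρ => ?_⟩
  exact hsample.ae_tendsto_iSup_blDist (μ := fun t => densityMeasure (ρ t)) h hξ hW hT hθ
    (hρ.isMeasureSolution h.measurable_density h.density_nonneg)

open KuramotoMF in
theorem corollary2p2
    (K : ℝ) (W : I → I → ℝ) (LW : ℝ)
    (hWsymm : ∀ x y, W x y = W y x)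
    (hWlip : ∀ x₁ y₁ x₂ y₂ : I, |W x₁ y₁ - W x₂ y₂| ≤
      LW * √(((x₁ : ℝ) - (x₂ : ℝ)) ^ 2 + ((y₁ : ℝ) - (y₂ : ℝ)) ^ 2))
    (ξ : (n : ℕ) → Fin n → I) (hξ : Equidistributed ξ)
    (g : ℝ → ℝ) (hg : Continuous g) (hg0 : ∀ s, 0 ≤ g s)
    (q : Phase → ℝ → I → ℝ)
    (hq : Continuous (fun P : G => q P.1 P.2.1 P.2.2))
    (hq0 : ∀ φ s x, 0 ≤ q φ s x)
    (hqunif : ∀ ε > 0, ∃ δ > 0, ∀ x₁ x₂ : I, |(x₁ : ℝ) - (x₂ : ℝ)| < δ →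
      ∀ φ s, |q φ s x₁ - q φ s x₂| < ε)
    (hq1 : ∀ s x, ∫ φ, q φ s x = 1)
    {Ω : Type*} [MeasurableSpace Ω] (Pr : Measure Ω) [IsProbabilityMeasure Pr]
    (ω : ℕ → Ω → ℝ) (θ₀ : (n : ℕ) → Fin n → Ω → Phase)
    (hsample : IsSampled Pr g q ξ ω θ₀)
    (T : ℝ) (hT : 0 < T)
    (θ : (n : ℕ) → Ω → Fin n → ℝ → Phase)
    (hθ : ∀ n z, IsKuramotoSolution K W T (ξ n) (fun i => ω i z) (fun i => θ₀ n i z) (θ n z)) :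
    (∃ ρ : ℝ → G → ℝ,
      IsWeakSolution K W T (fun P => q P.1 P.2.1 P.2.2 * g P.2.1) ρ) ∧
    ∀ ρ : ℝ → G → ℝ,
      IsWeakSolution K W T (fun P => q P.1 P.2.1 P.2.2 * g P.2.1) ρ →
      ∀ᵐ z ∂Pr, Tendsto
        (fun n : ℕ => ⨆ t : Set.Icc (0 : ℝ) T,
          blDist (empiricalMeasure (fun i : Fin n => (θ n z i t, ω i z, ξ n i)))
            (densityMeasure (ρ t)))
        atTop (𝓝 0) :=
  corollary2p2_general K W LW hWlip ξ hξ g hg.measurable hg0 q hq.measurable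
    (fun φ s => hq.comp (f := fun x : I => (φ, s, x)) (by fun_prop)) hq0 hq1 Pr ω θ₀ hsample T hT.le
    θ hθ
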